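/- **Conventions.** For real variables $w$, a property holds *generically* if there is a polynomial $p\not\equiv 0$ in $w$ such that it holds for all real $w$ with $p(w)\neq 0$. Let $n_1,n_2\ge 2$ and $\mathcal V=\mathbb R^{n_1\times n_2}$. For $u,v\in\mathcal V$ put $u\vee v=\frac12(u\otimes v+v\otimes u)$; for a subspace $U\subseteq\mathcal V$ put $S^2(U)=\operatorname{span}\{u\vee v:u,v\in U\}$; for $a<c$, $b<d$ put $E_{abcd}=e_{ab}\vee e_{cd}-e_{ad}\vee e_{cb}$, where the $e_{ij}$ are the matrix units. Elements of $\mathcal V\otimes\mathcal V$ are identified with $n_1n_2\times n_1n_2$ matrices, with the entrywise inner product. **The JLV algorithm** on a tensor $\mathcal T\in\mathbb R^{n_1\times n_2\times n_3}$ (the number of terms is not part of the input): 1. Compute a basis $u^1,\dots,u^r$ of the column span $U\subseteq\mathcal V$ of the flattening $T_{(i,j),k}=\mathcal T_{ijk}$. 2. Compute a basis $P_1,\dots,P_s$ of $S^2(U)\cap\operatorname{span}\{E_{abcd}:a<c,\ b<d\}^\perp$. 3. (Simultaneous diagonalization of $\sum_i e_i\otimes P_i$.) Choose $\alpha,\beta\in\mathbb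 R^s$, form $A=\sum_i\alpha_iP_i$ and $B=\sum_i\beta_iP_i$, and compute their Moore–Penrose inverses $A^+,B^+$. Compute eigenvectors $x_1,\dots,x_s$ of $AB^+$ for its nonzero real eigenvalues, which are to be $s$ distinct numbers $\mu_1,\dots,\mu_s$, and eigenvectors $y_1,\dots,y_s$ of $(A^+B)^\top$ for its nonzero real eigenvalues, which are to be $\mu_1^{-1},\dots,\mu_s^{-1}$. Solve $P_i=\sum_j z_{ji}\,x_j\otimes y_j$ $(i\le s)$ for the numbers $z_{ji}$. 4. Factor $x_l=\hat a^l\otimes\hat b^l$ and solve $\mathcal T=\sum_l x_l\otimes\hat c^l$ for $\hat c^1,\dots,\hat c^s\in\mathbb R^{n_3}$. Output $(\hat a^l,\hat b^l,\hat c^l)_{l\le s}$. If one of the steps is impossible, the algorithm fails; otherwise the run is *completed*. **Machine model.** A *real RAM* is a single program, independent of the dimensions, with integer index registers (constants, addition, truncated subtraction, comparison, bounded loops) and arrays of real cells (integer constants, $+,-,\times,\div$, comparison). It can also compute the $k$-th smallest real root of a polynomial of degree at most $d$ whose coefficients are stored in memory, at a cost of $d+1$ steps. Every other instruction, test and loop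 iteration costs one step. The input consists of $n_1,n_2,n_3$ and the entries of $\mathcal T$. **Theorem.** There are a real RAM program and a polynomial $q$ such that the following holds. On every tensor in $\mathbb R^{n_1\times n_2\times n_3}$, for all $n_1,n_2,n_3$, the program halts after at most $q(n_1+n_2+n_3)$ steps. Moreover, let $n_1,n_2\ge2$ and $$R\le\min\left\{\tfrac12(n_1-1)(n_2-2),\ n_3\right\}.$$ Then for generically chosen $a^l\in\mathbb R^{n_1}$, $b^l\in\mathbb R^{n_2}$, $c^l\in\mathbb R^{n_3}$ $(1\le l\le R)$ and $\mathcal T=\sum_{l=1}^R a^l\otimes b^l\otimes c^l$: - every completed run of the JLV algorithm on $\mathcal T$ recovers the components, that is, $s=R$ and there are a permutation $\pi$ of $[R]$ and nonzero scalars $\kappa_l,\nu_l$ with $\hat a^l=\kappa_l a^{\pi(l)}$, $\hat b^l=\nu_l b^{\pi(l)}$, $\hat c^l=(\kappa_l\nu_l)^{-1}c^{\pi(l)}$ for all $l$ (so the rank-1 terms are recovered up to ordering); - for every choice of the bases in steps 1 and 2 and generically chosen $(\alpha,\beta)$, there is a completed run of the JLV algorithm on $\mathcal T$ with these bases and this $(\alpha,\beta)$;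 - the program, on input $\mathcal T$, computes all the data of a completed run of the JLV algorithm on $\mathcal T$, and thus outputs the components in the above sense. -/

import Mathlib

namespace JLV

open scoped Matrix

/-! ### Generic properties -/

/-- A property of real vectors `w` holds generically if it holds off the zero set of some
polynomial that is not identically zero. -/
def Generically {σ : Type} (Q : (σ → ℝ) → Prop) : Prop :=
  ∃ p : MvPolynomial σ ℝ, p ≠ 0 ∧ ∀ w : σ → ℝ, MvPolynomial.eval w p ≠ 0 → Q w

/-- A property of the components `a¹,…,aᴿ ∈ ℝ^{n₁}`, `b¹,…,bᴿ ∈ ℝ^{n₂}`, `c¹,…,cᴿ ∈ ℝ^{n₃}`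
holds generically, the symbolic variables being all the `R (n₁ + n₂ + n₃)` coordinates. -/
def GenericComponents (n₁ n₂ n₃ R : ℕ)
    (Q : (Fin R → Fin n₁ → ℝ) → (Fin R → Fin n₂ → ℝ) → (Fin R → Fin n₃ → ℝ) → Prop) : Prop :=
  Generically fun w : Fin R × (Fin n₁ ⊕ (Fin n₂ ⊕ Fin n₃)) → ℝ =>
    Q (fun l i => w (l, Sum.inl i)) (fun l j => w (l, Sum.inr (Sum.inl j)))
      (fun l k => w (l, Sum.inr (Sum.inr k)))

/-! ### Tensors and the linear algebra of the algorithm -/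

/-- Tensors in `ℝ^{n₁ × n₂ × n₃}`. -/
abbrev Tensor (n₁ n₂ n₃ : ℕ) : Type := Fin n₁ → Fin n₂ → Fin n₃ → ℝ

/-- The space `ℝ^{m × n}` of matrices, as vectors indexed by pairs `(i, j)`. -/
abbrev Mat (m n : ℕ) : Type := Fin m × Fin n → ℝ

/-- The space `ℝ^{m × n} ⊗ ℝ^{m × n}`, as square matrices indexed by pairs `(i, j)`. -/
abbrev Mat2 (m n : ℕ) : Type := Matrix (Fin m × Fin n) (Fin m × Fin n) ℝ

/-- The tensor `∑ₗ aˡ ⊗ bˡ ⊗ cˡ`. -/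
def cpTensor {n₁ n₂ n₃ R : ℕ} (a : Fin R → Fin n₁ → ℝ) (b : Fin R → Fin n₂ → ℝ)
    (c : Fin R → Fin n₃ → ℝ) : Tensor n₁ n₂ n₃ :=
  fun i j k => ∑ l, a l i * b l j * c l k

/-- The column span of the flattening `T_{(i,j),k} = T_{ijk}`. -/
def colSpan {n₁ n₂ n₃ : ℕ} (T : Tensor n₁ n₂ n₃) : Submodule ℝ (Mat n₁ n₂) :=
  Submodule.span ℝ (Set.range fun (k : Fin n₃) (p : Fin n₁ × Fin n₂) => T p.1 p.2 k)

/-- The symmetric 2-tensor `u ∨ v = (u ⊗ v + v ⊗ u) / 2`. -/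
noncomputable def vee {m n : ℕ} (u v : Mat m n) : Mat2 m n :=
  (1 / 2 : ℝ) • Matrix.vecMulVec u v + (1 / 2 : ℝ) • Matrix.vecMulVec v u

/-- `S²(U) = span {u ∨ v : u, v ∈ U}`. -/
def symSquare {m n : ℕ} (U : Submodule ℝ (Mat m n)) : Submodule ℝ (Mat2 m n) :=
  Submodule.span ℝ {S | ∃ u ∈ U, ∃ v ∈ U, S = vee u v}

/-- `E_{abcd} = e_{ab} ∨ e_{cd} - e_{ad} ∨ e_{cb}`, the symmetric tensor of a `2 × 2` minor. -/
noncomputable def minorTensor {m n : ℕ} (a : Fin m) (b : Fin n) (c : Fin m) (d : Fin n) :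
    Mat2 m n :=
  vee (Pi.single (a, b) 1) (Pi.single (c, d) 1) - vee (Pi.single (a, d) 1) (Pi.single (c, b) 1)

/-- The inner product `⟨S, S'⟩ = ∑ S_{pq} S'_{pq}`, linear in `S`. -/
def pairing {m n : ℕ} (S' : Mat2 m n) : Mat2 m n →ₗ[ℝ] ℝ where
  toFun S := ∑ p, ∑ q, S p q * S' p q
  map_add' S S₂ := by simp [add_mul, Finset.sum_add_distrib]
  map_smul' t S := by simp [Finset.mul_sum, mul_assoc]

/-- `span {E_{abcd} : a < c, b < d}^⊥`. -/
noncomputable def minorsPerp (m n : ℕ) : Submodule ℝ (Mat2 m n) :=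
  ⨅ (a : Fin m) (b : Fin n) (c : Fin m) (d : Fin n) (_ : a < c) (_ : b < d),
    LinearMap.ker (pairing (minorTensor a b c d))

/-- The family `u` is a basis of the subspace `W`. -/
def IsBasisOf {r : ℕ} {V : Type} [AddCommGroup V] [Module ℝ V] (u : Fin r → V)
    (W : Submodule ℝ V) : Prop :=
  LinearIndependent ℝ u ∧ Submodule.span ℝ (Set.range u) = W

/-- `X` is the Moore–Penrose pseudo-inverse of the real square matrix `A`. -/
structure IsPseudoInverse {ι : Type} [Fintype ι] (A X : Matrix ι ι ℝ) : Prop where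
  mul_mul_left : A * X * A = A
  mul_mul_right : X * A * X = X
  symm_left : (A * X)ᵀ = A * X
  symm_right : (X * A)ᵀ = X * A

/-- `μ j`, `w j` (`j < s`) are the nonzero real eigenvalues of `M`, listed without repetition,
and eigenvectors for them. -/
structure IsNonzeroEigensystem {ι : Type} [Fintype ι] {s : ℕ} (M : Matrix ι ι ℝ)
    (μ : Fin s → ℝ) (w : Fin s → ι → ℝ) : Prop where
  eigenvalue_ne_zero : ∀ j, μ j ≠ 0
  injective : Function.Injective μ
  eigenvector_ne_zero : ∀ j, w j ≠ 0
  mulVec_eq : ∀ j, M *ᵥ w j = μ j • w j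
  complete : ∀ (ν : ℝ) (v : ι → ℝ), ν ≠ 0 → v ≠ 0 → M *ᵥ v = ν • v → ∃ j, μ j = ν

/-! ### The JLV algorithm -/

/-- Everything that is computed in one run of the algorithm on an `n₁ × n₂ × n₃` tensor. -/
structure Transcript (n₁ n₂ n₃ r s : ℕ) where
  /-- a basis of the column span `U` of the flattening -/
  u : Fin r → Mat n₁ n₂
  /-- a basis of `S²(U) ∩ span {E_{abcd}}^⊥` -/
  P : Fin s → Mat2 n₁ n₂
  /-- the coefficients of the first contraction -/
  α : Fin s → ℝ
  /-- the coefficients of the second contraction -/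
  β : Fin s → ℝ
  /-- the pseudo-inverse of the first contraction -/
  Ainv : Mat2 n₁ n₂
  /-- the pseudo-inverse of the second contraction -/
  Binv : Mat2 n₁ n₂
  /-- eigenvalues -/
  μ : Fin s → ℝ
  /-- eigenvectors; these are the recovered rank-1 matrices -/
  x : Fin s → Mat n₁ n₂
  /-- the matching eigenvectors in the other mode -/
  y : Fin s → Mat n₁ n₂
  /-- coefficients in the remaining mode -/
  z : Fin s → Fin s → ℝ
  /-- output: first factors -/
  a : Fin s → Fin n₁ → ℝ
  /-- output: second factors -/
  b : Fin s → Fin n₂ → ℝ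
  /-- output: third factors -/
  c : Fin s → Fin n₃ → ℝ

namespace Transcript

variable {n₁ n₂ n₃ r s : ℕ}

/-- The contraction `∑ᵢ αᵢ Pᵢ` of the tensor `∑ᵢ eᵢ ⊗ Pᵢ`. -/
def A (t : Transcript n₁ n₂ n₃ r s) : Mat2 n₁ n₂ := ∑ i, t.α i • t.P i

/-- The contraction `∑ᵢ βᵢ Pᵢ` of the tensor `∑ᵢ eᵢ ⊗ Pᵢ`. -/
def B (t : Transcript n₁ n₂ n₃ r s) : Mat2 n₁ n₂ := ∑ i, t.β i • t.P i

end Transcript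

/-- The transcript `t` records a completed run (one that does not end in failure) of the JLV
algorithm for decomposing the tensor `T`. -/
structure IsRun {n₁ n₂ n₃ r s : ℕ} (T : Tensor n₁ n₂ n₃) (t : Transcript n₁ n₂ n₃ r s) :
    Prop where
  /-- Flatten `T` and compute a basis of its column span `U`. -/
  basis : IsBasisOf t.u (colSpan T)
  /-- Compute a basis `P₁,…,Pₛ` of `S²(U) ∩ span {E_{abcd}}^⊥`. -/
  intersection : IsBasisOf t.P
    (symSquare (Submodule.span ℝ (Set.range t.u)) ⊓ minorsPerp n₁ n₂)
  /-- Simultaneous diagonalization of `∑ᵢ eᵢ ⊗ Pᵢ`: contract twice along the first mode, giving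
  `A` and `B`, and compute the pseudo-inverses `A⁺` and `B⁺`. -/
  pinvA : IsPseudoInverse t.A t.Ainv
  pinvB : IsPseudoInverse t.B t.Binv
  /-- Compute the eigenvectors of `A B⁺` and of `(A⁺ B)ᵀ` for the nonzero eigenvalues, and
  match those with reciprocal eigenvalues. -/
  eigenX : IsNonzeroEigensystem (t.A * t.Binv) t.μ t.x
  eigenY : IsNonzeroEigensystem (t.Ainv * t.B)ᵀ (fun j => (t.μ j)⁻¹) t.y
  /-- Solve the linear system `∑ᵢ eᵢ ⊗ Pᵢ = ∑ⱼ zⱼ ⊗ xⱼ ⊗ yⱼ` for the `zⱼ`. -/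
  solveZ : ∀ i, t.P i = ∑ j, t.z j i • Matrix.vecMulVec (t.x j) (t.y j)
  /-- Factor the recovered rank-1 matrices `xₗ = aˡ ⊗ bˡ`. -/
  factor : ∀ l i j, t.x l (i, j) = t.a l i * t.b l j
  /-- Solve the linear system `T = ∑ₗ xₗ ⊗ cˡ` for the third factors. -/
  solveC : ∀ i j k, T i j k = ∑ l, t.x l (i, j) * t.c l k

/-- The output of the run consists of the components `aˡ, bˡ, cˡ` up to a permutation and, in each
term, scalars of product `1`. In particular the rank-1 terms `aˡ ⊗ bˡ ⊗ cˡ` are recovered up to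
ordering. -/
def Recovers {n₁ n₂ n₃ r s R : ℕ} (t : Transcript n₁ n₂ n₃ r s) (a : Fin R → Fin n₁ → ℝ)
    (b : Fin R → Fin n₂ → ℝ) (c : Fin R → Fin n₃ → ℝ) : Prop :=
  ∃ π : Fin s ≃ Fin R, ∀ l, ∃ κ ν : ℝ, κ ≠ 0 ∧ ν ≠ 0 ∧
    t.a l = κ • a (π l) ∧ t.b l = ν • b (π l) ∧ t.c l = (κ * ν)⁻¹ • c (π l)

/-! ### Real RAM with step count -/

/-- A memory cell: an array name, and the index registers that hold its indices. -/
structure Cell where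
  arr : ℕ
  idx : List ℕ

/-- The four arithmetic operations. -/
inductive ArithOp
  | add | sub | mul | div

/-- Programs of a real RAM. Index registers hold natural numbers and are used for addressing and
loop control; memory cells hold real numbers and are organized in multi-dimensional arrays. The
only real constants are integers. -/
inductive Prog
  /-- index register `x := k` -/
  | idxConst (x k : ℕ)
  /-- index register `x := y + z` -/
  | idxAdd (x y z : ℕ)
  /-- index register `x := y - z`, truncated at `0` -/
  | idxSub (x y z : ℕ)
  /-- cell `dst := k` -/
  | const (dst : Cell) (k : ℤ)
  /-- cell `dst := a op b` -/
  | arith (op : ArithOp) (dst a b : Cell)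
  /-- cell `dst :=` the `k`-th smallest real root (from `0`, without multiplicity) of the
  polynomial of degree at most `d` whose `i`-th coefficient is the entry of the array `c` with
  last index `i`; the result is `0` if there is no such root. Here `d`, `k` are index registers. -/
  | root (dst c : Cell) (d k : ℕ)
  /-- sequential composition -/
  | seq (p q : Prog)
  /-- `if a ≤ b then p else q` on memory cells -/
  | ifLe (a b : Cell) (p q : Prog)
  /-- `if x < y then p else q` on index registers -/
  | ifIdxLt (x y : ℕ) (p q : Prog)
  /-- `for i = 0, …, x - 1 do p`, where `x` is read once, on entry -/
  | loop (i x : ℕ) (p : Prog)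

/-- The contents of the index registers and of the memory. -/
structure State where
  reg : ℕ → ℕ
  mem : ℕ → List ℕ → ℝ

namespace State

def setReg (st : State) (x k : ℕ) : State where
  reg := Function.update st.reg x k
  mem := st.mem

def get (st : State) (c : Cell) : ℝ := st.mem c.arr (c.idx.map st.reg)

def set (st : State) (c : Cell) (v : ℝ) : State where
  reg := st.reg
  mem := Function.update st.mem c.arr
    (Function.update (st.mem c.arr) (c.idx.map st.reg) v)

end State

noncomputable def ArithOp.eval : ArithOp → ℝ → ℝ → ℝ
  | .add, a, b => a + b
  | .sub, a, b => a - b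
  | .mul, a, b => a * b
  | .div, a, b => a / b

open Classical in
/-- The `k`-th smallest real root of `∑_{i ≤ d} (coef i) Xⁱ`, or `0` if there is none. -/
noncomputable def kthRoot (coef : ℕ → ℝ) (d k : ℕ) : ℝ :=
  ((∑ i ∈ Finset.range (d + 1),
    Polynomial.C (coef i) * Polynomial.X ^ i).roots.toFinset.sort (· ≤ ·)).getD k 0

open Classical in
/-- The final state and the number of steps of a program started in a given state. Every
instruction, every test and every loop iteration takes one step; root extraction takes one step
for each coefficient. -/
noncomputable def Prog.run : Prog → State → State × ℕ
  | .idxConst x k, st => (st.setReg x k, 1)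
  | .idxAdd x y z, st => (st.setReg x (st.reg y + st.reg z), 1)
  | .idxSub x y z, st => (st.setReg x (st.reg y - st.reg z), 1)
  | .const dst k, st => (st.set dst k, 1)
  | .arith op dst a b, st => (st.set dst (op.eval (st.get a) (st.get b)), 1)
  | .root dst c d k, st =>
      (st.set dst (kthRoot (fun i => st.mem c.arr (c.idx.map st.reg ++ [i])) (st.reg d)
        (st.reg k)), st.reg d + 1)
  | .seq p q, st =>
      let s₁ := p.run st
      let s₂ := q.run s₁.1
      (s₂.1, s₁.2 + s₂.2)
  | .ifLe a b p q, st =>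
      let s₁ := if st.get a ≤ st.get b then p.run st else q.run st
      (s₁.1, s₁.2 + 1)
  | .ifIdxLt x y p q, st =>
      let s₁ := if st.reg x < st.reg y then p.run st else q.run st
      (s₁.1, s₁.2 + 1)
  | .loop i x p, st =>
      Nat.rec (st, 1)
        (fun k acc =>
          let s₁ := p.run (acc.1.setReg i k)
          (s₁.1, acc.2 + s₁.2 + 1))
        (st.reg x)

/-- Input convention: registers `0, 1, 2` hold the dimensions and array `0` holds the entries of
the tensor; everything else is `0`. -/
def inputState {n₁ n₂ n₃ : ℕ} (T : Tensor n₁ n₂ n₃) : State where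
  reg
    | 0 => n₁
    | 1 => n₂
    | 2 => n₃
    | _ => 0
  mem
    | 0, [i, j, k] =>
        if h : i < n₁ ∧ j < n₂ ∧ k < n₃ then T ⟨i, h.1⟩ ⟨j, h.2.1⟩ ⟨k, h.2.2⟩ else 0
    | _, _ => 0

/-- Output convention: registers `3, 4` hold `r, s`, and arrays `1, …, 13` hold the data of the
run, the last three being the factors of the decomposition. -/
def readTranscript (n₁ n₂ n₃ : ℕ) (st : State) :
    Transcript n₁ n₂ n₃ (st.reg 3) (st.reg 4) where
  u l p := st.mem 1 [l, p.1, p.2]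
  P i p q := st.mem 2 [i, p.1, p.2, q.1, q.2]
  α i := st.mem 3 [i]
  β i := st.mem 4 [i]
  Ainv p q := st.mem 5 [p.1, p.2, q.1, q.2]
  Binv p q := st.mem 6 [p.1, p.2, q.1, q.2]
  μ j := st.mem 7 [j]
  x j p := st.mem 8 [j, p.1, p.2]
  y j p := st.mem 9 [j, p.1, p.2]
  z j i := st.mem 10 [j, i]
  a l i := st.mem 11 [l, i]
  b l j := st.mem 12 [l, j]
  c l k := st.mem 13 [l, k]

end JLV

/-!
Write `xˡ = aˡ ⊗ bˡ`, let `X` be the matrix with the columns `xˡ`, and let `R` be the number of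
terms.

**Why the components are recovered.** Two generic conditions carry the argument: the `xˡ` are
independent, and so are the tensors `(aˡ ∧ aᵏ) ⊗ (bˡ ∧ bᵏ)` for `l < k`. Since also `R ≤ n₃`, the
column span `U` of the flattening is the column span of `X`, and `S²(U)` consists of the matrices
`X S Xᵀ` with `S` symmetric. The minors vanish on each `xˡ ⊗ xˡ`, and on `xˡ ∨ xᵏ` they are the
coordinates of `(aˡ ∧ aᵏ) ⊗ (bˡ ∧ bᵏ)`; so the second condition forces `S` to be diagonal on the
orthogonal complement of the minors (`Good.mem_inter_iff`). Hence every `Pᵢ` is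
`X (diagonal Zᵢ) Xᵀ`, and `A = X (diagonal dα) Xᵀ`, `B = X (diagonal dβ) Xᵀ`. Let `L` be the
left inverse of `X`
for which `X L` is the orthogonal projection onto `U`. If no entry of `dα`, `dβ` is zero, then
`A⁺ = Lᵀ (diagonal dα⁻¹) L`, and likewise for `B`, so `A B⁺ = X (diagonal (dα / dβ)) L`: its
eigenvectors for simple nonzero eigenvalues are multiples of the `xˡ`. In any completed run the
`R` distinct nonzero eigenvalues give `A B⁺` rank `R`, which excludes zeros in `dα` and `dβ`; this
is `Good.recovers`. Conversely, a run is completed as soon as `dα`, `dβ` have no zeros and their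
ratios are distinct (`Good.isRun`), which holds for generic `α`, `β` because the matrix of the
`Zᵢ` is invertible (`Good.generically_exists_isRun`).

**Why the conditions are generic.** Independence of vectors that depend polynomially on parameters
is generic once it holds somewhere (`Generically.independent`). The witness divides the indices
into at most `n₁ - 1` blocks of size at most `r = ⌊n₂ / 2⌋`, which is where the bound on `R` is
used: `aˡ` is `e_{i+1} + l e₀` for `l` in block `i`, and `bˡ` is the moment vector
`(1, l, l², …)`. Two blocks together have at most `n₂` indices, so their `bˡ` have a dual
family, and wedge
products of functionals isolate one pair at a time (`witness_core`).

**The program.** Each linear-algebra step of the algorithm is the solution of a linear system, and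
all systems are solved by one routine, `addEq`, which maintains a basis of the solution space and
adds one equation at a time; the invariant is `Rep`. An inhomogeneous system is homogenized by an
extra coordinate `0` (`Rep.solve`). The program is deterministic, so it needs its own generic `α`,
`β`: it takes the rows `(0, 0)` and `(0, 1)` of the flattened tensor. The basis `Pᵢ` produced by
`Rep` is dual to `R` matrix entries, so the matrix of the `Zᵢ` is the inverse of the matrix of
these entries of the `xˡ ⊗ xˡ` (`sampleMatrix`), and `dα`, `dβ` become rational functions of the
components. They are nonzero with distinct ratios for generic components (`generic_coef`). The
eigenvalues are the roots of the minimal polynomial of `A B⁺` on `U`, whose coefficients solve a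
linear system in the powers of `A B⁺` (`charProg`), and since `A`, `B` are symmetric one may take
`yₗ = xₗ`.

**Running time.** The registers that bound loops in the main part are never written there, and
hold numbers at most `(n₁ + n₂ + n₃ + 1)⁴`. A program of this kind takes polynomially many steps
on any input (`run_le`, `jlvProg_cost`).
-/


namespace JLV

/-! ### Execution, frames and running time of programs -/

/-- Run the first program, then the second. -/
infixr:65 " ;; " => Prog.seq

namespace Prog

/-- The final state of a program, without the step count. -/
noncomputable def exec (p : Prog) (st : State) : State := (p.run st).1

/-- The state before iteration `m` of a loop with counter register `i` and body `p`. -/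
noncomputable def iter (p : Prog) (i : ℕ) (st : State) : ℕ → State
  | 0 => st
  | k + 1 => p.exec ((iter p i st k).setReg i k)

/-- The index registers that a program may change. -/
def wr : Prog → List ℕ
  | .idxConst x _ => [x]
  | .idxAdd x _ _ => [x]
  | .idxSub x _ _ => [x]
  | .const _ _ => []
  | .arith _ _ _ _ => []
  | .root _ _ _ _ => []
  | .seq p q => p.wr ++ q.wr
  | .ifLe _ _ p q => p.wr ++ q.wr
  | .ifIdxLt _ _ p q => p.wr ++ q.wr
  | .loop i _ p => i :: p.wr

/-- The arrays that a program may change. -/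
def wm : Prog → List ℕ
  | .idxConst _ _ => []
  | .idxAdd _ _ _ => []
  | .idxSub _ _ _ => []
  | .const d _ => [d.arr]
  | .arith _ d _ _ => [d.arr]
  | .root d _ _ _ => [d.arr]
  | .seq p q => p.wm ++ q.wm
  | .ifLe _ _ p q => p.wm ++ q.wm
  | .ifIdxLt _ _ p q => p.wm ++ q.wm
  | .loop _ _ p => p.wm

/-- The index registers that bound a loop or a degree in a program. -/
def bounds : Prog → List ℕ
  | .idxConst _ _ => []
  | .idxAdd _ _ _ => []
  | .idxSub _ _ _ => []
  | .const _ _ => []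
  | .arith _ _ _ _ => []
  | .root _ _ d _ => [d]
  | .seq p q => p.bounds ++ q.bounds
  | .ifLe _ _ p q => p.bounds ++ q.bounds
  | .ifIdxLt _ _ p q => p.bounds ++ q.bounds
  | .loop _ x p => x :: p.bounds

/-- A bound for the running time, as a polynomial in a bound for the registers `bounds p`. -/
noncomputable def costPoly : Prog → Polynomial ℕ
  | .idxConst _ _ => 1
  | .idxAdd _ _ _ => 1
  | .idxSub _ _ _ => 1
  | .const _ _ => 1
  | .arith _ _ _ _ => 1
  | .root _ _ _ _ => Polynomial.X + 1
  | .seq p q => p.costPoly + q.costPoly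
  | .ifLe _ _ p q => p.costPoly + q.costPoly + 1
  | .ifIdxLt _ _ p q => p.costPoly + q.costPoly + 1
  | .loop _ _ p => 1 + Polynomial.X * (p.costPoly + 1)

/-- All writes of the program to the array `d` are at cells whose `m`-th index is register `i`. -/
def writesAt (d m i : ℕ) : Prog → Bool
  | .idxConst _ _ => true
  | .idxAdd _ _ _ => true
  | .idxSub _ _ _ => true
  | .const c _ => c.arr != d || c.idx[m]? == some i
  | .arith _ c _ _ => c.arr != d || c.idx[m]? == some i
  | .root c _ _ _ => c.arr != d || c.idx[m]? == some i
  | .seq p q => p.writesAt d m i && q.writesAt d m i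
  | .ifLe _ _ p q => p.writesAt d m i && q.writesAt d m i
  | .ifIdxLt _ _ p q => p.writesAt d m i && q.writesAt d m i
  | .loop _ _ p => p.writesAt d m i

end Prog

open Prog

namespace State

@[simp] theorem setReg_reg (st : State) (x k r : ℕ) :
    (st.setReg x k).reg r = if r = x then k else st.reg r := by
  simp [setReg, Function.update_apply]

@[simp] theorem setReg_mem (st : State) (x k : ℕ) : (st.setReg x k).mem = st.mem := rfl

@[simp] theorem set_reg (st : State) (c : Cell) (v : ℝ) : (st.set c v).reg = st.reg := rfl

@[simp] theorem set_mem (st : State) (A : ℕ) (I : List ℕ) (v : ℝ) (a : ℕ) (idx : List ℕ) :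
    (st.set ⟨A, I⟩ v).mem a idx =
      if a = A ∧ idx = I.map st.reg then v else st.mem a idx := by
  by_cases h : a = A
  · subst h
    simp [set, Function.update_apply]
  · simp [set, h]

theorem set_mem_of_ne (st : State) (c : Cell) (v : ℝ) {a : ℕ} (h : a ≠ c.arr) :
    (st.set c v).mem a = st.mem a := by
  simp [set, h]

@[simp] theorem get_mk (st : State) (A : ℕ) (I : List ℕ) :
    st.get ⟨A, I⟩ = st.mem A (I.map st.reg) := rfl

end State

namespace Prog

@[simp] theorem exec_idxConst (x k : ℕ) (st : State) :
    (idxConst x k).exec st = st.setReg x k := rfl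

@[simp] theorem exec_idxAdd (x y z : ℕ) (st : State) :
    (idxAdd x y z).exec st = st.setReg x (st.reg y + st.reg z) := rfl

@[simp] theorem exec_idxSub (x y z : ℕ) (st : State) :
    (idxSub x y z).exec st = st.setReg x (st.reg y - st.reg z) := rfl

@[simp] theorem exec_const (d : Cell) (k : ℤ) (st : State) :
    (const d k).exec st = st.set d k := rfl

@[simp] theorem exec_arith (op : ArithOp) (d a b : Cell) (st : State) :
    (arith op d a b).exec st = st.set d (op.eval (st.get a) (st.get b)) := rfl

@[simp] theorem exec_root (d c : Cell) (e k : ℕ) (st : State) :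
    (root d c e k).exec st = st.set d (kthRoot
      (fun i => st.mem c.arr (c.idx.map st.reg ++ [i])) (st.reg e) (st.reg k)) := rfl

@[simp] theorem exec_seq (p q : Prog) (st : State) :
    (p ;; q).exec st = q.exec (p.exec st) := rfl

@[simp] theorem exec_ifLe (a b : Cell) (p q : Prog) (st : State) :
    (ifLe a b p q).exec st = if st.get a ≤ st.get b then p.exec st else q.exec st := by
  simp only [exec, run]
  split <;> rfl

@[simp] theorem exec_ifIdxLt (x y : ℕ) (p q : Prog) (st : State) :
    (ifIdxLt x y p q).exec st = if st.reg x < st.reg y then p.exec st else q.exec st := by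
  simp only [exec, run]
  split <;> rfl

theorem exec_loop (i x : ℕ) (p : Prog) (st : State) :
    (loop i x p).exec st = p.iter i st (st.reg x) := by
  simp only [exec, run]
  induction st.reg x with
  | zero => rfl
  | succ k ih => simp only [iter, exec, ← ih]

/-- `st'` agrees with `st` outside the registers and arrays that `p` may change. -/
structure Frame (p : Prog) (st st' : State) : Prop where
  reg : ∀ r, p.wr.contains r = false → st'.reg r = st.reg r
  mem : ∀ a, p.wm.contains a = false → st'.mem a = st.mem a

theorem frame_exec (p : Prog) (st : State) : Frame p st (p.exec st) := by
  have key : ∀ (p : Prog) (st : State), (∀ r ∉ p.wr, (p.exec st).reg r = st.reg r) ∧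
      (∀ a ∉ p.wm, (p.exec st).mem a = st.mem a) := by
    intro p
    induction p with
    | idxConst | idxAdd | idxSub => simp +contextual [wr]
    | const | arith | root => simp +contextual [wm, State.set_mem_of_ne]
    | seq p q hp hq => simp +contextual [wr, wm, hp, hq]
    | ifLe a b p q hp hq =>
      intro st; simp only [exec_ifLe]; split <;> simp +contextual [wr, wm, hp, hq]
    | ifIdxLt a b p q hp hq =>
      intro st; simp only [exec_ifIdxLt]; split <;> simp +contextual [wr, wm, hp, hq]
    | loop i x p hp =>
      intro st
      rw [exec_loop]
      induction st.reg x with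
      | zero => simp [iter]
      | succ k ih =>
        refine ⟨fun r hr => ?_, fun a ha => ?_⟩
        · rw [iter, (hp _).1 r (by simp_all [wr]), State.setReg_reg, if_neg (by simp_all [wr]),
            ih.1 r hr]
        · rw [iter, (hp _).2 a (by simp_all [wm]), State.setReg_mem, ih.2 a ha]
  exact ⟨fun r hr => (key p st).1 r (by simpa using hr),
    fun a ha => (key p st).2 a (by simpa using ha)⟩

theorem Frame.refl (p : Prog) (st : State) : Frame p st st := ⟨fun _ _ => rfl, fun _ _ => rfl⟩

theorem Frame.trans {p : Prog} {st₁ st₂ st₃ : State} (h : Frame p st₁ st₂) (h' : Frame p st₂ st₃) :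
    Frame p st₁ st₃ :=
  ⟨fun r hr => (h'.reg r hr).trans (h.reg r hr), fun a ha => (h'.mem a ha).trans (h.mem a ha)⟩

theorem frame_iter (p : Prog) (i x : ℕ) (st : State) (k : ℕ) :
    Frame (loop i x p) st (p.iter i st k) := by
  induction k with
  | zero => exact Frame.refl _ _
  | succ k ih =>
    refine ih.trans ⟨fun r hr => ?_, fun a ha => ?_⟩
    · have h : r ≠ i ∧ p.wr.contains r = false := by simpa [wr] using hr
      rw [iter, (frame_exec p _).reg r h.2, State.setReg_reg, if_neg h.1]
    · rw [iter, (frame_exec p _).mem a ha, State.setReg_mem]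

theorem frame_iter_setReg (p : Prog) (i x : ℕ) (st : State) (k : ℕ) :
    Frame (loop i x p) st ((p.iter i st k).setReg i k) := by
  refine (frame_iter p i x st k).trans ⟨fun r hr => ?_, fun a ha => rfl⟩
  have h : r ≠ i ∧ p.wr.contains r = false := by simpa [wr] using hr
  rw [State.setReg_reg, if_neg h.1]

/-- Loop invariants; in each iteration the state is known outside what the loop changes. -/
theorem loop_induction {i x : ℕ} {p : Prog} {st : State} (I : ℕ → State → Prop) (h0 : I 0 st)
    (hs : ∀ k < st.reg x, ∀ st', Frame (loop i x p) st st' → I k st' →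
      I (k + 1) (p.exec (st'.setReg i k))) :
    I (st.reg x) ((loop i x p).exec st) := by
  rw [exec_loop]
  have : ∀ k ≤ st.reg x, I k (p.iter i st k) := by
    intro k
    induction k with
    | zero => exact fun _ => h0
    | succ k ih => exact fun hk => hs k hk _ (frame_iter p i x st k) (ih (by omega))
  exact this _ le_rfl

theorem mem_of_writesAt {d m i : ℕ} (p : Prog) (h : p.writesAt d m i = true)
    (hi : p.wr.contains i = false) (st : State) (idx : List ℕ) (hx : idx[m]? ≠ some (st.reg i)) :
    (p.exec st).mem d idx = st.mem d idx := by
  have hi' : i ∉ p.wr := by simpa using hi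
  clear hi
  induction p generalizing st with
  | idxConst | idxAdd | idxSub => rfl
  | const c | arith _ c | root c =>
    obtain ⟨A, I⟩ := c
    simp only [exec_const, exec_arith, exec_root, State.set_mem]
    refine if_neg ?_
    rintro ⟨rfl, rfl⟩
    simp only [writesAt, bne_self_eq_false, Bool.false_or, beq_iff_eq] at h
    simp [h] at hx
  | seq p q hp hq =>
    simp only [writesAt, Bool.and_eq_true, wr, List.mem_append, not_or] at h hi'
    rw [exec_seq, hq h.2 _ (by rwa [(frame_exec p st).reg i (by simpa using hi'.1)]) hi'.2,
      hp h.1 _ hx hi'.1]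
  | ifLe _ _ p q hp hq | ifIdxLt _ _ p q hp hq =>
    simp only [writesAt, Bool.and_eq_true, wr, List.mem_append, not_or] at h hi'
    simp only [exec_ifLe, exec_ifIdxLt]
    split
    · exact hp h.1 _ hx hi'.1
    · exact hq h.2 _ hx hi'.2
  | loop j x p hp =>
    simp only [wr, List.mem_cons, not_or] at hi'
    rw [exec_loop]
    induction st.reg x with
    | zero => rfl
    | succ k ih =>
      rw [iter, hp h _ ?_ hi'.2, State.setReg_mem, ih]
      rw [State.setReg_reg, if_neg hi'.1, (frame_iter p j x st k).reg i]
      · exact hx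
      · simpa [wr] using hi'

/-- If iteration `k` of a loop writes to the array `d` only at cells with `m`-th index `k`, then
these cells keep the contents that iteration `k` gives them. -/
theorem loop_row {d m i x : ℕ} {p : Prog} {st : State} {k : ℕ} (hk : k < st.reg x)
    (h : p.writesAt d m i = true) (hi : p.wr.contains i = false) :
    ∃ st', Frame (loop i x p) st st' ∧ st'.reg i = k ∧
      (∀ idx : List ℕ, idx[m]? = some k → st'.mem d idx = st.mem d idx) ∧
      ∀ idx : List ℕ, idx[m]? = some k →
        ((loop i x p).exec st).mem d idx = (p.exec st').mem d idx := by
  refine ⟨(p.iter i st k).setReg i k, frame_iter_setReg p i x st k, by simp, ?_, ?_⟩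
  · intro idx hidx
    rw [State.setReg_mem]
    have : ∀ k' ≤ k, (p.iter i st k').mem d idx = st.mem d idx := by
      intro k'
      induction k' with
      | zero => exact fun _ => rfl
      | succ k' ih =>
        intro hk'
        rw [iter, mem_of_writesAt p h hi _ _ (by simp [hidx]; omega), State.setReg_mem,
          ih (by omega)]
    exact this k le_rfl
  · intro idx hidx
    rw [exec_loop]
    obtain ⟨e, he⟩ := Nat.exists_eq_add_of_lt hk
    rw [he]
    clear he
    induction e with
    | zero => rfl
    | succ e ih =>
      rw [← ih, show k + (e + 1) + 1 = (k + e + 1) + 1 from rfl, iter,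
        mem_of_writesAt p h hi _ _ (by simp [hidx]; omega), State.setReg_mem]

theorem loop_row_of_le {d m i x : ℕ} {p : Prog} {st : State} {idx : List ℕ}
    (hk : ∀ k < st.reg x, idx[m]? ≠ some k)
    (h : p.writesAt d m i = true) (hi : p.wr.contains i = false) :
    ((loop i x p).exec st).mem d idx = st.mem d idx := by
  refine loop_induction (fun _ st' => st'.mem d idx = st.mem d idx) rfl ?_
  intro k hk' st' _ ih
  rw [mem_of_writesAt p h hi _ _ (by simpa using hk k hk'), State.setReg_mem, ih]

/-- The running time is bounded by a polynomial if the registers that bound loops and degrees do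
not change. -/
theorem run_le (p : Prog) (st : State) (B : ℕ) (hB : ∀ x ∈ p.bounds, st.reg x ≤ B)
    (hp : ∀ x ∈ p.bounds, x ∉ p.wr) : (p.run st).2 ≤ p.costPoly.eval B := by
  induction p generalizing st with
  | idxConst | idxAdd | idxSub | const | arith => simp [run, costPoly]
  | root d c e k => simpa [run, costPoly, bounds] using hB
  | seq p q ihp ihq =>
    simp only [bounds, wr, List.mem_append, not_or] at hB hp
    have h1 := ihp st (fun x hx => hB x (.inl hx)) (fun x hx => (hp x (.inl hx)).1)
    have h2 := ihq (p.exec st) (fun x hx => by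
      rw [(frame_exec p st).reg x (by simpa using (hp x (.inr hx)).1)]
      exact hB x (.inr hx)) (fun x hx => (hp x (.inr hx)).2)
    simpa [run, costPoly, exec] using add_le_add h1 h2
  | ifLe a b p q ihp ihq | ifIdxLt a b p q ihp ihq =>
    simp only [bounds, wr, List.mem_append, not_or] at hB hp
    have h1 := ihp st (fun x hx => hB x (.inl hx)) (fun x hx => (hp x (.inl hx)).1)
    have h2 := ihq st (fun x hx => hB x (.inr hx)) (fun x hx => (hp x (.inr hx)).2)
    simp only [run, costPoly, Polynomial.eval_add, Polynomial.eval_one]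
    split <;> omega
  | loop i x p ih =>
    simp only [bounds, wr, List.mem_cons, not_or] at hB hp
    have key : ∀ m : ℕ, ∀ acc : State × ℕ, acc = Nat.rec (motive := fun _ => State × ℕ) (st, 1)
        (fun k acc => ((p.run (acc.1.setReg i k)).1, acc.2 + (p.run (acc.1.setReg i k)).2 + 1)) m →
        acc.1 = p.iter i st m ∧ acc.2 ≤ 1 + m * (p.costPoly.eval B + 1) := by
      intro m
      induction m with
      | zero => rintro acc rfl; simp [iter]
      | succ m ihm =>
        rintro acc rfl
        obtain ⟨h1, h2⟩ := ihm _ rfl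
        have h3 := ih ((p.iter i st m).setReg i m) (fun y hy => by
          have := hp y (.inr hy)
          rw [State.setReg_reg, if_neg this.1,
            (frame_iter p i x st m).reg y (by simpa [wr] using this)]
          exact hB y (.inr hy)) (fun y hy => (hp y (.inr hy)).2)
        refine ⟨?_, ?_⟩
        · simp only [h1]; rfl
        · simp only [h1]
          rw [add_mul]
          omega
    have h := (key (st.reg x) _ rfl).2
    have hx := hB x (.inl rfl)
    simp only [run, costPoly, Polynomial.eval_add, Polynomial.eval_one, Polynomial.eval_mul,
      Polynomial.eval_X]
    exact h.trans (by gcongr)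

end Prog
end JLV

namespace JLV

open Prog

/-! ### Kernels of systems of linear equations, one equation at a time -/

/-- The square array `V` of size `n` represents the space of vectors of length `n` with the linear
property `S`. A row `i` of `V` is either zero or active, `V i i = 1`; the active rows form a basis
of the space, dual to the coordinates with the same indices, and `V` is upper triangular. Vectors
are functions on `ℕ` of which only the first `n` values matter. -/
structure Rep (n : ℕ) (V : ℕ → ℕ → ℝ) (S : (ℕ → ℝ) → Prop) : Prop where
  sub : ∀ u v w c, S v → S w → (∀ j < n, u j = v j - c * w j) → S u
  row : ∀ i < n, S (V i)
  span : ∀ w, S w → ∀ k < n, w k = ∑ i ∈ Finset.range n, w i * V i k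
  tri : ∀ i j, j < i → i < n → V i j = 0
  diag : ∀ j < n, (V j j = 1 ∧ ∀ i < n, i ≠ j → V i j = 0) ∨ ∀ k < n, V j k = 0

namespace Rep

variable {n : ℕ} {V V' : ℕ → ℕ → ℝ} {S S' : (ℕ → ℝ) → Prop} {E : ℕ → ℝ}

theorem congr_prop (h : Rep n V S) (hS : ∀ w, S w ↔ S' w) : Rep n V S' := by
  obtain rfl : S = S' := funext fun w => propext (hS w)
  exact h

theorem smul_mem (h : Rep n V S) {v : ℕ → ℝ} (hv : S v) (c : ℝ) : S (fun j => c * v j) :=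
  h.sub _ v v (1 - c) hv hv fun j _ => by ring

theorem add_mem (h : Rep n V S) {v w : ℕ → ℝ} (hv : S v) (hw : S w) : S (fun j => v j + w j) :=
  h.sub _ v w (-1) hv hw fun j _ => by ring

theorem congr_mem (h : Rep n V S) {v w : ℕ → ℝ} (hv : S v) (hw : ∀ j < n, w j = v j) : S w :=
  h.sub _ v v 0 hv hv fun j hj => by rw [hw j hj]; ring

/-- The identity matrix represents the whole space. -/
theorem one (h : ∀ i < n, ∀ j < n, V i j = if i = j then 1 else 0)
    (ht : ∀ i j, j < i → i < n → V i j = 0) : Rep n V fun _ => True where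
  sub := fun _ _ _ _ _ _ _ => trivial
  row := fun _ _ => trivial
  span := fun w _ k hk => by
    rw [Finset.sum_congr rfl fun i hi => by rw [h i (Finset.mem_range.1 hi) k hk]]
    simp [hk]
  tri := ht
  diag := fun j hj => .inl ⟨by simp [h j hj j hj], fun i hi hij => by simp [h i hi j hj, hij]⟩

/-- The value of the linear form `E` on a vector of the space, from its values on the rows. -/
theorem sum_mul_row (h : Rep n V S) {w : ℕ → ℝ} (hw : S w) :
    ∑ i ∈ Finset.range n, w i * ∑ j ∈ Finset.range n, E j * V i j =
      ∑ j ∈ Finset.range n, E j * w j := by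
  have h1 : ∀ j ∈ Finset.range n, E j * w j = ∑ i ∈ Finset.range n, w i * (E j * V i j) := by
    intro j hj
    rw [h.span w hw j (Finset.mem_range.1 hj), Finset.mul_sum]
    exact Finset.sum_congr rfl fun _ _ => mul_left_comm _ _ _
  rw [Finset.sum_congr rfl h1, Finset.sum_comm]
  simp only [Finset.mul_sum]

theorem sub_eq (h : Rep n V S) (u v w : ℕ → ℝ) (c : ℝ)
    (hv : S v ∧ ∑ j ∈ Finset.range n, E j * v j = 0)
    (hw : S w ∧ ∑ j ∈ Finset.range n, E j * w j = 0) (hu : ∀ j < n, u j = v j - c * w j) :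
    S u ∧ ∑ j ∈ Finset.range n, E j * u j = 0 := by
  refine ⟨h.sub u v w c hv.1 hw.1 hu, ?_⟩
  rw [Finset.sum_congr rfl fun j hj => by
    rw [hu j (Finset.mem_range.1 hj), mul_sub, mul_left_comm]]
  rw [Finset.sum_sub_distrib, ← Finset.mul_sum, hv.2, hw.2]
  simp

theorem add_of_eq_zero (h : Rep n V S) (hV : ∀ i < n, ∀ j < n, V' i j = V i j)
    (h0 : ∀ i < n, ∑ j ∈ Finset.range n, E j * V i j = 0) :
    Rep n V' fun w => S w ∧ ∑ j ∈ Finset.range n, E j * w j = 0 where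
  sub := h.sub_eq
  row := fun i hi => ⟨h.congr_mem (h.row i hi) (hV i hi), by
    rw [Finset.sum_congr rfl fun j hj => by rw [hV i hi j (Finset.mem_range.1 hj)], h0 i hi]⟩
  span := fun w hw k hk => by
    rw [Finset.sum_congr rfl fun i hi => by rw [hV i (Finset.mem_range.1 hi) k hk]]
    exact h.span w hw.1 k hk
  tri := fun i j hij hi => by rw [hV i hi j (by omega), h.tri i j hij hi]
  diag := fun j hj => by
    refine (h.diag j hj).imp (fun h1 => ⟨by rw [hV j hj j hj, h1.1], fun i hi hij => ?_⟩)
      fun h1 k hk => by rw [hV j hj k hk, h1 k hk]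
    rw [hV i hi j hj, h1.2 i hi hij]

/-- Elimination with the last possible pivot keeps the array triangular. -/
theorem add_of_pivot (h : Rep n V S) {W : ℕ → ℝ}
    (hW : ∀ i < n, W i = ∑ j ∈ Finset.range n, E j * V i j) {p : ℕ} (hp : p < n)
    (hWp : W p ≠ 0) (hlast : ∀ i < n, p < i → W i = 0)
    (hV : ∀ i < n, ∀ j < n, V' i j = V i j - W i * (V p j / W p)) :
    Rep n V' fun w => S w ∧ ∑ j ∈ Finset.range n, E j * w j = 0 where
  sub := h.sub_eq
  row := fun i hi => by
    refine ⟨h.sub _ (V i) (V p) (W i / W p) (h.row i hi) (h.row p hp) fun j hj => ?_, ?_⟩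
    · rw [hV i hi j hj]; ring
    · rw [Finset.sum_congr rfl fun j hj => by
        rw [hV i hi j (Finset.mem_range.1 hj),
          show E j * (V i j - W i * (V p j / W p)) =
            E j * V i j - W i / W p * (E j * V p j) by ring]]
      rw [Finset.sum_sub_distrib, ← Finset.mul_sum, ← hW i hi, ← hW p hp]
      field_simp
      ring
  span := fun w hw k hk => by
    rw [Finset.sum_congr rfl fun i hi => by
      rw [hV i (Finset.mem_range.1 hi) k hk,
        show w i * (V i k - W i * (V p k / W p)) = w i * V i k - V p k / W p * (w i * W i) by ring]]
    rw [Finset.sum_sub_distrib, ← Finset.mul_sum, ← h.span w hw.1 k hk,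
      Finset.sum_congr rfl fun i hi => by rw [hW i (Finset.mem_range.1 hi)],
      h.sum_mul_row hw.1, hw.2]
    simp
  tri := fun i j hij hi => by
    rw [hV i hi j (by omega), h.tri i j hij hi]
    by_cases hpi : p < i
    · simp [hlast i hi hpi]
    · simp [h.tri p j (by omega) hp]
  diag := fun j hj => by
    by_cases hjp : j = p
    · subst hjp
      exact .inr fun k hk => by rw [hV j hj k hk]; field_simp; ring
    · refine (h.diag j hj).imp (fun h1 => ⟨?_, fun i hi hij => ?_⟩) fun h1 k hk => ?_
      · rw [hV j hj j hj, h1.1, h1.2 p hp (Ne.symm hjp)]; simp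
      · rw [hV i hi j hj, h1.2 i hi hij, h1.2 p hp (Ne.symm hjp)]; simp
      · rw [hV j hj k hk, hW j hj, h1 k hk,
          Finset.sum_eq_zero fun l hl => by rw [h1 l (Finset.mem_range.1 hl), mul_zero]]
        simp

/-- If the space contains a vector with coordinate `0` equal to `1`, then so is row `0`. -/
theorem row_zero (h : Rep n V S) (hn : 0 < n) {w : ℕ → ℝ} (hw : S w) (h0 : w 0 = 1) :
    V 0 0 = 1 := by
  have h1 := h.span w hw 0 hn
  rw [Finset.sum_eq_single_of_mem 0 (Finset.mem_range.2 hn) fun i hi hi0 => by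
    rw [h.tri i 0 (by omega) (Finset.mem_range.1 hi), mul_zero], h0, one_mul] at h1
  exact h1.symm

/-- The sum of the active rows is a nonzero vector of the space, if there is any. -/
theorem sum_rows (h : Rep n V S) {w : ℕ → ℝ} (hw : S w) (hw0 : ∃ k < n, w k ≠ 0) :
    S (fun j => ∑ i ∈ Finset.range n, V i i * V i j) ∧
      ∃ k < n, ∑ i ∈ Finset.range n, V i i * V i k ≠ 0 := by
  constructor
  · have : ∀ m ≤ n, S (fun j => ∑ i ∈ Finset.range m, V i i * V i j) := by
      intro m
      induction m with
      | zero => exact fun _ => h.sub _ w w 1 hw hw fun j _ => by simp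
      | succ m ih =>
        intro hm
        simp only [Finset.sum_range_succ]
        exact h.add_mem (ih (by omega)) (h.smul_mem (h.row m (by omega)) _)
    exact this n le_rfl
  · obtain ⟨k, hk, hwk⟩ := hw0
    obtain ⟨j, hj, hVj⟩ : ∃ j < n, V j j = 1 := by
      by_contra! hcon
      refine hwk ?_
      rw [h.span w hw k hk]
      refine Finset.sum_eq_zero fun i hi => ?_
      have hi := Finset.mem_range.1 hi
      rcases h.diag i hi with h1 | h1
      · exact absurd h1.1 (hcon i hi)
      · rw [h1 k hk, mul_zero]
    refine ⟨j, hj, ?_⟩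
    rcases h.diag j hj with h1 | h1
    · rw [Finset.sum_eq_single_of_mem j (Finset.mem_range.2 hj) fun i hi hij => by
        rw [h1.2 i (Finset.mem_range.1 hi) hij, mul_zero], hVj]
      norm_num
    · rw [h1 j hj] at hVj
      norm_num at hVj

end Rep

/-! ### Building blocks of the program -/

namespace Prog

/-- `dst := src`. -/
def copy (d s : Cell) : Prog := const d 0 ;; arith .add d d s

@[simp] theorem exec_copy (A B : ℕ) (I J : List ℕ) (h : A ≠ B) (st : State) :
    (copy ⟨A, I⟩ ⟨B, J⟩).exec st = st.set ⟨A, I⟩ (st.mem B (J.map st.reg)) := by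
  simp only [copy, exec_seq, exec_const, exec_arith, ArithOp.eval]
  simp [State.set, State.get, h.symm]

/-- Index register `y := p * m + q`; register `19` is a counter. -/
def flat (y p q m : ℕ) : Prog := idxConst y 0 ;; loop 19 m (idxAdd y y p) ;; idxAdd y y q

@[simp] theorem exec_flat_mem (y p q m : ℕ) (st : State) :
    ((flat y p q m).exec st).mem = st.mem := by
  funext a
  exact (frame_exec _ _).mem a rfl

theorem exec_flat_reg_of_ne {y p q m r : ℕ} (h : r ≠ y) (h' : r ≠ 19) (st : State) :
    ((flat y p q m).exec st).reg r = st.reg r :=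
  (frame_exec _ _).reg r (by simp [flat, wr, h, h'])

theorem exec_flat_reg_self {y p q m : ℕ} (hp : p ≠ y) (hp' : p ≠ 19) (hq : q ≠ y) (hq' : q ≠ 19)
    (hm : m ≠ y) (hy : y ≠ 19) (st : State) :
    ((flat y p q m).exec st).reg y = st.reg p * st.reg m + st.reg q := by
  have h := loop_induction (i := 19) (x := m) (p := idxAdd y y p) (st := st.setReg y 0)
    (fun k st' => st'.reg y = st.reg p * k) (by simp) (fun k hk st' hfr ih => by
      have := hfr.reg p (by simp [wr, hp, hp'])
      simp [hy, hp', ih, this, hp, mul_add])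
  have h2 := (frame_exec (loop 19 m (idxAdd y y p)) (st.setReg y 0)).reg q
    (by simp [wr, hq, hq'])
  simp only [State.setReg_reg, if_neg hm, if_neg hq] at h h2
  simp [flat, h, h2]

/-- The value of register `r` after `flat y p q m`; used with numerals for all registers. -/
theorem exec_flat_reg {y p q m r : ℕ} (hp : p ≠ y) (hp' : p ≠ 19) (hq : q ≠ y) (hq' : q ≠ 19)
    (hm : m ≠ y) (hy : y ≠ 19) (hr : r ≠ 19) (st : State) :
    ((flat y p q m).exec st).reg r =
      if r = y then st.reg p * st.reg m + st.reg q else st.reg r := by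
  split
  · next h => rw [h, exec_flat_reg_self hp hp' hq hq' hm hy]
  · next h => exact exec_flat_reg_of_ne h hr st

/-- Array `40` (a scalar) `:= ∑ X Y`, the sum being over the values of the register `k` below
that of `n`. -/
def dot (k n : ℕ) (X Y : Cell) : Prog :=
  const ⟨40, []⟩ 0 ;; loop k n (arith .mul ⟨24, []⟩ X Y ;; arith .add ⟨40, []⟩ ⟨40, []⟩ ⟨24, []⟩)

theorem exec_dot_reg {k n r : ℕ} {X Y : Cell} (h : r ≠ k) (st : State) :
    ((dot k n X Y).exec st).reg r = st.reg r :=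
  (frame_exec _ _).reg r (by simp [dot, wr, h])

theorem exec_dot_acc {k n A B : ℕ} {I J : List ℕ} (hA : A ≠ 24) (hA' : A ≠ 40) (hB : B ≠ 24)
    (hB' : B ≠ 40) (st : State) :
    ((dot k n ⟨A, I⟩ ⟨B, J⟩).exec st).mem 40 [] = ∑ m ∈ Finset.range (st.reg n),
      st.mem A (I.map (st.setReg k m).reg) * st.mem B (J.map (st.setReg k m).reg) := by
  have key := loop_induction (i := k) (x := n)
    (p := arith .mul ⟨24, []⟩ ⟨A, I⟩ ⟨B, J⟩ ;; arith .add ⟨40, []⟩ ⟨40, []⟩ ⟨24, []⟩)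
    (st := st.set ⟨40, []⟩ 0)
    (fun t st' => st'.mem 40 [] = ∑ m ∈ Finset.range t,
      st.mem A (I.map (st.setReg k m).reg) * st.mem B (J.map (st.setReg k m).reg)) (by simp) (by
  intro t ht st' hfr ih
  have hr : (st'.setReg k t).reg = (st.setReg k t).reg := by
    funext r
    by_cases h : r = k
    · simp [h]
    · simpa [h] using hfr.reg r (by simp [wr, h])
  have hmA := hfr.mem A (by simp [wm, hA, hA'])
  have hmB := hfr.mem B (by simp [wm, hB, hB'])
  rw [State.set_mem_of_ne _ _ _ hA'] at hmA
  rw [State.set_mem_of_ne _ _ _ hB'] at hmB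
  rw [Finset.sum_range_succ, ← ih]
  simp [ArithOp.eval, hr, hmA, hmB])
  simpa [dot] using key

/-- The array `21` as a matrix. -/
def V (st : State) (i j : ℕ) : ℝ := st.mem 21 [i, j]

/-- Array `21` `:=` the identity matrix of size `n`. -/
def kerInit (n : ℕ) : Prog :=
  loop 10 n (loop 11 n (const ⟨21, [10, 11]⟩ 0)) ;; loop 10 n (const ⟨21, [10, 10]⟩ 1)

/-- Adds the equation with the coefficients in array `20` to the system whose solution space is
represented by array `21`. The values of the equation on the rows go to array `22`. Register `12`
holds the last row on which the equation is not zero, if there is one, and multiples of this row are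
subtracted from all rows, itself included. The choice of the last row keeps the matrix triangular.
Register `13` tells whether there is such a row. Register `n` holds the number of unknowns. -/
def addEq (n : ℕ) : Prog :=
  loop 10 n (dot 11 n ⟨20, [11]⟩ ⟨21, [10, 11]⟩ ;; copy ⟨22, [10]⟩ ⟨40, []⟩) ;;
  idxConst 13 0 ;; idxConst 14 0 ;; const ⟨26, []⟩ 0 ;;
  loop 10 n (ifLe ⟨22, [10]⟩ ⟨26, []⟩
    (ifLe ⟨26, []⟩ ⟨22, [10]⟩ (idxConst 11 0) (idxAdd 12 10 14 ;; idxConst 13 1))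
    (idxAdd 12 10 14 ;; idxConst 13 1)) ;;
  ifIdxLt 14 13
    (loop 11 n (arith .div ⟨23, [11]⟩ ⟨21, [12, 11]⟩ ⟨22, [12]⟩) ;;
     loop 10 n (loop 11 n (arith .mul ⟨24, []⟩ ⟨22, [10]⟩ ⟨23, [11]⟩ ;;
       arith .sub ⟨21, [10, 11]⟩ ⟨21, [10, 11]⟩ ⟨24, []⟩)))
    (idxConst 11 0)

theorem kerInit_spec {n : ℕ} (hn : n < 10) (st : State) :
    Rep (st.reg n) (V ((kerInit n).exec st)) fun _ => True := by
  have h10 : n ≠ 10 := by omega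
  have h11 : n ≠ 11 := by omega
  have key : ∀ i < st.reg n, ∀ j < st.reg n,
      V ((kerInit n).exec st) i j = if i = j then 1 else 0 := by
    intro i hi j hj
    have hz : ((loop 10 n (loop 11 n (const ⟨21, [10, 11]⟩ 0))).exec st).mem 21 [i, j] = 0 := by
      obtain ⟨s1, f1, r1, -, e1⟩ := loop_row (d := 21) (m := 0) (k := i) (i := 10) (x := n)
        (p := loop 11 n (const ⟨21, [10, 11]⟩ 0)) hi rfl rfl
      have hn1 := f1.reg n (by simp [wr, h10, h11])
      rw [e1 _ rfl]
      obtain ⟨s2, f2, r2, -, e2⟩ := loop_row (d := 21) (m := 1) (i := 11) (x := n)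
        (p := const ⟨21, [10, 11]⟩ 0) (st := s1) (by rwa [hn1]) rfl rfl
      rw [e2 _ rfl]
      have := f2.reg 10 rfl
      simp [r2, this, r1]
    have hst : ((loop 10 n (loop 11 n (const ⟨21, [10, 11]⟩ 0))).exec st).reg n = st.reg n :=
      (frame_exec _ _).reg n (by simp [wr, h10, h11])
    simp only [V, kerInit, exec_seq]
    obtain ⟨s1, f1, r1, g1, e1⟩ := loop_row (d := 21) (m := 0) (k := i) (i := 10) (x := n)
        (p := const ⟨21, [10, 10]⟩ 1)
        (st := (loop 10 n (loop 11 n (const ⟨21, [10, 11]⟩ 0))).exec st) (by rwa [hst]) rfl rfl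
    rw [e1 _ rfl]
    simp [r1, g1, hz, eq_comm]
  refine Rep.one key fun i j hij hi => ?_
  rw [key i hi j (by omega), if_neg (by omega)]

theorem addEq_spec {n : ℕ} (hn : n < 10) (st : State) {S : (ℕ → ℝ) → Prop}
    (h : Rep (st.reg n) (V st) S) :
    Rep (st.reg n) (V ((addEq n).exec st)) fun w => S w ∧
      ∑ j ∈ Finset.range (st.reg n), st.mem 20 [j] * w j = 0 := by
  have h10 : n ≠ 10 := by omega
  have h11 : n ≠ 11 := by omega
  have h12 : n ≠ 12 := by omega
  have h13 : n ≠ 13 := by omega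
  have h14 : n ≠ 14 := by omega
  simp only [addEq, exec_seq]
  -- the values of the equation on the rows
  have hW : ∀ i < st.reg n, ((loop 10 n (dot 11 n ⟨20, [11]⟩ ⟨21, [10, 11]⟩ ;;
      copy ⟨22, [10]⟩ ⟨40, []⟩)).exec st).mem 22 [i] =
      ∑ j ∈ Finset.range (st.reg n), st.mem 20 [j] * V st i j := by
    intro i hi
    obtain ⟨s1, f1, r1, -, e1⟩ := loop_row (d := 22) (m := 0) (i := 10) (x := n)
      (p := dot 11 n ⟨20, [11]⟩ ⟨21, [10, 11]⟩ ;; copy ⟨22, [10]⟩ ⟨40, []⟩) hi rfl rfl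
    have hn1 := f1.reg n (by simp [wr, dot, copy, h10, h11])
    have hE := f1.mem 20 rfl
    have hV := f1.mem 21 rfl
    rw [e1 _ rfl]
    simp [exec_dot_acc, exec_dot_reg, hn1, hE, hV, r1, V]
  have f1 := frame_exec (loop 10 n (dot 11 n ⟨20, [11]⟩ ⟨21, [10, 11]⟩ ;;
      copy ⟨22, [10]⟩ ⟨40, []⟩)) st
  set s1 := (loop 10 n (dot 11 n ⟨20, [11]⟩ ⟨21, [10, 11]⟩ ;; copy ⟨22, [10]⟩ ⟨40, []⟩)).exec st
  have hn1 : s1.reg n = st.reg n := f1.reg n (by simp [wr, dot, copy, h10, h11])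
  have hV1 : s1.mem 21 = st.mem 21 := f1.mem 21 rfl
  simp only [exec_idxConst, exec_const]
  set s2 := ((s1.setReg 13 0).setReg 14 0).set ⟨26, []⟩ ((0 : ℤ) : ℝ) with hs2
  have hn2 : s2.reg n = st.reg n := by simp [hs2, hn1, h13, h14]
  have hV2 : s2.mem 21 = st.mem 21 := by
    rw [hs2, State.set_mem_of_ne _ _ _ (by decide)]; simpa using hV1
  have hW2 : ∀ i < st.reg n, s2.mem 22 [i] =
      ∑ j ∈ Finset.range (st.reg n), st.mem 20 [j] * V st i j := by
    intro i hi; rw [← hW i hi]; simp [hs2]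
  -- the search for the last pivot
  have hsearch := loop_induction (i := 10) (x := n)
    (p := ifLe ⟨22, [10]⟩ ⟨26, []⟩
      (ifLe ⟨26, []⟩ ⟨22, [10]⟩ (idxConst 11 0) (idxAdd 12 10 14 ;; idxConst 13 1))
      (idxAdd 12 10 14 ;; idxConst 13 1)) (st := s2)
    (fun t s => (s.reg 13 = 0 ∧ ∀ i < t, s2.mem 22 [i] = 0) ∨
      (s.reg 13 = 1 ∧ s.reg 12 < t ∧ s2.mem 22 [s.reg 12] ≠ 0 ∧
        ∀ i < t, s.reg 12 < i → s2.mem 22 [i] = 0)) (by left; simp [hs2]) (by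
      intro t ht s f ih
      have h22 := f.mem 22 rfl
      have h26 : s.mem 26 [] = 0 := by rw [f.mem 26 rfl]; simp [hs2]
      have hr14 : s.reg 14 = 0 := by rw [f.reg 14 rfl]; simp [hs2]
      have hcase : ∀ s', s' = (ifLe ⟨22, [10]⟩ ⟨26, []⟩
          (ifLe ⟨26, []⟩ ⟨22, [10]⟩ (idxConst 11 0) (idxAdd 12 10 14 ;; idxConst 13 1))
          (idxAdd 12 10 14 ;; idxConst 13 1)).exec (s.setReg 10 t) →
          (s2.mem 22 [t] = 0 ∧ s'.reg 13 = s.reg 13 ∧ s'.reg 12 = s.reg 12) ∨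
          (s2.mem 22 [t] ≠ 0 ∧ s'.reg 13 = 1 ∧ s'.reg 12 = t) := by
        rintro s' rfl
        rw [← h22]
        by_cases h0 : s.mem 22 [t] = 0
        · left; simp [h0, h26]
        · right
          refine ⟨h0, ?_⟩
          have hne : s.mem 22 [t] ≤ 0 → ¬ 0 ≤ s.mem 22 [t] := fun h1 h2 => h0 (le_antisymm h1 h2)
          by_cases h1 : s.mem 22 [t] ≤ 0
          · simp [h26, hr14, h1, hne h1]
          · simp [h26, hr14, h1]
      rcases hcase _ rfl with ⟨h0, e13, e12⟩ | ⟨h0, e13, e12⟩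
      · rw [e13, e12]
        rcases ih with ⟨a, b⟩ | ⟨a, b, c, d⟩
        · exact .inl ⟨a, fun i hi => by
            rcases Nat.lt_succ_iff_lt_or_eq.1 hi with h | rfl
            · exact b i h
            · exact h0⟩
        · refine .inr ⟨a, by omega, c, fun i hi hi' => ?_⟩
          rcases Nat.lt_succ_iff_lt_or_eq.1 hi with h | rfl
          · exact d i h hi'
          · exact h0
      · rw [e13, e12]
        exact .inr ⟨rfl, by omega, h0, fun i hi hi' => by omega⟩)
  have f3 := frame_exec (loop 10 n (ifLe ⟨22, [10]⟩ ⟨26, []⟩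
      (ifLe ⟨26, []⟩ ⟨22, [10]⟩ (idxConst 11 0) (idxAdd 12 10 14 ;; idxConst 13 1))
      (idxAdd 12 10 14 ;; idxConst 13 1))) s2
  set s3 := (loop 10 n (ifLe ⟨22, [10]⟩ ⟨26, []⟩
      (ifLe ⟨26, []⟩ ⟨22, [10]⟩ (idxConst 11 0) (idxAdd 12 10 14 ;; idxConst 13 1))
      (idxAdd 12 10 14 ;; idxConst 13 1))).exec s2
  have hn3 : s3.reg n = st.reg n := by
    rw [f3.reg n (by simp [wr, h10, h11, h12, h13]), hn2]
  have hV3 : s3.mem 21 = st.mem 21 := by rw [f3.mem 21 rfl, hV2]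
  have hW3 : s3.mem 22 = s2.mem 22 := f3.mem 22 rfl
  have h14' : s3.reg 14 = 0 := by rw [f3.reg 14 rfl]; simp [hs2]
  rw [hn2] at hsearch
  simp only [exec_ifIdxLt]
  rcases hsearch with ⟨e13, h0⟩ | ⟨e13, hp, hWp, hlast⟩
  · rw [e13, h14', if_neg (lt_irrefl 0)]
    refine h.add_of_eq_zero (fun i _ j _ => ?_) fun i hi => ?_
    · simp [V, hV3]
    · rw [← hW2 i hi, h0 i hi]
  · rw [e13, h14', if_pos one_pos, exec_seq]
    set p := s3.reg 12
    have hR : ∀ j < st.reg n, ((loop 11 n (arith .div ⟨23, [11]⟩ ⟨21, [12, 11]⟩ ⟨22, [12]⟩)).exec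
        s3).mem 23 [j] = V st p j / s2.mem 22 [p] := by
      intro j hj
      obtain ⟨s4, f4, r4, -, e4⟩ := loop_row (d := 23) (m := 0) (i := 11) (x := n)
        (p := arith .div ⟨23, [11]⟩ ⟨21, [12, 11]⟩ ⟨22, [12]⟩) (st := s3) (by rwa [hn3]) rfl rfl
      rw [e4 _ rfl]
      have a1 : s4.reg 12 = p := f4.reg 12 rfl
      have a2 := f4.mem 21 rfl
      have a3 := f4.mem 22 rfl
      simp [ArithOp.eval, r4, a1, a2, a3, hV3, hW3, V]
    have f4 := frame_exec (loop 11 n (arith .div ⟨23, [11]⟩ ⟨21, [12, 11]⟩ ⟨22, [12]⟩)) s3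
    set s4 := (loop 11 n (arith .div ⟨23, [11]⟩ ⟨21, [12, 11]⟩ ⟨22, [12]⟩)).exec s3
    have hn4 : s4.reg n = st.reg n := by rw [f4.reg n (by simp [wr, h11]), hn3]
    have hV4 : s4.mem 21 = st.mem 21 := by rw [f4.mem 21 rfl, hV3]
    have hW4 : s4.mem 22 = s2.mem 22 := by rw [f4.mem 22 rfl, hW3]
    refine h.add_of_pivot (W := fun i => s2.mem 22 [i]) (fun i hi => hW2 i hi) hp hWp hlast ?_
    intro i hi j hj
    simp only [V]
    obtain ⟨s5, f5, r5, g5, e5⟩ := loop_row (d := 21) (m := 0) (k := i) (i := 10) (x := n)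
      (p := loop 11 n (arith .mul ⟨24, []⟩ ⟨22, [10]⟩ ⟨23, [11]⟩ ;;
       arith .sub ⟨21, [10, 11]⟩ ⟨21, [10, 11]⟩ ⟨24, []⟩)) (st := s4) (by rwa [hn4]) rfl rfl
    rw [e5 _ rfl]
    have hn5 : s5.reg n = st.reg n := by rw [f5.reg n (by simp [wr, h10, h11]), hn4]
    obtain ⟨s6, f6, r6, g6, e6⟩ := loop_row (d := 21) (m := 1) (i := 11) (x := n)
      (p := arith .mul ⟨24, []⟩ ⟨22, [10]⟩ ⟨23, [11]⟩ ;;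
       arith .sub ⟨21, [10, 11]⟩ ⟨21, [10, 11]⟩ ⟨24, []⟩) (st := s5) (by rwa [hn5]) rfl rfl
    rw [e6 _ rfl]
    have a1 : s6.reg 10 = i := by rw [f6.reg 10 rfl, r5]
    have a2 := f6.mem 22 rfl
    have a3 := f6.mem 23 rfl
    have a4 := f5.mem 22 rfl
    have a5 := f5.mem 23 rfl
    simp [ArithOp.eval, a1, r6, a2, a3, a4, a5, g6, g5, hV4, hW4, hR j hj, V]

end Prog
end JLV

namespace JLV

open Prog

theorem Rep.congr_mat {n : ℕ} {V V' : ℕ → ℕ → ℝ} {S : (ℕ → ℝ) → Prop} (h : Rep n V S)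
    (hV : ∀ i < n, ∀ j < n, V' i j = V i j) : Rep n V' S where
  sub := h.sub
  row := fun i hi => h.congr_mem (h.row i hi) (hV i hi)
  span := fun w hw k hk => by
    rw [Finset.sum_congr rfl fun i hi => by rw [hV i (Finset.mem_range.1 hi) k hk]]
    exact h.span w hw k hk
  tri := fun i j hij hi => by rw [hV i hi j (by omega), h.tri i j hij hi]
  diag := fun j hj => by
    refine (h.diag j hj).imp (fun h1 => ⟨by rw [hV j hj j hj, h1.1], fun i hi hij => ?_⟩)
      fun h1 k hk => by rw [hV j hj k hk, h1 k hk]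
    rw [hV i hi j hj, h1.2 i hi hij]

/-- Row `0` of a representation of a homogenized system, with homogenizing coordinate `0`, gives
a solution of the inhomogeneous system, if there is any. -/
theorem Rep.solve {n : ℕ} {V : ℕ → ℕ → ℝ} {ι : Type} {D : ι → Prop} {b : ι → ℝ} {a : ι → ℕ → ℝ}
    (h : Rep (n + 1) V fun w =>
      ∀ t, D t → -b t * w 0 + ∑ p ∈ Finset.range n, a t p * w (p + 1) = 0)
    (hx : ∃ x : ℕ → ℝ, ∀ t, D t → ∑ p ∈ Finset.range n, a t p * x p = b t) (t : ι) (ht : D t) :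
    ∑ p ∈ Finset.range n, a t p * V 0 (p + 1) = b t := by
  obtain ⟨x, hx⟩ := hx
  have h1 := h.row_zero (w := fun j => if j = 0 then 1 else x (j - 1)) (by omega)
    (fun t ht => by simp [hx t ht]) rfl
  have h2 := h.row 0 (by omega) t ht
  rw [h1] at h2
  linarith

/-- The sizes that the index registers hold after the start of the program. -/
structure Sizes (n₁ n₂ n₃ : ℕ) (st : State) : Prop where
  r0 : st.reg 0 = n₁
  r1 : st.reg 1 = n₂
  r2 : st.reg 2 = n₃
  r5 : st.reg 5 = n₁ * n₂
  r6 : st.reg 6 = n₁ * n₂ + 1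
  r7 : st.reg 7 = n₁ * n₂ * (n₁ * n₂)
  r8 : st.reg 8 = 0
  r9 : st.reg 9 = 1

theorem Sizes.of_frame {n₁ n₂ n₃ : ℕ} {p : Prog} {st st' : State} (h : Sizes n₁ n₂ n₃ st)
    (f : Frame p st st')
    (hp : ([0, 1, 2, 5, 6, 7, 8, 9].all fun r => !p.wr.contains r) = true) :
    Sizes n₁ n₂ n₃ st' := by
  simp only [List.all_eq_true, Bool.not_eq_true'] at hp
  exact ⟨(f.reg 0 (hp 0 (by simp))).trans h.r0, (f.reg 1 (hp 1 (by simp))).trans h.r1,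
    (f.reg 2 (hp 2 (by simp))).trans h.r2, (f.reg 5 (hp 5 (by simp))).trans h.r5,
    (f.reg 6 (hp 6 (by simp))).trans h.r6, (f.reg 7 (hp 7 (by simp))).trans h.r7,
    (f.reg 8 (hp 8 (by simp))).trans h.r8, (f.reg 9 (hp 9 (by simp))).trans h.r9⟩

theorem flat_lt {n m p q : ℕ} (hp : p < n) (hq : q < m) : p * m + q < n * m := by
  calc p * m + q < p * m + m := by omega
    _ = (p + 1) * m := by ring
    _ ≤ n * m := by gcongr; omega

namespace Prog

theorem Frame.setReg {i x : ℕ} {p : Prog} {st st' : State} (f : Frame (loop i x p) st st') (k : ℕ) :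
    Frame (loop i x p) st (st'.setReg i k) := by
  refine f.trans ⟨fun r hr => ?_, fun a ha => rfl⟩
  have h : r ≠ i ∧ p.wr.contains r = false := by simpa [wr] using hr
  rw [State.setReg_reg, if_neg h.1]

/-- A loop that adds equations to a system. -/
theorem loop_rep {i x n : ℕ} {p : Prog} {st : State} {S : (ℕ → ℝ) → Prop}
    (Q : ℕ → (ℕ → ℝ) → Prop) (h0 : Rep n (V st) S)
    (hs : ∀ k < st.reg x, ∀ st', Frame (loop i x p) st st' → st'.reg i = k →
      ∀ S', Rep n (V st') S' → Rep n (V (p.exec st')) fun w => S' w ∧ Q k w) :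
    Rep n (V ((loop i x p).exec st)) fun w => S w ∧ ∀ k < st.reg x, Q k w := by
  refine loop_induction (fun t st' => Rep n (V st') fun w => S w ∧ ∀ k < t, Q k w) ?_ ?_
  · exact h0.congr_prop fun w => by simp
  · intro k hk st' f ih
    refine (hs k hk (st'.setReg i k) (f.setReg k) (by simp) _ ih).congr_prop fun w => ?_
    rw [Nat.forall_lt_succ_right, and_assoc]

/-- The linear form with the coefficients in array `20`. -/
def ev (n : ℕ) (st : State) (w : ℕ → ℝ) : ℝ := ∑ j ∈ Finset.range n, st.mem 20 [j] * w j

theorem ev_congr {n : ℕ} {st st' : State} (h : st'.mem 20 = st.mem 20) (w : ℕ → ℝ) :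
    ev n st' w = ev n st w := by
  simp only [ev, h]

@[simp] theorem ev_setReg (n : ℕ) (st : State) (x k : ℕ) (w : ℕ → ℝ) :
    ev n (st.setReg x k) w = ev n st w := rfl

/-- A loop that adds terms to the coefficients of an equation. -/
theorem loop_ev {i x n : ℕ} {p : Prog} {st : State} {w : ℕ → ℝ} (g : ℕ → ℝ)
    (hs : ∀ k < st.reg x, ∀ st', Frame (loop i x p) st st' → st'.reg i = k →
      ev n (p.exec st') w = ev n st' w + g k) :
    ev n ((loop i x p).exec st) w = ev n st w + ∑ k ∈ Finset.range (st.reg x), g k := by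
  refine loop_induction (fun t st' => ev n st' w = ev n st w + ∑ k ∈ Finset.range t, g k)
    (by simp) ?_
  intro k hk st' f ih
  rw [hs k hk (st'.setReg i k) (f.setReg k) (by simp), ev_setReg, ih,
    Finset.sum_range_succ, add_assoc]

theorem ev_set {n : ℕ} (st : State) {y : ℕ} (hy : st.reg y < n) (v : ℝ) (w : ℕ → ℝ) :
    ev n (st.set ⟨20, [y]⟩ (st.mem 20 [st.reg y] + v)) w = ev n st w + v * w (st.reg y) := by
  have h : ∀ j ∈ Finset.range n, (st.set ⟨20, [y]⟩ (st.mem 20 [st.reg y] + v)).mem 20 [j] * w j =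
      st.mem 20 [j] * w j + if j = st.reg y then v * w (st.reg y) else 0 := by
    intro j _
    by_cases hj : j = st.reg y
    · simp [hj, add_mul]
    · simp [hj]
  rw [ev, ev, Finset.sum_congr rfl h, Finset.sum_add_distrib]
  simp [hy]

/-- Clears the coefficients of the equation in array `20`. -/
def zeroE (n : ℕ) : Prog := loop 10 n (const ⟨20, [10]⟩ 0)

theorem ev_zeroE {n : ℕ} (st : State) (w : ℕ → ℝ) : ev (st.reg n) ((zeroE n).exec st) w = 0 := by
  refine Finset.sum_eq_zero fun j hj => ?_
  obtain ⟨s1, f1, r1, -, e1⟩ := loop_row (d := 20) (m := 0) (i := 10) (x := n)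
    (p := const ⟨20, [10]⟩ 0) (Finset.mem_range.1 hj) rfl rfl
  rw [zeroE, e1 _ rfl]
  simp [r1]

/-- Adds the number in the cell `c` to the coefficient with index in register `y`. -/
def eqAdd (y : ℕ) (c : Cell) : Prog := arith .add ⟨20, [y]⟩ ⟨20, [y]⟩ c

/-- Subtracts the number in the cell `c` from the coefficient with index in register `y`. -/
def eqSub (y : ℕ) (c : Cell) : Prog := arith .sub ⟨20, [y]⟩ ⟨20, [y]⟩ c

theorem ev_eqAdd {n y B : ℕ} {J : List ℕ} (st : State) (hy : st.reg y < n) (w : ℕ → ℝ) :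
    ev n ((eqAdd y ⟨B, J⟩).exec st) w = ev n st w + st.mem B (J.map st.reg) * w (st.reg y) := by
  simpa [eqAdd, ArithOp.eval] using ev_set st hy (st.mem B (J.map st.reg)) w

theorem ev_eqSub {n y B : ℕ} {J : List ℕ} (st : State) (hy : st.reg y < n) (w : ℕ → ℝ) :
    ev n ((eqSub y ⟨B, J⟩).exec st) w = ev n st w + -st.mem B (J.map st.reg) * w (st.reg y) := by
  simpa [eqSub, ArithOp.eval, sub_eq_add_neg] using ev_set st hy (-st.mem B (J.map st.reg)) w

/-- Adds the equation whose coefficients are computed by `B` to the system. -/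
def equation (n : ℕ) (B : Prog) : Prog := zeroE n ;; B ;; addEq n

theorem equation_spec {n m : ℕ} {B : Prog} {st : State} {S : (ℕ → ℝ) → Prop}
    (h : Rep m (V st) S) (hm : st.reg n = m) (g : (ℕ → ℝ) → ℝ) (hn : n < 10)
    (hB : B.wr.contains n = false) (hV : B.wm.contains 21 = false)
    (hg : ∀ w st', Frame (zeroE n) st st' → ev m (B.exec st') w = ev m st' w + g w) :
    Rep m (V ((equation n B).exec st)) fun w => S w ∧ g w = 0 := by
  subst hm
  have f := frame_exec (zeroE n) st
  have hr : (B.exec ((zeroE n).exec st)).reg n = st.reg n := by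
    rw [(frame_exec B _).reg n hB, f.reg n (by simp [zeroE, wr]; omega)]
  have hV' : V (B.exec ((zeroE n).exec st)) = V st := by
    funext i j
    rw [V, (frame_exec B _).mem 21 hV, f.mem 21 rfl, V]
  have := addEq_spec hn (B.exec ((zeroE n).exec st)) (S := S) (by rwa [hr, hV'])
  rw [hr] at this
  refine this.congr_prop fun w => ?_
  have := hg w _ f
  rw [ev_zeroE, zero_add] at this
  rw [← this, ev]

/-! ### The parts of the program

Conventions, with `N = n₁ n₂`. Pairs of indices are flattened to `(i, j) ↦ i n₂ + j`, and pairs of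
such pairs to `(p, q) ↦ p N + q`.

Index registers:
* `0`, `1`, `2`, `5`, `6`, `7`, `8`, `9` hold `n₁`, `n₂`, `n₃`, `N`, `N + 1`, `N²`, `0`, `1`, and do
  not change after the start; `3` and `4` hold `r` and `s`;
* `10`, …, `14` and `19` are used by `addEq` and `flat`; the others are loop counters and flattened
  indices. An `idxConst 11 0` or `idxConst 14 0` serves as an empty branch.

Arrays:
* `0`, …, `13` are the input and the output;
* `20` holds the current equation, `21` the current solution space; `22`, `23`, `24`, `26`, `40`,
  `42`, `43` are scratch;
* `25` holds a matrix with kernel `U`, `50` the `Pᵢ`, `28`, `29` the contractions `A`, `B`, `51`,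
  `52` their pseudo-inverses, `36` a square, `38` the matrix `A B⁺`, `39` its powers, `41` the
  coefficients of a polynomial, and `53` the eigenvectors.

After a homogenized system has been solved, row `0` of array `21` is the solution (`Rep.solve`). -/

/-- The slices of the tensor; the first ones will be a basis of their span. -/
def slicesProg : Prog :=
  loop 18 2 (loop 15 0 (loop 16 1 (copy ⟨1, [18, 15, 16]⟩ ⟨0, [15, 16, 18]⟩)))

theorem slicesProg_spec {n₁ n₂ n₃ : ℕ} {st : State} (hs : Sizes n₁ n₂ n₃ st) {i j k : ℕ}
    (hi : i < n₁) (hj : j < n₂) (hk : k < n₃) :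
    (slicesProg.exec st).mem 1 [k, i, j] = st.mem 0 [i, j, k] := by
  rw [slicesProg]
  obtain ⟨s1, f1, r1, -, e1⟩ := loop_row (d := 1) (m := 0) (i := 18) (x := 2)
    (p := loop 15 0 (loop 16 1 (copy ⟨1, [18, 15, 16]⟩ ⟨0, [15, 16, 18]⟩)))
    (by rw [hs.r2]; exact hk) rfl rfl
  have hs1 := hs.of_frame f1 rfl
  obtain ⟨s2, f2, r2, -, e2⟩ := loop_row (d := 1) (m := 1) (i := 15) (x := 0)
    (p := loop 16 1 (copy ⟨1, [18, 15, 16]⟩ ⟨0, [15, 16, 18]⟩))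
    (by rw [hs1.r0]; exact hi) rfl rfl
  have hs2 := hs1.of_frame f2 rfl
  obtain ⟨s3, f3, r3, -, e3⟩ := loop_row (d := 1) (m := 2) (i := 16) (x := 1)
    (p := copy ⟨1, [18, 15, 16]⟩ ⟨0, [15, 16, 18]⟩) (by rw [hs2.r1]; exact hj) rfl rfl
  rw [e1 _ rfl, e2 _ rfl, e3 _ rfl]
  have a1 := f3.reg 18 rfl
  have a2 := f2.reg 18 rfl
  have a3 := f3.reg 15 rfl
  simp [a1, a2, a3, r1, r2, r3, f3.mem 0 rfl, f2.mem 0 rfl, f1.mem 0 rfl]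

/-- Array `25` `:=` the orthogonal complement of the slices of the tensor. As a matrix, array `25`
then has the span of the slices as its kernel. -/
def perpProg : Prog :=
  kerInit 5 ;;
  loop 18 2 (equation 5 (loop 15 0 (loop 16 1 (flat 30 15 16 1 ;; eqAdd 30 ⟨0, [15, 16, 18]⟩)))) ;;
  loop 15 5 (loop 16 5 (copy ⟨25, [15, 16]⟩ ⟨21, [15, 16]⟩))

theorem copy_array_spec {d s n : ℕ} {st : State} (hds : d ≠ s) (hn : n ≠ 15) (hn' : n ≠ 16)
    {i j : ℕ} (hi : i < st.reg n) (hj : j < st.reg n) :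
    ((loop 15 n (loop 16 n (copy ⟨d, [15, 16]⟩ ⟨s, [15, 16]⟩))).exec st).mem d [i, j] =
      st.mem s [i, j] := by
  have hc : ∀ m i, [15, 16][m]? = some i → writesAt d m i (copy ⟨d, [15, 16]⟩ ⟨s, [15, 16]⟩) := by
    intro m i h
    simp [copy, writesAt, h]
  obtain ⟨s1, f1, r1, -, e1⟩ := loop_row (d := d) (m := 0) (i := 15) (x := n)
    (p := loop 16 n (copy ⟨d, [15, 16]⟩ ⟨s, [15, 16]⟩)) hi (hc 0 15 rfl) rfl
  have hn1 := f1.reg n (by simp [wr, copy, hn, hn'])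
  obtain ⟨s2, f2, r2, -, e2⟩ := loop_row (d := d) (m := 1) (i := 16) (x := n)
    (p := copy ⟨d, [15, 16]⟩ ⟨s, [15, 16]⟩) (st := s1) (by rwa [hn1]) (hc 1 16 rfl) rfl
  rw [e1 _ rfl, e2 _ rfl]
  have a1 := f2.reg 15 rfl
  have a2 := f2.mem s (by simp [wm, copy, hds.symm])
  have a3 := f1.mem s (by simp [wm, copy, hds.symm])
  simp [hds, a1, a2, a3, r1, r2]

theorem perpProg_spec {n₁ n₂ n₃ : ℕ} {st : State} (hs : Sizes n₁ n₂ n₃ st) :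
    Rep (n₁ * n₂) (fun i j => (perpProg.exec st).mem 25 [i, j]) fun w =>
      ∀ k < n₃, ∑ i ∈ Finset.range n₁, ∑ j ∈ Finset.range n₂,
        st.mem 0 [i, j, k] * w (i * n₂ + j) = 0 := by
  simp only [perpProg, exec_seq]
  have h0 := kerInit_spec (n := 5) (by norm_num) st
  have f0 := frame_exec (kerInit 5) st
  rw [hs.r5] at h0
  set s0 := (kerInit 5).exec st
  have hs0 := hs.of_frame f0 rfl
  have h1 := loop_rep (i := 18) (x := 2) (p := equation 5 (loop 15 0 (loop 16 1
      (flat 30 15 16 1 ;; eqAdd 30 ⟨0, [15, 16, 18]⟩)))) (fun k w =>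
      ∑ i ∈ Finset.range n₁, ∑ j ∈ Finset.range n₂, st.mem 0 [i, j, k] * w (i * n₂ + j) = 0) h0
    (by
      intro k hk s1 f1 r1 S' h1
      have hs1 := hs0.of_frame f1 rfl
      refine equation_spec h1 hs1.r5 _ (by norm_num) rfl rfl ?_
      intro w s2 f2
      have hs2 := hs1.of_frame f2 rfl
      rw [loop_ev (fun i => ∑ j ∈ Finset.range n₂, st.mem 0 [i, j, k] * w (i * n₂ + j)), hs2.r0]
      intro i hi s3 f3 r3
      have hs3 := hs2.of_frame f3 rfl
      rw [loop_ev (fun j => st.mem 0 [i, j, k] * w (i * n₂ + j)), hs3.r1]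
      intro j hj s4 f4 r4
      have hs4 := hs3.of_frame f4 rfl
      rw [hs2.r0] at hi
      rw [hs3.r1] at hj
      have e15 : s4.reg 15 = i := (f4.reg 15 rfl).trans r3
      have e30 : ((flat 30 15 16 1).exec s4).reg 30 = i * n₂ + j := by
        rw [exec_flat_reg_self] <;> simp [e15, r4, hs4.r1]
      have e18 : s4.reg 18 = k := by
        rw [f4.reg 18 rfl, f3.reg 18 rfl, f2.reg 18 rfl, r1]
      have e0 : s4.mem 0 = st.mem 0 := by
        rw [f4.mem 0 rfl, f3.mem 0 rfl, f2.mem 0 rfl, f1.mem 0 rfl, f0.mem 0 rfl]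
      rw [exec_seq, ev_eqAdd _ (by rw [e30]; exact flat_lt hi hj), e30,
        ev_congr (st := s4) (by simp)]
      simp [exec_flat_reg, e15, r4, e18, e0])
  have f1 := frame_exec (loop 18 2 (equation 5 (loop 15 0 (loop 16 1
    (flat 30 15 16 1 ;; eqAdd 30 ⟨0, [15, 16, 18]⟩))))) s0
  have hs1 := hs0.of_frame f1 rfl
  rw [hs0.r2] at h1
  refine (h1.congr_prop fun w => by simp).congr_mat fun i hi j hj => ?_
  rw [copy_array_spec (by decide) (by decide) (by decide) (by rwa [hs1.r5]) (by rwa [hs1.r5]), V]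

end Prog
end JLV

namespace JLV

open Prog

namespace Prog

/-- Adds the equation that the coordinates with the indices in the registers `x` and `y` are
equal. -/
def eqDiff (x y : ℕ) : Prog :=
  equation 7 (const ⟨42, []⟩ 1 ;; eqAdd x ⟨42, []⟩ ;; eqSub y ⟨42, []⟩)

theorem eqDiff_spec {m x y : ℕ} {st : State} {S : (ℕ → ℝ) → Prop} (h : Rep m (V st) S)
    (hm : st.reg 7 = m) (hx : x ≠ 10) (hy : y ≠ 10) (hxm : st.reg x < m) (hym : st.reg y < m) :
    Rep m (V ((eqDiff x y).exec st)) fun w => S w ∧ w (st.reg x) - w (st.reg y) = 0 := by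
  refine equation_spec h hm _ (by norm_num) rfl rfl ?_
  intro w s1 f1
  have ex : s1.reg x = st.reg x := f1.reg x (by simp [zeroE, wr, hx])
  have ey : s1.reg y = st.reg y := f1.reg y (by simp [zeroE, wr, hy])
  set s2 := s1.set ⟨42, []⟩ ((1 : ℤ) : ℝ) with hs2
  have hr : s2.reg = s1.reg := rfl
  have h42 : s2.mem 42 [] = 1 := by simp [hs2]
  have h20 : s2.mem 20 = s1.mem 20 := State.set_mem_of_ne _ _ _ (by decide)
  simp only [exec_seq, exec_const, ← hs2]
  rw [ev_eqSub _ (by simpa [eqAdd, hr, ey] using hym), ev_eqAdd _ (by simpa [hr, ex] using hxm),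
    ev_congr h20]
  simp [eqAdd, hr, ex, ey, h42]
  ring

/-- The system for the intersection of `S²(U)` and the orthogonal complement of the minors: the
unknown matrix is symmetric, array `25` annihilates its columns, and it satisfies the equations of
the minors. -/
def interSystem : Prog :=
  kerInit 7 ;;
  loop 15 5 (loop 16 5 (flat 30 15 16 5 ;; flat 31 16 15 5 ;; eqDiff 30 31)) ;;
  loop 15 5 (loop 16 5 (equation 7 (loop 17 5 (flat 30 17 16 5 ;; eqAdd 30 ⟨25, [15, 17]⟩)))) ;;
  loop 15 0 (loop 16 1 (loop 17 0 (loop 18 1 (flat 32 15 16 1 ;; flat 33 17 18 1 ;;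
    flat 34 15 18 1 ;; flat 35 17 16 1 ;; flat 30 32 33 5 ;; flat 31 34 35 5 ;; eqDiff 30 31))))

theorem interSystem_spec {n₁ n₂ n₃ : ℕ} {st : State} (hs : Sizes n₁ n₂ n₃ st) {N : ℕ}
    (hN : N = n₁ * n₂) :
    Rep (N * N) (V (interSystem.exec st)) fun w =>
      (∀ p < N, ∀ q < N, w (p * N + q) - w (q * N + p) = 0) ∧
      (∀ i < N, ∀ q < N, ∑ p ∈ Finset.range N, st.mem 25 [i, p] * w (p * N + q) = 0) ∧
      ∀ a < n₁, ∀ b < n₂, ∀ c < n₁, ∀ d < n₂,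
        w ((a * n₂ + b) * N + (c * n₂ + d)) - w ((a * n₂ + d) * N + (c * n₂ + b)) = 0 := by
  simp only [interSystem, exec_seq]
  have h0 := kerInit_spec (n := 7) (by norm_num) st
  have f0 := frame_exec (kerInit 7) st
  rw [hs.r7, ← hN] at h0
  set s0 := (kerInit 7).exec st
  have hs0 := hs.of_frame f0 rfl
  have h1 := loop_rep (i := 15) (x := 5)
    (p := loop 16 5 (flat 30 15 16 5 ;; flat 31 16 15 5 ;; eqDiff 30 31))
    (fun p w => ∀ q < N, w (p * N + q) - w (q * N + p) = 0) h0 (by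
      intro p hp s1 f1 r1 S' h1
      have hs1 := hs0.of_frame f1 rfl
      rw [hs0.r5, ← hN] at hp
      have := loop_rep (i := 16) (x := 5) (p := flat 30 15 16 5 ;; flat 31 16 15 5 ;; eqDiff 30 31)
        (fun q w => w (p * N + q) - w (q * N + p) = 0) h1 (by
          intro q hq s2 f2 r2 S'' h2
          have hs2 := hs1.of_frame f2 rfl
          rw [hs1.r5, ← hN] at hq
          have e15 : s2.reg 15 = p := (f2.reg 15 rfl).trans r1
          simp only [exec_seq]
          set s3 := (flat 31 16 15 5).exec ((flat 30 15 16 5).exec s2) with hs3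
          have hV : V s3 = V s2 := by funext i j; simp [V, hs3]
          have e30 : s3.reg 30 = p * N + q := by
            simp [hs3, exec_flat_reg, e15, r2, hs2.r5, hN]
          have e31 : s3.reg 31 = q * N + p := by
            simp [hs3, exec_flat_reg, e15, r2, hs2.r5, hN]
          have e7 : s3.reg 7 = N * N := by simp [hs3, exec_flat_reg, hs2.r7, hN]
          rw [← e30, ← e31]
          refine eqDiff_spec (hV ▸ h2) e7 (by decide) (by decide) ?_ ?_
          · rw [e30]; exact flat_lt hp hq
          · rw [e31]; exact flat_lt hq hp)
      rwa [hs1.r5, ← hN] at this)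
  have f1 := frame_exec (loop 15 5 (loop 16 5 (flat 30 15 16 5 ;; flat 31 16 15 5 ;;
    eqDiff 30 31))) s0
  rw [hs0.r5, ← hN] at h1
  set s1 := (loop 15 5 (loop 16 5 (flat 30 15 16 5 ;; flat 31 16 15 5 ;; eqDiff 30 31))).exec s0
  have hs1 := hs0.of_frame f1 rfl
  have m1 : s1.mem 25 = st.mem 25 := by rw [f1.mem 25 rfl, f0.mem 25 rfl]
  have h2 := loop_rep (i := 15) (x := 5)
    (p := loop 16 5 (equation 7 (loop 17 5 (flat 30 17 16 5 ;; eqAdd 30 ⟨25, [15, 17]⟩))))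
    (fun i w => ∀ q < N, ∑ p ∈ Finset.range N, st.mem 25 [i, p] * w (p * N + q) = 0) h1 (by
      intro i hi s2 f2 r2 S' h2
      have hs2 := hs1.of_frame f2 rfl
      have := loop_rep (i := 16) (x := 5)
        (p := equation 7 (loop 17 5 (flat 30 17 16 5 ;; eqAdd 30 ⟨25, [15, 17]⟩)))
        (fun q w => ∑ p ∈ Finset.range N, st.mem 25 [i, p] * w (p * N + q) = 0) h2 (by
          intro q hq s3 f3 r3 S'' h3
          have hs3 := hs2.of_frame f3 rfl
          rw [hs2.r5, ← hN] at hq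
          refine equation_spec h3 (by rw [hs3.r7, hN]) _ (by norm_num) rfl rfl ?_
          intro w s4 f4
          have hs4 := hs3.of_frame f4 rfl
          rw [loop_ev (fun p => st.mem 25 [i, p] * w (p * N + q)), hs4.r5, ← hN]
          intro p hp s5 f5 r5
          rw [hs4.r5, ← hN] at hp
          have hs5 := hs4.of_frame f5 rfl
          have e16 : s5.reg 16 = q := by rw [f5.reg 16 rfl, f4.reg 16 rfl, r3]
          have e15 : s5.reg 15 = i := by rw [f5.reg 15 rfl, f4.reg 15 rfl, f3.reg 15 rfl, r2]
          have e30 : ((flat 30 17 16 5).exec s5).reg 30 = p * N + q := by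
            simp [exec_flat_reg, e16, r5, hs5.r5, hN]
          have em : s5.mem 25 = st.mem 25 := by
            rw [f5.mem 25 rfl, f4.mem 25 rfl, f3.mem 25 rfl, f2.mem 25 rfl, m1]
          rw [exec_seq, ev_eqAdd _ (by rw [e30]; exact flat_lt hp hq), e30,
            ev_congr (st := s5) (by simp)]
          simp [exec_flat_reg, e15, r5, em])
      rwa [hs2.r5, ← hN] at this)
  have f2 := frame_exec (loop 15 5 (loop 16 5 (equation 7 (loop 17 5 (flat 30 17 16 5 ;;
    eqAdd 30 ⟨25, [15, 17]⟩))))) s1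
  rw [hs1.r5, ← hN] at h2
  set s2 := (loop 15 5 (loop 16 5 (equation 7 (loop 17 5 (flat 30 17 16 5 ;;
    eqAdd 30 ⟨25, [15, 17]⟩))))).exec s1
  have hs2 := hs1.of_frame f2 rfl
  have h3 := loop_rep (i := 15) (x := 0)
    (p := loop 16 1 (loop 17 0 (loop 18 1 (flat 32 15 16 1 ;; flat 33 17 18 1 ;;
      flat 34 15 18 1 ;; flat 35 17 16 1 ;; flat 30 32 33 5 ;; flat 31 34 35 5 ;; eqDiff 30 31))))
    (fun a w => ∀ b < n₂, ∀ c < n₁, ∀ d < n₂,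
        w ((a * n₂ + b) * N + (c * n₂ + d)) - w ((a * n₂ + d) * N + (c * n₂ + b)) = 0) h2 (by
      intro a ha s3 f3 r3 S3 h3
      have hs3 := hs2.of_frame f3 rfl
      rw [hs2.r0] at ha
      have := loop_rep (i := 16) (x := 1)
        (p := loop 17 0 (loop 18 1 (flat 32 15 16 1 ;; flat 33 17 18 1 ;;
          flat 34 15 18 1 ;; flat 35 17 16 1 ;; flat 30 32 33 5 ;; flat 31 34 35 5 ;;
          eqDiff 30 31)))
        (fun b w => ∀ c < n₁, ∀ d < n₂,
          w ((a * n₂ + b) * N + (c * n₂ + d)) - w ((a * n₂ + d) * N + (c * n₂ + b)) = 0) h3 (by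
        intro b hb s4 f4 r4 S4 h4
        have hs4 := hs3.of_frame f4 rfl
        rw [hs3.r1] at hb
        have := loop_rep (i := 17) (x := 0)
          (p := loop 18 1 (flat 32 15 16 1 ;; flat 33 17 18 1 ;;
            flat 34 15 18 1 ;; flat 35 17 16 1 ;; flat 30 32 33 5 ;; flat 31 34 35 5 ;;
            eqDiff 30 31))
          (fun c w => ∀ d < n₂,
            w ((a * n₂ + b) * N + (c * n₂ + d)) - w ((a * n₂ + d) * N + (c * n₂ + b)) = 0) h4 (by
          intro c hc s5 f5 r5 S5 h5
          have hs5 := hs4.of_frame f5 rfl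
          rw [hs4.r0] at hc
          have := loop_rep (i := 18) (x := 1)
            (p := flat 32 15 16 1 ;; flat 33 17 18 1 ;;
              flat 34 15 18 1 ;; flat 35 17 16 1 ;; flat 30 32 33 5 ;; flat 31 34 35 5 ;;
              eqDiff 30 31)
            (fun d w =>
              w ((a * n₂ + b) * N + (c * n₂ + d)) - w ((a * n₂ + d) * N + (c * n₂ + b)) = 0) h5 (by
            intro d hd s6 f6 r6 S6 h6
            have hs6 := hs5.of_frame f6 rfl
            rw [hs5.r1] at hd
            have e17 : s6.reg 17 = c := by rw [f6.reg 17 rfl, r5]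
            have e16 : s6.reg 16 = b := by rw [f6.reg 16 rfl, f5.reg 16 rfl, r4]
            have e15 : s6.reg 15 = a := by
              rw [f6.reg 15 rfl, f5.reg 15 rfl, f4.reg 15 rfl, r3]
            simp only [exec_seq]
            set s7 := (flat 31 34 35 5).exec ((flat 30 32 33 5).exec ((flat 35 17 16 1).exec
              ((flat 34 15 18 1).exec ((flat 33 17 18 1).exec ((flat 32 15 16 1).exec s6)))))
              with hs7
            have hV : V s7 = V s6 := by funext i j; simp [V, hs7]
            have e30 : s7.reg 30 = (a * n₂ + b) * N + (c * n₂ + d) := by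
              simp [hs7, exec_flat_reg, e15, e16, e17, r6, hs6.r5, hs6.r1, hN]
            have e31 : s7.reg 31 = (a * n₂ + d) * N + (c * n₂ + b) := by
              simp [hs7, exec_flat_reg, e15, e16, e17, r6, hs6.r5, hs6.r1, hN]
            have e7 : s7.reg 7 = N * N := by simp [hs7, exec_flat_reg, hs6.r7, hN]
            rw [← e30, ← e31]
            refine eqDiff_spec (hV ▸ h6) e7 (by decide) (by decide) ?_ ?_
            · rw [e30]; subst hN; exact flat_lt (flat_lt ha hb) (flat_lt hc hd)
            · rw [e31]; subst hN; exact flat_lt (flat_lt ha hd) (flat_lt hc hb))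
          rwa [hs5.r1] at this)
        rwa [hs4.r0] at this)
      rwa [hs3.r1] at this)
  rw [hs2.r0] at h3
  exact h3.congr_prop fun w => by simp [and_assoc]

/-- Copies the active rows of array `21` to array `50`, and their number to the registers `3` and
`4`. For generic components, this number is both `s` and `r`. -/
def extractProg : Prog :=
  idxConst 4 0 ;; const ⟨26, []⟩ 0 ;;
  loop 15 7 (ifLe ⟨21, [15, 15]⟩ ⟨26, []⟩ (idxConst 14 0)
    (loop 16 7 (copy ⟨50, [4, 16]⟩ ⟨21, [15, 16]⟩) ;; idxAdd 4 4 9)) ;;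
  idxAdd 3 4 8

theorem extractProg_spec {n₁ n₂ n₃ : ℕ} {st : State} (hs : Sizes n₁ n₂ n₃ st) {m : ℕ}
    (hm : st.reg 7 = m) {S : (ℕ → ℝ) → Prop} (h : Rep m (V st) S) :
    (extractProg.exec st).reg 3 = (extractProg.exec st).reg 4 ∧
    ∃ f : ℕ → ℕ, (∀ l < (extractProg.exec st).reg 4, f l < m ∧ V st (f l) (f l) = 1) ∧
      (∀ i < m, V st i i ≠ 0 → ∃ l < (extractProg.exec st).reg 4, f l = i) ∧
      (∀ l < (extractProg.exec st).reg 4, ∀ l' < (extractProg.exec st).reg 4,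
        f l = f l' → l = l') ∧
      (∀ l < (extractProg.exec st).reg 4, ∀ j < m,
        (extractProg.exec st).mem 50 [l, j] = V st (f l) j) ∧
      ∀ l, (extractProg.exec st).reg 4 ≤ l → ∀ j,
        (extractProg.exec st).mem 50 [l, j] = st.mem 50 [l, j] := by
  simp only [extractProg, exec_seq, exec_idxConst, exec_const]
  set s0 := (st.setReg 4 0).set ⟨26, []⟩ ((0 : ℤ) : ℝ) with hs0
  have m21 : s0.mem 21 = st.mem 21 := by
    rw [hs0, State.set_mem_of_ne _ _ _ (by decide)]; rfl
  have m50 : s0.mem 50 = st.mem 50 := by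
    rw [hs0, State.set_mem_of_ne _ _ _ (by decide)]; rfl
  have e7 : s0.reg 7 = m := by simp [hs0, hm]
  have e9 : s0.reg 9 = 1 := by simp [hs0, hs.r9]
  have e8 : s0.reg 8 = 0 := by simp [hs0, hs.r8]
  have key := loop_induction (i := 15) (x := 7) (p := ifLe ⟨21, [15, 15]⟩ ⟨26, []⟩ (idxConst 14 0)
      (loop 16 7 (copy ⟨50, [4, 16]⟩ ⟨21, [15, 16]⟩) ;; idxAdd 4 4 9)) (st := s0)
    (fun t s => ∃ f : ℕ → ℕ, (∀ l < s.reg 4, f l < t ∧ V st (f l) (f l) = 1) ∧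
      (∀ i < t, V st i i ≠ 0 → ∃ l < s.reg 4, f l = i) ∧
      (∀ l < s.reg 4, ∀ l' < s.reg 4, f l = f l' → l = l') ∧
      (∀ l < s.reg 4, ∀ j < m, s.mem 50 [l, j] = V st (f l) j) ∧
      ∀ l, s.reg 4 ≤ l → ∀ j, s.mem 50 [l, j] = st.mem 50 [l, j])
    ⟨id, by simp [hs0], by simp, by simp [hs0], by simp [hs0], by simp [m50]⟩ (by
      rintro t ht s fr ⟨f, c1, c2, c3, c4, c5⟩
      rw [e7] at ht
      have a21 : s.mem 21 = st.mem 21 := by rw [fr.mem 21 rfl, m21]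
      have a26 : s.mem 26 [] = 0 := by rw [fr.mem 26 rfl]; simp [hs0]
      have a7 : s.reg 7 = m := by rw [fr.reg 7 rfl, e7]
      have a9 : s.reg 9 = 1 := by rw [fr.reg 9 rfl, e9]
      have hV : s.mem 21 [t, t] = V st t t := by rw [a21]; rfl
      by_cases h0 : V st t t = 1
      · have hexec : (ifLe ⟨21, [15, 15]⟩ ⟨26, []⟩ (idxConst 14 0)
            (loop 16 7 (copy ⟨50, [4, 16]⟩ ⟨21, [15, 16]⟩) ;; idxAdd 4 4 9)).exec
            (s.setReg 15 t) = (idxAdd 4 4 9).exec ((loop 16 7 (copy ⟨50, [4, 16]⟩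
              ⟨21, [15, 16]⟩)).exec (s.setReg 15 t)) := by
          rw [exec_ifLe, if_neg]
          · rfl
          · simp [hV, a26, h0]
        rw [hexec]
        have fs := frame_exec (loop 16 7 (copy ⟨50, [4, 16]⟩ ⟨21, [15, 16]⟩)) (s.setReg 15 t)
        have hrow : ∀ j < m, ((loop 16 7 (copy ⟨50, [4, 16]⟩ ⟨21, [15, 16]⟩)).exec
            (s.setReg 15 t)).mem 50 [s.reg 4, j] = V st t j := by
          intro j hj
          obtain ⟨s1, f1, r1, -, e1⟩ := loop_row (d := 50) (m := 1) (k := j) (i := 16) (x := 7)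
            (p := copy ⟨50, [4, 16]⟩ ⟨21, [15, 16]⟩) (st := s.setReg 15 t) (by simpa [a7] using hj)
            rfl rfl
          rw [e1 _ rfl]
          have b4 := f1.reg 4 rfl
          have b15 := f1.reg 15 rfl
          have b21 := f1.mem 21 rfl
          simp at b4 b15 b21
          simp [b4, b15, b21, r1, a21, V]
        have hother : ∀ l j, l ≠ s.reg 4 → ((loop 16 7 (copy ⟨50, [4, 16]⟩ ⟨21, [15, 16]⟩)).exec
            (s.setReg 15 t)).mem 50 [l, j] = s.mem 50 [l, j] := by
          intro l j hl
          rw [mem_of_writesAt (d := 50) (m := 0) (i := 4) _ rfl rfl]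
          · rfl
          · simpa using hl
        set s' := (loop 16 7 (copy ⟨50, [4, 16]⟩ ⟨21, [15, 16]⟩)).exec (s.setReg 15 t)
        have b4 : s'.reg 4 = s.reg 4 := by rw [fs.reg 4 rfl]; simp
        have b9 : s'.reg 9 = 1 := by rw [fs.reg 9 rfl]; simp [a9]
        have d4 : ((idxAdd 4 4 9).exec s').reg 4 = s.reg 4 + 1 := by simp [b4, b9]
        have dm : ((idxAdd 4 4 9).exec s').mem = s'.mem := rfl
        rw [d4, dm]
        refine ⟨Function.update f (s.reg 4) t, ?_, ?_, ?_, ?_, ?_⟩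
        · intro l hl
          rcases Nat.lt_succ_iff_lt_or_eq.1 hl with hl | rfl
          · rw [Function.update_of_ne hl.ne]
            exact ⟨(c1 l hl).1.trans (Nat.lt_succ_self t), (c1 l hl).2⟩
          · simp [h0]
        · intro i hi hne
          rcases Nat.lt_succ_iff_lt_or_eq.1 hi with hi | rfl
          · obtain ⟨l, hl, hfl⟩ := c2 i hi hne
            exact ⟨l, hl.trans (Nat.lt_succ_self _), by rw [Function.update_of_ne hl.ne, hfl]⟩
          · exact ⟨s.reg 4, Nat.lt_succ_self _, by simp⟩
        · intro l hl l' hl' he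
          rcases Nat.lt_succ_iff_lt_or_eq.1 hl with hl | rfl <;>
            rcases Nat.lt_succ_iff_lt_or_eq.1 hl' with hl' | rfl
          · rw [Function.update_of_ne hl.ne, Function.update_of_ne hl'.ne] at he
            exact c3 l hl l' hl' he
          · rw [Function.update_of_ne hl.ne, Function.update_self] at he
            exact absurd he (c1 l hl).1.ne
          · rw [Function.update_of_ne hl'.ne, Function.update_self] at he
            exact absurd he.symm (c1 l' hl').1.ne
          · rfl
        · intro l hl j hj
          rcases Nat.lt_succ_iff_lt_or_eq.1 hl with hl | rfl
          · rw [Function.update_of_ne hl.ne, hother l j hl.ne, c4 l hl j hj]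
          · rw [Function.update_self, hrow j hj]
        · intro l hl j
          rw [hother l j (by omega), c5 l (by omega) j]
      · have h00 : V st t t = 0 := by
          rcases h.diag t ht with h1 | h1
          · exact absurd h1.1 h0
          · exact h1 t ht
        have hexec : (ifLe ⟨21, [15, 15]⟩ ⟨26, []⟩ (idxConst 14 0)
            (loop 16 7 (copy ⟨50, [4, 16]⟩ ⟨21, [15, 16]⟩) ;; idxAdd 4 4 9)).exec
            (s.setReg 15 t) = (s.setReg 15 t).setReg 14 0 := by
          rw [exec_ifLe, if_pos]
          · rfl
          · simp [hV, a26, h00]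
        rw [hexec]
        refine ⟨f, ?_, ?_, by simpa using c3, by simpa using c4, by simpa using c5⟩
        · intro l hl
          exact ⟨(c1 l (by simpa using hl)).1.trans (Nat.lt_succ_self t),
            (c1 l (by simpa using hl)).2⟩
        · intro i hi hne
          rcases Nat.lt_succ_iff_lt_or_eq.1 hi with hi | rfl
          · simpa using c2 i hi hne
          · exact absurd h00 hne)
  rw [e7] at key
  have fk := frame_exec (loop 15 7 (ifLe ⟨21, [15, 15]⟩ ⟨26, []⟩ (idxConst 14 0)
      (loop 16 7 (copy ⟨50, [4, 16]⟩ ⟨21, [15, 16]⟩) ;; idxAdd 4 4 9))) s0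
  set s1 := (loop 15 7 (ifLe ⟨21, [15, 15]⟩ ⟨26, []⟩ (idxConst 14 0)
      (loop 16 7 (copy ⟨50, [4, 16]⟩ ⟨21, [15, 16]⟩) ;; idxAdd 4 4 9))).exec s0
  have b8 : s1.reg 8 = 0 := by rw [fk.reg 8 rfl, e8]
  simpa [b8] using key

/-- The coefficients of the two contractions are two rows of slices of the tensor. -/
def coefProg : Prog :=
  loop 15 2 (copy ⟨3, [15]⟩ ⟨0, [8, 8, 15]⟩ ;; copy ⟨4, [15]⟩ ⟨0, [8, 9, 15]⟩)

theorem coefProg_spec {n₁ n₂ n₃ : ℕ} {st : State} (hs : Sizes n₁ n₂ n₃ st) {i : ℕ} (hi : i < n₃) :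
    (coefProg.exec st).mem 3 [i] = st.mem 0 [0, 0, i] ∧
      (coefProg.exec st).mem 4 [i] = st.mem 0 [0, 1, i] := by
  constructor
  · obtain ⟨s1, f1, r1, -, e1⟩ := loop_row (d := 3) (m := 0) (i := 15) (x := 2)
      (p := copy ⟨3, [15]⟩ ⟨0, [8, 8, 15]⟩ ;; copy ⟨4, [15]⟩ ⟨0, [8, 9, 15]⟩)
      (by rw [hs.r2]; exact hi) rfl rfl
    have hs1 := hs.of_frame f1 rfl
    rw [coefProg, e1 _ rfl]
    simp [r1, hs1.r8, f1.mem 0 rfl]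
  · obtain ⟨s1, f1, r1, -, e1⟩ := loop_row (d := 4) (m := 0) (i := 15) (x := 2)
      (p := copy ⟨3, [15]⟩ ⟨0, [8, 8, 15]⟩ ;; copy ⟨4, [15]⟩ ⟨0, [8, 9, 15]⟩)
      (by rw [hs.r2]; exact hi) rfl rfl
    have hs1 := hs.of_frame f1 rfl
    rw [coefProg, e1 _ rfl]
    simp [r1, hs1.r8, hs1.r9, f1.mem 0 rfl]

/-- Array `d` `:= ∑ᵢ cᵢ Pᵢ`, where array `c` holds the coefficients `cᵢ`. -/
def contract (c d : ℕ) : Prog :=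
  loop 15 5 (loop 16 5 (flat 30 15 16 5 ;; dot 17 5 ⟨c, [17]⟩ ⟨50, [17, 30]⟩ ;;
    copy ⟨d, [15, 16]⟩ ⟨40, []⟩))

theorem contract_spec {n₁ n₂ n₃ : ℕ} {st : State} (hs : Sizes n₁ n₂ n₃ st) {c d N : ℕ}
    (hN : N = n₁ * n₂) (hc : c ∉ [24, 40, d]) (hd : d ∉ [24, 40, 50]) {p q : ℕ} (hp : p < N)
    (hq : q < N) :
    ((contract c d).exec st).mem d [p, q] =
      ∑ i ∈ Finset.range N, st.mem c [i] * st.mem 50 [i, p * N + q] := by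
  simp only [List.mem_cons, List.not_mem_nil, or_false, not_or] at hc hd
  have hw : ∀ m i, [15, 16][m]? = some i → writesAt d m i (flat 30 15 16 5 ;;
      dot 17 5 ⟨c, [17]⟩ ⟨50, [17, 30]⟩ ;; copy ⟨d, [15, 16]⟩ ⟨40, []⟩) := by
    intro m i h
    simp [flat, dot, copy, writesAt, h, Ne.symm hd.1, Ne.symm hd.2.1]
  obtain ⟨s1, f1, r1, -, e1⟩ := loop_row (d := d) (m := 0) (i := 15) (x := 5)
    (p := loop 16 5 (flat 30 15 16 5 ;; dot 17 5 ⟨c, [17]⟩ ⟨50, [17, 30]⟩ ;;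
    copy ⟨d, [15, 16]⟩ ⟨40, []⟩)) (by rw [hs.r5, ← hN]; exact hp) (hw 0 15 rfl) rfl
  have hs1 := hs.of_frame f1 rfl
  obtain ⟨s2, f2, r2, -, e2⟩ := loop_row (d := d) (m := 1) (i := 16) (x := 5)
    (p := flat 30 15 16 5 ;; dot 17 5 ⟨c, [17]⟩ ⟨50, [17, 30]⟩ ;;
    copy ⟨d, [15, 16]⟩ ⟨40, []⟩) (st := s1) (by rw [hs1.r5, ← hN]; exact hq) (hw 1 16 rfl) rfl
  have hs2 := hs1.of_frame f2 rfl
  rw [contract, e1 _ rfl, e2 _ rfl]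
  have a15 := f2.reg 15 rfl
  have ac := f2.mem c (by simp [flat, dot, copy, wm, hc])
  have ac1 := f1.mem c (by simp [flat, dot, copy, wm, hc])
  have a50 := f2.mem 50 (by simp [flat, dot, copy, wm, Ne.symm hd.2.2])
  have a501 := f1.mem 50 (by simp [flat, dot, copy, wm, Ne.symm hd.2.2])
  simp [exec_dot_acc, exec_dot_reg, exec_flat_reg, a15, r1, r2, hs2.r5, ac, ac1, a50, a501, hc,
    hd, hN]

/-- Array `d` `:=` the product of the matrices in the arrays `x` and `y`. -/
def matmul (x y d : ℕ) : Prog :=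
  loop 15 5 (loop 16 5 (dot 17 5 ⟨x, [15, 17]⟩ ⟨y, [17, 16]⟩ ;; copy ⟨d, [15, 16]⟩ ⟨40, []⟩))

theorem matmul_spec {n₁ n₂ n₃ : ℕ} {st : State} (hs : Sizes n₁ n₂ n₃ st) {x y d N : ℕ}
    (hN : N = n₁ * n₂) (hx : x ∉ [24, 40, d]) (hy : y ∉ [24, 40, d]) (hd : d ∉ [24, 40]) {p q : ℕ}
    (hp : p < N) (hq : q < N) :
    ((matmul x y d).exec st).mem d [p, q] =
      ∑ i ∈ Finset.range N, st.mem x [p, i] * st.mem y [i, q] := by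
  simp only [List.mem_cons, List.not_mem_nil, or_false, not_or] at hx hy hd
  have hw : ∀ m i, [15, 16][m]? = some i → writesAt d m i
      (dot 17 5 ⟨x, [15, 17]⟩ ⟨y, [17, 16]⟩ ;; copy ⟨d, [15, 16]⟩ ⟨40, []⟩) := by
    intro m i h
    simp [dot, copy, writesAt, h, Ne.symm hd.1, Ne.symm hd.2]
  obtain ⟨s1, f1, r1, -, e1⟩ := loop_row (d := d) (m := 0) (i := 15) (x := 5)
    (p := loop 16 5 (dot 17 5 ⟨x, [15, 17]⟩ ⟨y, [17, 16]⟩ ;; copy ⟨d, [15, 16]⟩ ⟨40, []⟩))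
    (by rw [hs.r5, ← hN]; exact hp) (hw 0 15 rfl) rfl
  have hs1 := hs.of_frame f1 rfl
  obtain ⟨s2, f2, r2, -, e2⟩ := loop_row (d := d) (m := 1) (i := 16) (x := 5)
    (p := dot 17 5 ⟨x, [15, 17]⟩ ⟨y, [17, 16]⟩ ;; copy ⟨d, [15, 16]⟩ ⟨40, []⟩) (st := s1)
    (by rw [hs1.r5, ← hN]; exact hq) (hw 1 16 rfl) rfl
  have hs2 := hs1.of_frame f2 rfl
  rw [matmul, e1 _ rfl, e2 _ rfl]
  have a15 := f2.reg 15 rfl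
  have b1 := f2.mem x (by simp [dot, copy, wm, hx])
  have b2 := f1.mem x (by simp [dot, copy, wm, hx])
  have b3 := f2.mem y (by simp [dot, copy, wm, hy])
  have b4 := f1.mem y (by simp [dot, copy, wm, hy])
  simp [exec_dot_acc, exec_dot_reg, a15, r1, r2, hs2.r5, b1, b2, b3, b4, hx, hy, hd, hN]

end Prog
end JLV

namespace JLV

open Prog

namespace Prog

/-- Array `d` `:=` the pseudo-inverse of the symmetric matrix in array `a` with kernel `U^⊥`. Its
rows are the solutions `x` of `x A² = Aᵢ` in `U`. -/
def pinv (a d : ℕ) : Prog :=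
  matmul a a 36 ;;
  loop 18 5 (kerInit 6 ;;
    loop 15 5 (equation 6 (eqSub 8 ⟨a, [18, 15]⟩ ;;
      loop 16 5 (idxAdd 17 16 9 ;; eqAdd 17 ⟨36, [16, 15]⟩))) ;;
    loop 15 5 (equation 6 (loop 16 5 (idxAdd 17 16 9 ;; eqAdd 17 ⟨25, [15, 16]⟩))) ;;
    loop 16 5 (idxAdd 17 16 9 ;; copy ⟨d, [18, 16]⟩ ⟨21, [8, 17]⟩))

theorem pinv_spec {n₁ n₂ n₃ : ℕ} {st : State} (hs : Sizes n₁ n₂ n₃ st) {a d N : ℕ}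
    (hN : N = n₁ * n₂) (ha : a ∉ [20, 21, 22, 23, 24, 26, 36, 40, d])
    (hd : d ∉ [20, 21, 22, 23, 24, 25, 26, 36, 40]) {i : ℕ} (hi : i < N)
    (hx : ∃ x : ℕ → ℝ, (∀ q < N, ∑ p ∈ Finset.range N,
        (∑ l ∈ Finset.range N, st.mem a [p, l] * st.mem a [l, q]) * x p = st.mem a [i, q]) ∧
      ∀ j < N, ∑ p ∈ Finset.range N, st.mem 25 [j, p] * x p = 0) :
    (∀ q < N, ∑ p ∈ Finset.range N,
        (∑ l ∈ Finset.range N, st.mem a [p, l] * st.mem a [l, q]) *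
          ((pinv a d).exec st).mem d [i, p] = st.mem a [i, q]) ∧
      ∀ j < N, ∑ p ∈ Finset.range N, st.mem 25 [j, p] * ((pinv a d).exec st).mem d [i, p] = 0 := by
  simp only [List.mem_cons, List.not_mem_nil, or_false, not_or] at ha hd
  simp only [pinv, exec_seq]
  have f0 := frame_exec (matmul a a 36) st
  have m36 : ∀ p < N, ∀ q < N, ((matmul a a 36).exec st).mem 36 [p, q] =
      ∑ l ∈ Finset.range N, st.mem a [p, l] * st.mem a [l, q] := fun p hp q hq =>
    matmul_spec hs hN (by simp [ha]) (by simp [ha]) (by simp) hp hq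
  set s0 := (matmul a a 36).exec st
  have hs0 := hs.of_frame f0 rfl
  have a0 : s0.mem a = st.mem a := f0.mem a (by simp [matmul, dot, copy, wm, ha])
  have v0 : s0.mem 25 = st.mem 25 := f0.mem 25 rfl
  obtain ⟨s1, f1, r1, -, e1⟩ := loop_row (d := d) (m := 0) (k := i) (i := 18) (x := 5)
    (p := kerInit 6 ;;
      loop 15 5 (equation 6 (eqSub 8 ⟨a, [18, 15]⟩ ;;
        loop 16 5 (idxAdd 17 16 9 ;; eqAdd 17 ⟨36, [16, 15]⟩))) ;;
      loop 15 5 (equation 6 (loop 16 5 (idxAdd 17 16 9 ;; eqAdd 17 ⟨25, [15, 16]⟩))) ;;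
      loop 16 5 (idxAdd 17 16 9 ;; copy ⟨d, [18, 16]⟩ ⟨21, [8, 17]⟩)) (st := s0)
    (by rw [hs0.r5, ← hN]; exact hi)
    (by simp [kerInit, equation, zeroE, addEq, eqAdd, eqSub, dot, copy, writesAt,
      Ne.symm hd.1, Ne.symm hd.2.1, Ne.symm hd.2.2.1, Ne.symm hd.2.2.2.1, Ne.symm hd.2.2.2.2.1,
      Ne.symm hd.2.2.2.2.2.2.1, Ne.symm hd.2.2.2.2.2.2.2.2]) rfl
  have hs1 := hs0.of_frame f1 rfl
  have a1 : s1.mem a = st.mem a := by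
    rw [f1.mem a (by simp [kerInit, equation, zeroE, addEq, eqAdd, eqSub, dot, copy, wm, ha]), a0]
  have v1 : s1.mem 25 = st.mem 25 := by
    rw [f1.mem 25 (by simp [kerInit, equation, zeroE, addEq, eqAdd, eqSub, dot, copy, wm,
      Ne.symm hd.2.2.2.2.2.1]), v0]
  have q1 : s1.mem 36 = s0.mem 36 :=
    f1.mem 36 (by simp [kerInit, equation, zeroE, addEq, eqAdd, eqSub, dot, copy, wm,
      Ne.symm hd.2.2.2.2.2.2.2.1])
  simp only [exec_seq] at e1
  have h2 := kerInit_spec (n := 6) (by norm_num) s1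
  have f2 := frame_exec (kerInit 6) s1
  rw [hs1.r6, ← hN] at h2
  set s2 := (kerInit 6).exec s1
  have hs2 := hs1.of_frame f2 rfl
  have h3 := loop_rep (i := 15) (x := 5) (p := equation 6 (eqSub 8 ⟨a, [18, 15]⟩ ;;
      loop 16 5 (idxAdd 17 16 9 ;; eqAdd 17 ⟨36, [16, 15]⟩)))
    (fun q w => -st.mem a [i, q] * w 0 + ∑ p ∈ Finset.range N, s0.mem 36 [p, q] * w (p + 1) = 0)
    h2 (by
      intro q hq s3 f3 r3 S' h3
      have hs3 := hs2.of_frame f3 rfl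
      refine equation_spec h3 (by rw [hs3.r6, hN]) _ (by norm_num) rfl rfl ?_
      intro w s4 f4
      have hs4 := hs3.of_frame f4 rfl
      have e18 : s4.reg 18 = i := by rw [f4.reg 18 rfl, f3.reg 18 rfl, f2.reg 18 rfl, r1]
      have e15 : s4.reg 15 = q := by rw [f4.reg 15 rfl, r3]
      have a4 : s4.mem a = st.mem a := by
        rw [f4.mem a (by simp [zeroE, wm, ha]), f3.mem a (by simp [equation, zeroE, addEq, eqAdd,
          eqSub, dot, copy, wm, ha]), f2.mem a (by simp [kerInit, wm, ha]), a1]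
      have q4 : s4.mem 36 = s0.mem 36 := by
        rw [f4.mem 36 rfl, f3.mem 36 rfl, f2.mem 36 rfl, q1]
      have f5 := frame_exec (eqSub 8 ⟨a, [18, 15]⟩) s4
      rw [exec_seq, loop_ev (fun p => s0.mem 36 [p, q] * w (p + 1)), ev_eqSub]
      · have hs5 := hs4.of_frame f5 rfl
        simp only [hs5.r5]
        simp [e18, e15, a4, hs4.r8, hN]
        ring
      · rw [hs4.r8]; omega
      · intro p hp s6 f6 r6
        have hs5 := hs4.of_frame f5 rfl
        have hs6 := hs5.of_frame f6 rfl
        rw [hs5.r5, ← hN] at hp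
        have g15 : s6.reg 15 = q := by rw [f6.reg 15 rfl, f5.reg 15 rfl, e15]
        have g36 : s6.mem 36 = s0.mem 36 := by rw [f6.mem 36 rfl, f5.mem 36 rfl, q4]
        rw [exec_seq, ev_eqAdd _ (by simp [r6, hs6.r9]; omega), exec_idxAdd, ev_setReg]
        simp [r6, hs6.r9, g15, g36])
  have f3 := frame_exec (loop 15 5 (equation 6 (eqSub 8 ⟨a, [18, 15]⟩ ;;
      loop 16 5 (idxAdd 17 16 9 ;; eqAdd 17 ⟨36, [16, 15]⟩)))) s2
  rw [hs2.r5, ← hN] at h3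
  set s3 := (loop 15 5 (equation 6 (eqSub 8 ⟨a, [18, 15]⟩ ;;
      loop 16 5 (idxAdd 17 16 9 ;; eqAdd 17 ⟨36, [16, 15]⟩)))).exec s2
  have hs3 := hs2.of_frame f3 rfl
  have v3 : s3.mem 25 = st.mem 25 := by rw [f3.mem 25 rfl, f2.mem 25 rfl, v1]
  have h4 := loop_rep (i := 15) (x := 5)
    (p := equation 6 (loop 16 5 (idxAdd 17 16 9 ;; eqAdd 17 ⟨25, [15, 16]⟩)))
    (fun j w => ∑ p ∈ Finset.range N, st.mem 25 [j, p] * w (p + 1) = 0) h3 (by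
      intro j hj s4 f4 r4 S' h4
      have hs4 := hs3.of_frame f4 rfl
      refine equation_spec h4 (by rw [hs4.r6, hN]) _ (by norm_num) rfl rfl ?_
      intro w s5 f5
      have hs5 := hs4.of_frame f5 rfl
      rw [loop_ev (fun p => st.mem 25 [j, p] * w (p + 1)), hs5.r5, ← hN]
      intro p hp s6 f6 r6
      have hs6 := hs5.of_frame f6 rfl
      rw [hs5.r5, ← hN] at hp
      have g15 : s6.reg 15 = j := by rw [f6.reg 15 rfl, f5.reg 15 rfl, r4]
      have g25 : s6.mem 25 = st.mem 25 := by
        rw [f6.mem 25 rfl, f5.mem 25 rfl, f4.mem 25 rfl, v3]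
      rw [exec_seq, ev_eqAdd _ (by simp [r6, hs6.r9]; omega), exec_idxAdd, ev_setReg]
      simp [r6, hs6.r9, g15, g25])
  have f4 := frame_exec (loop 15 5 (equation 6
    (loop 16 5 (idxAdd 17 16 9 ;; eqAdd 17 ⟨25, [15, 16]⟩)))) s3
  rw [hs3.r5, ← hN] at h4
  set s4 := (loop 15 5 (equation 6
    (loop 16 5 (idxAdd 17 16 9 ;; eqAdd 17 ⟨25, [15, 16]⟩)))).exec s3
  have hs4 := hs3.of_frame f4 rfl
  have hout : ∀ p < N, ((loop 18 5 (kerInit 6 ;;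
      loop 15 5 (equation 6 (eqSub 8 ⟨a, [18, 15]⟩ ;;
        loop 16 5 (idxAdd 17 16 9 ;; eqAdd 17 ⟨36, [16, 15]⟩))) ;;
      loop 15 5 (equation 6 (loop 16 5 (idxAdd 17 16 9 ;; eqAdd 17 ⟨25, [15, 16]⟩))) ;;
      loop 16 5 (idxAdd 17 16 9 ;; copy ⟨d, [18, 16]⟩ ⟨21, [8, 17]⟩))).exec s0).mem d [i, p] =
      V s4 0 (p + 1) := by
    intro p hp
    rw [e1 _ rfl]
    obtain ⟨s5, f5, r5, -, e5⟩ := loop_row (d := d) (m := 1) (k := p) (i := 16) (x := 5)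
      (p := idxAdd 17 16 9 ;; copy ⟨d, [18, 16]⟩ ⟨21, [8, 17]⟩) (st := s4)
      (by rw [hs4.r5, ← hN]; exact hp) (by simp [copy, writesAt]) rfl
    have hs5 := hs4.of_frame f5 rfl
    rw [e5 _ rfl]
    have g18 : s5.reg 18 = i := by
      rw [f5.reg 18 rfl, f4.reg 18 rfl, f3.reg 18 rfl, f2.reg 18 rfl, r1]
    have g21 : s5.mem 21 = s4.mem 21 := f5.mem 21 (by simp [copy, wm, Ne.symm hd.2.1])
    simp [hd.2.1, g18, r5, hs5.r8, hs5.r9, g21, V]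
  have h5 : Rep (N + 1) (V s4) fun w => ∀ t : ℕ ⊕ ℕ, Sum.elim (· < N) (· < N) t →
      -(Sum.elim (fun q => st.mem a [i, q]) (fun _ => 0) t) * w 0 + ∑ p ∈ Finset.range N,
        Sum.elim (fun q p => s0.mem 36 [p, q]) (fun j p => st.mem 25 [j, p]) t p * w (p + 1) = 0 :=
    h4.congr_prop fun w => by simp [Sum.forall]
  obtain ⟨x, hx1, hx2⟩ := hx
  have h6 := h5.solve ⟨x, by
    rintro (q | j) ht
    · rw [Sum.elim_inl, Sum.elim_inl, ← hx1 q ht]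
      exact Finset.sum_congr rfl fun p hp => by rw [m36 p (Finset.mem_range.1 hp) q ht]
    · exact hx2 j ht⟩
  refine ⟨fun q hq => ?_, fun j hj => ?_⟩
  · rw [← show _ = st.mem a [i, q] from h6 (.inl q) hq]
    refine Finset.sum_congr rfl fun p hp => ?_
    have hp := Finset.mem_range.1 hp
    rw [hout p hp, ← m36 p hp q hq]
    rfl
  · refine (show _ = (0 : ℝ) from h6 (.inr j) hj) ▸ ?_
    refine Finset.sum_congr rfl fun p hp => ?_
    rw [hout p (Finset.mem_range.1 hp)]
    rfl

/-- Array `39` `:=` the matrices `M, M², …, M^{N+1}`, where `M` is the matrix in array `38`. -/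
def powProg : Prog :=
  loop 15 5 (loop 16 5 (copy ⟨39, [8, 15, 16]⟩ ⟨38, [15, 16]⟩)) ;;
  loop 18 5 (idxAdd 17 18 9 ;;
    loop 15 5 (loop 16 5 (dot 14 5 ⟨39, [18, 15, 14]⟩ ⟨38, [14, 16]⟩ ;;
      copy ⟨43, [15, 16]⟩ ⟨40, []⟩)) ;;
    loop 15 5 (loop 16 5 (copy ⟨39, [17, 15, 16]⟩ ⟨43, [15, 16]⟩)))

theorem copy_row_spec {d s x n : ℕ} {st : State} (hds : d ≠ s) (hn : n ∉ [15, 16])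
    (hx : x ∉ [15, 16]) {i j : ℕ} (hi : i < st.reg n) (hj : j < st.reg n) :
    ((loop 15 n (loop 16 n (copy ⟨d, [x, 15, 16]⟩ ⟨s, [15, 16]⟩))).exec st).mem d
      [st.reg x, i, j] = st.mem s [i, j] := by
  simp only [List.mem_cons, List.not_mem_nil, or_false, not_or] at hn hx
  have hc : ∀ m i, [x, 15, 16][m]? = some i →
      writesAt d m i (copy ⟨d, [x, 15, 16]⟩ ⟨s, [15, 16]⟩) := by
    intro m i h
    simp [copy, writesAt, h]
  obtain ⟨s1, f1, r1, -, e1⟩ := loop_row (d := d) (m := 1) (i := 15) (x := n)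
    (p := loop 16 n (copy ⟨d, [x, 15, 16]⟩ ⟨s, [15, 16]⟩)) hi (hc 1 15 rfl) rfl
  have hn1 := f1.reg n (by simp [wr, copy, hn])
  obtain ⟨s2, f2, r2, -, e2⟩ := loop_row (d := d) (m := 2) (i := 16) (x := n)
    (p := copy ⟨d, [x, 15, 16]⟩ ⟨s, [15, 16]⟩) (st := s1) (by rwa [hn1]) (hc 2 16 rfl) rfl
  rw [e1 _ rfl, e2 _ rfl]
  have a1 := f2.reg 15 rfl
  have a2 := f2.mem s (by simp [wm, copy, hds.symm])
  have a3 := f1.mem s (by simp [wm, copy, hds.symm])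
  have a4 := f2.reg x (by simp [wr, copy, hx])
  have a5 := f1.reg x (by simp [wr, copy, hx])
  simp [hds, a1, a2, a3, r1, r2, a4, a5]

theorem powProg_spec {n₁ n₂ n₃ : ℕ} {st : State} (hs : Sizes n₁ n₂ n₃ st) {N : ℕ}
    (hN : N = n₁ * n₂) :
    (∀ p < N, ∀ q < N, (powProg.exec st).mem 39 [0, p, q] = st.mem 38 [p, q]) ∧
      ∀ k < N, ∀ p < N, ∀ q < N, (powProg.exec st).mem 39 [k + 1, p, q] =
        ∑ i ∈ Finset.range N, (powProg.exec st).mem 39 [k, p, i] * st.mem 38 [i, q] := by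
  simp only [powProg, exec_seq]
  have f0 := frame_exec (loop 15 5 (loop 16 5 (copy ⟨39, [8, 15, 16]⟩ ⟨38, [15, 16]⟩))) st
  have h0 : ∀ p < N, ∀ q < N, ((loop 15 5 (loop 16 5 (copy ⟨39, [8, 15, 16]⟩
      ⟨38, [15, 16]⟩))).exec st).mem 39 [0, p, q] = st.mem 38 [p, q] := by
    intro p hp q hq
    have := copy_row_spec (d := 39) (s := 38) (x := 8) (n := 5) (st := st) (i := p) (j := q)
      (by decide) (by decide) (by decide) (by rw [hs.r5, ← hN]; exact hp)
      (by rw [hs.r5, ← hN]; exact hq)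
    rwa [hs.r8] at this
  set s0 := (loop 15 5 (loop 16 5 (copy ⟨39, [8, 15, 16]⟩ ⟨38, [15, 16]⟩))).exec st
  have hs0 := hs.of_frame f0 rfl
  have m0 : s0.mem 38 = st.mem 38 := f0.mem 38 rfl
  have key := loop_induction (i := 18) (x := 5) (p := idxAdd 17 18 9 ;;
    loop 15 5 (loop 16 5 (dot 14 5 ⟨39, [18, 15, 14]⟩ ⟨38, [14, 16]⟩ ;;
      copy ⟨43, [15, 16]⟩ ⟨40, []⟩)) ;;
    loop 15 5 (loop 16 5 (copy ⟨39, [17, 15, 16]⟩ ⟨43, [15, 16]⟩))) (st := s0)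
    (fun t s => (∀ p < N, ∀ q < N, s.mem 39 [0, p, q] = st.mem 38 [p, q]) ∧
      ∀ k < t, ∀ p < N, ∀ q < N, s.mem 39 [k + 1, p, q] =
        ∑ i ∈ Finset.range N, s.mem 39 [k, p, i] * st.mem 38 [i, q]) ⟨h0, by simp⟩ (by
      rintro t ht s f ⟨i1, i2⟩
      have hs1 := hs0.of_frame f rfl
      have hm : s.mem 38 = st.mem 38 := by rw [f.mem 38 rfl, m0]
      rw [exec_seq, exec_seq]
      set s1 := (idxAdd 17 18 9).exec (s.setReg 18 t) with hs1'
      have g17 : s1.reg 17 = t + 1 := by simp [hs1', hs1.r9]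
      have g18 : s1.reg 18 = t := by simp [hs1']
      have hs2 : Sizes n₁ n₂ n₃ s1 := by
        constructor <;> simp [hs1', hs1.r0, hs1.r1, hs1.r2, hs1.r5, hs1.r6, hs1.r7, hs1.r8, hs1.r9]
      have gm : s1.mem = s.mem := rfl
      have f2 := frame_exec (loop 15 5 (loop 16 5 (dot 14 5 ⟨39, [18, 15, 14]⟩ ⟨38, [14, 16]⟩ ;;
        copy ⟨43, [15, 16]⟩ ⟨40, []⟩))) s1
      have hmul : ∀ p < N, ∀ q < N, ((loop 15 5 (loop 16 5
          (dot 14 5 ⟨39, [18, 15, 14]⟩ ⟨38, [14, 16]⟩ ;;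
          copy ⟨43, [15, 16]⟩ ⟨40, []⟩))).exec s1).mem 43 [p, q] =
          ∑ i ∈ Finset.range N, s.mem 39 [t, p, i] * st.mem 38 [i, q] := by
        intro p hp q hq
        obtain ⟨s3, f3, r3, -, e3⟩ := loop_row (d := 43) (m := 0) (k := p) (i := 15) (x := 5)
          (p := loop 16 5 (dot 14 5 ⟨39, [18, 15, 14]⟩ ⟨38, [14, 16]⟩ ;;
            copy ⟨43, [15, 16]⟩ ⟨40, []⟩)) (st := s1) (by rw [hs2.r5, ← hN]; exact hp) rfl rfl
        have hs3 := hs2.of_frame f3 rfl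
        obtain ⟨s4, f4, r4, -, e4⟩ := loop_row (d := 43) (m := 1) (k := q) (i := 16) (x := 5)
          (p := dot 14 5 ⟨39, [18, 15, 14]⟩ ⟨38, [14, 16]⟩ ;;
            copy ⟨43, [15, 16]⟩ ⟨40, []⟩) (st := s3) (by rw [hs3.r5, ← hN]; exact hq) rfl rfl
        have hs4 := hs3.of_frame f4 rfl
        rw [e3 _ rfl, e4 _ rfl]
        have a18 : s4.reg 18 = t := by rw [f4.reg 18 rfl, f3.reg 18 rfl, g18]
        have a15 : s4.reg 15 = p := by rw [f4.reg 15 rfl, r3]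
        have a39 : s4.mem 39 = s.mem 39 := by rw [f4.mem 39 rfl, f3.mem 39 rfl, gm]
        have a38 : s4.mem 38 = st.mem 38 := by rw [f4.mem 38 rfl, f3.mem 38 rfl, gm, hm]
        simp [exec_dot_acc, exec_dot_reg, a18, a15, r4, a39, a38, hs4.r5, hN]
      set s2 := (loop 15 5 (loop 16 5 (dot 14 5 ⟨39, [18, 15, 14]⟩ ⟨38, [14, 16]⟩ ;;
        copy ⟨43, [15, 16]⟩ ⟨40, []⟩))).exec s1
      have hs3 := hs2.of_frame f2 rfl
      have k17 : s2.reg 17 = t + 1 := by rw [f2.reg 17 rfl, g17]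
      have k39 : s2.mem 39 = s.mem 39 := by rw [f2.mem 39 rfl, gm]
      have hother : ∀ k p q, k ≠ t + 1 → ((loop 15 5 (loop 16 5
          (copy ⟨39, [17, 15, 16]⟩ ⟨43, [15, 16]⟩))).exec s2).mem 39 [k, p, q] =
          s.mem 39 [k, p, q] := by
        intro k p q hk
        rw [mem_of_writesAt (m := 0) (i := 17) _ rfl rfl _ _ (by simpa [k17] using hk), k39]
      have hnew : ∀ p < N, ∀ q < N, ((loop 15 5 (loop 16 5
          (copy ⟨39, [17, 15, 16]⟩ ⟨43, [15, 16]⟩))).exec s2).mem 39 [t + 1, p, q] =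
          ∑ i ∈ Finset.range N, s.mem 39 [t, p, i] * st.mem 38 [i, q] := by
        intro p hp q hq
        have := copy_row_spec (d := 39) (s := 43) (x := 17) (n := 5) (st := s2) (i := p) (j := q)
          (by decide) (by decide) (by decide) (by rw [hs3.r5, ← hN]; exact hp)
          (by rw [hs3.r5, ← hN]; exact hq)
        rwa [k17, hmul p hp q hq] at this
      refine ⟨fun p hp q hq => by rw [hother _ _ _ (by omega), i1 p hp q hq],
        fun k hk p hp q hq => ?_⟩
      rcases Nat.lt_succ_iff_lt_or_eq.1 hk with hk | rfl
      · rw [hother _ _ _ (by omega), i2 k hk p hp q hq]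
        exact Finset.sum_congr rfl fun i _ => by rw [hother _ _ _ (by omega)]
      · rw [hnew p hp q hq]
        exact Finset.sum_congr rfl fun i _ => by rw [hother _ _ _ (by omega)])
  rwa [hs0.r5, ← hN] at key

/-- Cells `0, …, s - 1` of array `7` `:=` the roots of the minimal polynomial of `M` on its image,
which has degree `s`. Its coefficients `cₖ`, put in array `41`, solve
`Mˢ⁺¹ + ∑ₖ cₖ Mᵏ⁺¹ = 0` (`k < s`); the extra factor `M` makes up for the kernel of `M`. -/
def charProg : Prog :=
  kerInit 6 ;;
  loop 15 5 (loop 16 5 (equation 6 (eqAdd 8 ⟨39, [4, 15, 16]⟩ ;;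
    loop 17 5 (idxAdd 18 17 9 ;;
      ifIdxLt 17 4 (eqAdd 18 ⟨39, [17, 15, 16]⟩) (idxConst 14 0))))) ;;
  loop 17 6 (idxAdd 18 17 9 ;;
    ifIdxLt 17 4 (copy ⟨41, [17]⟩ ⟨21, [8, 18]⟩) (const ⟨41, [17]⟩ 0)) ;;
  const ⟨41, [4]⟩ 1 ;;
  loop 17 5 (ifIdxLt 17 4 (root ⟨7, [17]⟩ ⟨41, []⟩ 5 17) (idxConst 14 0))

theorem charProg_spec {n₁ n₂ n₃ : ℕ} {st : State} (hs : Sizes n₁ n₂ n₃ st) {N s : ℕ}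
    (hN : N = n₁ * n₂) (hsr : st.reg 4 = s) (hsN : s ≤ N)
    (hx : ∃ x : ℕ → ℝ, ∀ p < N, ∀ q < N,
      st.mem 39 [s, p, q] + ∑ k ∈ Finset.range s, st.mem 39 [k, p, q] * x k = 0) :
    ∃ c : ℕ → ℝ, c s = 1 ∧ (∀ k, s < k → k ≤ N → c k = 0) ∧
      (∀ p < N, ∀ q < N,
        st.mem 39 [s, p, q] + ∑ k ∈ Finset.range s, st.mem 39 [k, p, q] * c k = 0) ∧
      ∀ j < s, (charProg.exec st).mem 7 [j] = kthRoot c N j := by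
  simp only [charProg, exec_seq, exec_const]
  have h0 := kerInit_spec (n := 6) (by norm_num) st
  have f0 := frame_exec (kerInit 6) st
  rw [hs.r6, ← hN] at h0
  set s0 := (kerInit 6).exec st
  have hs0 := hs.of_frame f0 rfl
  have g0 : s0.reg 4 = s := by rw [f0.reg 4 rfl, hsr]
  have m0 : s0.mem 39 = st.mem 39 := f0.mem 39 rfl
  have h1 := loop_rep (i := 15) (x := 5)
    (p := loop 16 5 (equation 6 (eqAdd 8 ⟨39, [4, 15, 16]⟩ ;;
      loop 17 5 (idxAdd 18 17 9 ;;
        ifIdxLt 17 4 (eqAdd 18 ⟨39, [17, 15, 16]⟩) (idxConst 14 0)))))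
    (fun p w => ∀ q < N, st.mem 39 [s, p, q] * w 0 + ∑ k ∈ Finset.range N,
      (if k < s then st.mem 39 [k, p, q] else 0) * w (k + 1) = 0) h0 (by
      intro p hp s1 f1 r1 S' h1
      have hs1 := hs0.of_frame f1 rfl
      have := loop_rep (i := 16) (x := 5)
        (p := equation 6 (eqAdd 8 ⟨39, [4, 15, 16]⟩ ;;
          loop 17 5 (idxAdd 18 17 9 ;;
            ifIdxLt 17 4 (eqAdd 18 ⟨39, [17, 15, 16]⟩) (idxConst 14 0))))
        (fun q w => st.mem 39 [s, p, q] * w 0 + ∑ k ∈ Finset.range N,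
          (if k < s then st.mem 39 [k, p, q] else 0) * w (k + 1) = 0) h1 (by
        intro q hq s2 f2 r2 S'' h2
        have hs2 := hs1.of_frame f2 rfl
        refine equation_spec h2 (by rw [hs2.r6, hN]) _ (by norm_num) rfl rfl ?_
        intro w s3 f3
        have hs3 := hs2.of_frame f3 rfl
        have e4 : s3.reg 4 = s := by rw [f3.reg 4 rfl, f2.reg 4 rfl, f1.reg 4 rfl, g0]
        have e15 : s3.reg 15 = p := by rw [f3.reg 15 rfl, f2.reg 15 rfl, r1]
        have e16 : s3.reg 16 = q := by rw [f3.reg 16 rfl, r2]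
        have e39 : s3.mem 39 = st.mem 39 := by
          rw [f3.mem 39 rfl, f2.mem 39 rfl, f1.mem 39 rfl, m0]
        have f4 := frame_exec (eqAdd 8 ⟨39, [4, 15, 16]⟩) s3
        have hs4 := hs3.of_frame f4 rfl
        rw [exec_seq, loop_ev
          (fun k => (if k < s then st.mem 39 [k, p, q] else 0) * w (k + 1)), ev_eqAdd]
        · simp only [hs4.r5]
          simp [e4, e15, e16, e39, hs3.r8, hN]
          ring
        · rw [hs3.r8]; omega
        · intro k hk s5 f5 r5
          have hs5 := hs4.of_frame f5 rfl
          rw [hs4.r5, ← hN] at hk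
          have k4 : s5.reg 4 = s := by rw [f5.reg 4 rfl, f4.reg 4 rfl, e4]
          have k15 : s5.reg 15 = p := by rw [f5.reg 15 rfl, f4.reg 15 rfl, e15]
          have k16 : s5.reg 16 = q := by rw [f5.reg 16 rfl, f4.reg 16 rfl, e16]
          have k39 : s5.mem 39 = st.mem 39 := by rw [f5.mem 39 rfl, f4.mem 39 rfl, e39]
          rw [exec_seq, exec_idxAdd, exec_ifIdxLt]
          by_cases hks : k < s
          · rw [if_pos (by simpa [r5, k4] using hks), ev_eqAdd _ (by simp [r5, hs5.r9]; omega)]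
            simp [r5, hs5.r9, k15, k16, k39, hks]
          · rw [if_neg (by simpa [r5, k4] using hks)]
            simp [hks])
      rwa [hs1.r5, ← hN] at this)
  have f1 := frame_exec (loop 15 5 (loop 16 5 (equation 6 (eqAdd 8 ⟨39, [4, 15, 16]⟩ ;;
    loop 17 5 (idxAdd 18 17 9 ;;
      ifIdxLt 17 4 (eqAdd 18 ⟨39, [17, 15, 16]⟩) (idxConst 14 0)))))) s0
  rw [hs0.r5, ← hN] at h1
  set s1 := (loop 15 5 (loop 16 5 (equation 6 (eqAdd 8 ⟨39, [4, 15, 16]⟩ ;;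
    loop 17 5 (idxAdd 18 17 9 ;;
      ifIdxLt 17 4 (eqAdd 18 ⟨39, [17, 15, 16]⟩) (idxConst 14 0)))))).exec s0
  have hs1 := hs0.of_frame f1 rfl
  have g1 : s1.reg 4 = s := by rw [f1.reg 4 rfl, g0]
  have f2 := frame_exec (loop 17 6 (idxAdd 18 17 9 ;;
    ifIdxLt 17 4 (copy ⟨41, [17]⟩ ⟨21, [8, 18]⟩) (const ⟨41, [17]⟩ 0))) s1
  have h2 : ∀ k ≤ N, ((loop 17 6 (idxAdd 18 17 9 ;;
      ifIdxLt 17 4 (copy ⟨41, [17]⟩ ⟨21, [8, 18]⟩) (const ⟨41, [17]⟩ 0))).exec s1).mem 41 [k] =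
      if k < s then V s1 0 (k + 1) else 0 := by
    intro k hk
    obtain ⟨s2, f2, r2, -, e2⟩ := loop_row (d := 41) (m := 0) (k := k) (i := 17) (x := 6)
      (p := idxAdd 18 17 9 ;;
        ifIdxLt 17 4 (copy ⟨41, [17]⟩ ⟨21, [8, 18]⟩) (const ⟨41, [17]⟩ 0)) (st := s1)
      (by rw [hs1.r6, ← hN]; omega) rfl rfl
    have hs2 := hs1.of_frame f2 rfl
    have k4 : s2.reg 4 = s := by rw [f2.reg 4 rfl, g1]
    rw [e2 _ rfl, exec_seq, exec_idxAdd, exec_ifIdxLt]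
    by_cases hks : k < s
    · rw [if_pos (by simpa [r2, k4] using hks), if_pos hks]
      simp [r2, hs2.r8, hs2.r9, f2.mem 21 rfl, V]
    · rw [if_neg (by simpa [r2, k4] using hks), if_neg hks]
      simp [r2]
  set s2 := (loop 17 6 (idxAdd 18 17 9 ;;
    ifIdxLt 17 4 (copy ⟨41, [17]⟩ ⟨21, [8, 18]⟩) (const ⟨41, [17]⟩ 0))).exec s1
  have hs2 := hs1.of_frame f2 rfl
  have g2 : s2.reg 4 = s := by rw [f2.reg 4 rfl, g1]
  set s3 := s2.set ⟨41, [4]⟩ ((1 : ℤ) : ℝ) with hs3'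
  have r3 : s3.reg = s2.reg := rfl
  refine ⟨fun k => s3.mem 41 [k], by simp [hs3', g2], ?_, ?_, ?_⟩
  · intro k hk hkN
    simp [hs3', g2, hk.ne', h2 k hkN, hk.not_gt]
  · obtain ⟨x, hx⟩ := hx
    have hif : ∀ (f : ℕ → ℕ → ℕ → ℝ) (g : ℕ → ℝ) p q, ∑ k ∈ Finset.range N,
        (if k < s then f k p q else 0) * g k = ∑ k ∈ Finset.range s, f k p q * g k := by
      intro f g p q
      rw [← Finset.sum_subset (Finset.range_subset_range.2 hsN)]
      · exact Finset.sum_congr rfl fun k hk => by rw [if_pos (Finset.mem_range.1 hk)]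
      · intro k _ hk
        rw [if_neg (by simpa using hk), zero_mul]
    have h3 : Rep (N + 1) (V s1) fun w => ∀ t : ℕ × ℕ, (t.1 < N ∧ t.2 < N) →
        -(-st.mem 39 [s, t.1, t.2]) * w 0 + ∑ k ∈ Finset.range N,
          (if k < s then st.mem 39 [k, t.1, t.2] else 0) * w (k + 1) = 0 :=
      h1.congr_prop fun w => by
        simp only [true_and, neg_neg, Prod.forall, and_imp]
        exact ⟨fun h p q hp hq => h p hp q hq, fun h p hp q hq => h p q hp hq⟩
    intro p hp q hq
    have h4 := h3.solve ⟨x, fun t ht => by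
      have := hx t.1 ht.1 t.2 ht.2
      rw [hif (fun k p q => st.mem 39 [k, p, q])]
      linarith⟩ (p, q) ⟨hp, hq⟩
    rw [hif (fun k p q => st.mem 39 [k, p, q]) (fun k => V s1 0 (k + 1))] at h4
    have h5 : ∀ k ∈ Finset.range s, st.mem 39 [k, p, q] * s3.mem 41 [k] =
        st.mem 39 [k, p, q] * V s1 0 (k + 1) := by
      intro k hk
      have hk := Finset.mem_range.1 hk
      simp [hs3', g2, hk.ne, h2 k (by omega), hk]
    rw [Finset.sum_congr rfl h5, h4]
    simp
  · intro j hj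
    have e5 : s3.reg 5 = N := by rw [r3, hs2.r5, hN]
    obtain ⟨s4, f4, r4, -, e4⟩ := loop_row (d := 7) (m := 0) (k := j) (i := 17) (x := 5)
      (p := ifIdxLt 17 4 (root ⟨7, [17]⟩ ⟨41, []⟩ 5 17) (idxConst 14 0)) (st := s3)
      (by rw [e5]; omega) rfl rfl
    have k4 : s4.reg 4 = s := by rw [f4.reg 4 rfl, r3, g2]
    have k5 : s4.reg 5 = N := by rw [f4.reg 5 rfl, e5]
    rw [e4 _ rfl, exec_ifIdxLt, if_pos (by rw [r4, k4]; exact hj)]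
    simp [r4, k5, f4.mem 41 rfl]

end Prog
end JLV

namespace JLV

open Prog

namespace Prog

/-- Array `53` `:=` eigenvectors of the matrix in array `38` for the eigenvalues in array `7`,
each of them the sum of the active rows of array `21` (see `Rep.sum_rows`). -/
def eigProg : Prog :=
  loop 18 5 (ifIdxLt 18 4
    (kerInit 5 ;;
     loop 15 5 (equation 5 (loop 16 5 (eqAdd 16 ⟨38, [15, 16]⟩) ;; eqSub 15 ⟨7, [18]⟩)) ;;
     loop 16 5 (dot 15 5 ⟨21, [15, 15]⟩ ⟨21, [15, 16]⟩ ;; copy ⟨53, [18, 16]⟩ ⟨40, []⟩))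
    (idxConst 14 0))

theorem eigProg_spec_of_le {n₁ n₂ n₃ : ℕ} {st : State} (hs : Sizes n₁ n₂ n₃ st) {N s : ℕ}
    (hN : N = n₁ * n₂) (hsr : st.reg 4 = s) {j : ℕ} (hj : s ≤ j) (p : ℕ) :
    (eigProg.exec st).mem 53 [j, p] = st.mem 53 [j, p] := by
  rw [eigProg]
  by_cases hjN : j < N
  · obtain ⟨s1, f1, r1, g1, e1⟩ := loop_row (d := 53) (m := 0) (k := j) (i := 18) (x := 5)
      (p := ifIdxLt 18 4
        (kerInit 5 ;;
         loop 15 5 (equation 5 (loop 16 5 (eqAdd 16 ⟨38, [15, 16]⟩) ;; eqSub 15 ⟨7, [18]⟩)) ;;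
         loop 16 5 (dot 15 5 ⟨21, [15, 15]⟩ ⟨21, [15, 16]⟩ ;; copy ⟨53, [18, 16]⟩ ⟨40, []⟩))
        (idxConst 14 0)) (by rwa [hs.r5, ← hN]) rfl rfl
    have k4 : s1.reg 4 = s := by rw [f1.reg 4 rfl, hsr]
    rw [e1 _ rfl, exec_ifIdxLt, if_neg (by rw [r1, k4]; omega)]
    exact g1 _ rfl
  · exact loop_row_of_le (m := 0) (by rw [hs.r5, ← hN]; intro k hk; simp; omega) rfl rfl

theorem eigProg_spec {n₁ n₂ n₃ : ℕ} {st : State} (hs : Sizes n₁ n₂ n₃ st) {N s : ℕ}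
    (hN : N = n₁ * n₂) (hsr : st.reg 4 = s) (hsN : s ≤ N) {j : ℕ} (hj : j < s)
    (hw : ∃ w : ℕ → ℝ, (∀ p < N, ∑ q ∈ Finset.range N, st.mem 38 [p, q] * w q =
      st.mem 7 [j] * w p) ∧ ∃ k < N, w k ≠ 0) :
    (∀ p < N, ∑ q ∈ Finset.range N, st.mem 38 [p, q] * (eigProg.exec st).mem 53 [j, q] =
      st.mem 7 [j] * (eigProg.exec st).mem 53 [j, p]) ∧
      ∃ k < N, (eigProg.exec st).mem 53 [j, k] ≠ 0 := by
  rw [eigProg]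
  obtain ⟨s1, f1, r1, -, e1⟩ := loop_row (d := 53) (m := 0) (k := j) (i := 18) (x := 5)
    (p := ifIdxLt 18 4
      (kerInit 5 ;;
       loop 15 5 (equation 5 (loop 16 5 (eqAdd 16 ⟨38, [15, 16]⟩) ;; eqSub 15 ⟨7, [18]⟩)) ;;
       loop 16 5 (dot 15 5 ⟨21, [15, 15]⟩ ⟨21, [15, 16]⟩ ;; copy ⟨53, [18, 16]⟩ ⟨40, []⟩))
      (idxConst 14 0)) (st := st) (by rw [hs.r5, ← hN]; omega) rfl rfl
  have hs1 := hs.of_frame f1 rfl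
  have k4 : s1.reg 4 = s := by rw [f1.reg 4 rfl, hsr]
  have m38 : s1.mem 38 = st.mem 38 := f1.mem 38 rfl
  have m7 : s1.mem 7 = st.mem 7 := f1.mem 7 rfl
  rw [exec_ifIdxLt, if_pos (by rw [r1, k4]; exact hj), exec_seq, exec_seq] at e1
  have h2 := kerInit_spec (n := 5) (by norm_num) s1
  have f2 := frame_exec (kerInit 5) s1
  rw [hs1.r5, ← hN] at h2
  set s2 := (kerInit 5).exec s1
  have hs2 := hs1.of_frame f2 rfl
  have h3 := loop_rep (i := 15) (x := 5)
    (p := equation 5 (loop 16 5 (eqAdd 16 ⟨38, [15, 16]⟩) ;; eqSub 15 ⟨7, [18]⟩))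
    (fun p w => ∑ q ∈ Finset.range N, st.mem 38 [p, q] * w q + -st.mem 7 [j] * w p = 0) h2 (by
      intro p hp s3 f3 r3 S' h3
      have hs3 := hs2.of_frame f3 rfl
      rw [hs2.r5, ← hN] at hp
      refine equation_spec h3 (by rw [hs3.r5, hN]) _ (by norm_num) rfl rfl ?_
      intro w s4 f4
      have hs4 := hs3.of_frame f4 rfl
      have e18 : s4.reg 18 = j := by rw [f4.reg 18 rfl, f3.reg 18 rfl, f2.reg 18 rfl, r1]
      have e15 : s4.reg 15 = p := by rw [f4.reg 15 rfl, r3]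
      have e38 : s4.mem 38 = st.mem 38 := by
        rw [f4.mem 38 rfl, f3.mem 38 rfl, f2.mem 38 rfl, m38]
      have e7 : s4.mem 7 = st.mem 7 := by
        rw [f4.mem 7 rfl, f3.mem 7 rfl, f2.mem 7 rfl, m7]
      have f5 := frame_exec (loop 16 5 (eqAdd 16 ⟨38, [15, 16]⟩)) s4
      have g15 := f5.reg 15 rfl
      have g18 := f5.reg 18 rfl
      rw [exec_seq, ev_eqSub _ (by rw [g15, e15]; exact hp),
        loop_ev (fun q => st.mem 38 [p, q] * w q)]
      · simp [g15, g18, e15, e18, f5.mem 7 rfl, e7, hs4.r5, hN, add_assoc]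
      · intro q hq s6 f6 r6
        rw [hs4.r5, ← hN] at hq
        rw [ev_eqAdd _ (by rwa [r6])]
        simp [r6, f6.reg 15 rfl, e15, f6.mem 38 rfl, e38])
  have f3 := frame_exec (loop 15 5
    (equation 5 (loop 16 5 (eqAdd 16 ⟨38, [15, 16]⟩) ;; eqSub 15 ⟨7, [18]⟩))) s2
  rw [hs2.r5, ← hN] at h3
  set s3 := (loop 15 5
    (equation 5 (loop 16 5 (eqAdd 16 ⟨38, [15, 16]⟩) ;; eqSub 15 ⟨7, [18]⟩))).exec s2
  have hs3 := hs2.of_frame f3 rfl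
  have hout : ∀ q < N, ((loop 18 5 (ifIdxLt 18 4
      (kerInit 5 ;;
       loop 15 5 (equation 5 (loop 16 5 (eqAdd 16 ⟨38, [15, 16]⟩) ;; eqSub 15 ⟨7, [18]⟩)) ;;
       loop 16 5 (dot 15 5 ⟨21, [15, 15]⟩ ⟨21, [15, 16]⟩ ;; copy ⟨53, [18, 16]⟩ ⟨40, []⟩))
      (idxConst 14 0))).exec st).mem 53 [j, q] =
      ∑ i ∈ Finset.range N, V s3 i i * V s3 i q := by
    intro q hq
    rw [e1 _ rfl]
    obtain ⟨s4, f4, r4, -, e4⟩ := loop_row (d := 53) (m := 1) (k := q) (i := 16) (x := 5)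
      (p := dot 15 5 ⟨21, [15, 15]⟩ ⟨21, [15, 16]⟩ ;; copy ⟨53, [18, 16]⟩ ⟨40, []⟩) (st := s3)
      (by rw [hs3.r5, ← hN]; exact hq) rfl rfl
    have hs4 := hs3.of_frame f4 rfl
    have e18 : s4.reg 18 = j := by
      rw [f4.reg 18 rfl, f3.reg 18 rfl, f2.reg 18 rfl, r1]
    rw [e4 _ rfl]
    simp [exec_dot_acc, exec_dot_reg, e18, r4, hs4.r5, hN, f4.mem 21 rfl, V]
  obtain ⟨w, hw1, hw2⟩ := hw
  have hsum := h3.sum_rows (w := w)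
    ⟨trivial, fun p hp => by rw [hw1 p hp]; ring⟩ hw2
  refine ⟨fun p hp => ?_, ?_⟩
  · have := hsum.1.2 p hp
    rw [hout p hp, Finset.sum_congr rfl fun q hq => by rw [hout q (Finset.mem_range.1 hq)]]
    linarith
  · obtain ⟨k, hk, hk0⟩ := hsum.2
    exact ⟨k, hk, by rwa [hout k hk]⟩

/-- Array `10` `:=` the coefficients of the `Pᵢ` with respect to the `xⱼ ⊗ xⱼ`. -/
def zProg : Prog :=
  loop 18 5 (kerInit 6 ;;
    loop 15 5 (loop 16 5 (flat 30 15 16 5 ;; equation 6 (eqSub 8 ⟨50, [18, 30]⟩ ;;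
      loop 17 5 (idxAdd 31 17 9 ;; arith .mul ⟨42, []⟩ ⟨53, [17, 15]⟩ ⟨53, [17, 16]⟩ ;;
        eqAdd 31 ⟨42, []⟩)))) ;;
    loop 17 5 (idxAdd 31 17 9 ;; copy ⟨10, [17, 18]⟩ ⟨21, [8, 31]⟩))

theorem zProg_spec {n₁ n₂ n₃ : ℕ} {st : State} (hs : Sizes n₁ n₂ n₃ st) {N : ℕ}
    (hN : N = n₁ * n₂) {i : ℕ} (hi : i < N)
    (hx : ∃ x : ℕ → ℝ, ∀ p < N, ∀ q < N, ∑ j ∈ Finset.range N,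
      st.mem 53 [j, p] * st.mem 53 [j, q] * x j = st.mem 50 [i, p * N + q]) :
    ∀ p < N, ∀ q < N, ∑ j ∈ Finset.range N, st.mem 53 [j, p] * st.mem 53 [j, q] *
      (zProg.exec st).mem 10 [j, i] = st.mem 50 [i, p * N + q] := by
  rw [zProg]
  obtain ⟨s1, f1, r1, -, e1⟩ := loop_row (d := 10) (m := 1) (k := i) (i := 18) (x := 5)
    (p := kerInit 6 ;;
      loop 15 5 (loop 16 5 (flat 30 15 16 5 ;; equation 6 (eqSub 8 ⟨50, [18, 30]⟩ ;;
        loop 17 5 (idxAdd 31 17 9 ;; arith .mul ⟨42, []⟩ ⟨53, [17, 15]⟩ ⟨53, [17, 16]⟩ ;;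
          eqAdd 31 ⟨42, []⟩)))) ;;
      loop 17 5 (idxAdd 31 17 9 ;; copy ⟨10, [17, 18]⟩ ⟨21, [8, 31]⟩)) (st := st)
    (by rw [hs.r5, ← hN]; exact hi) rfl rfl
  have hs1 := hs.of_frame f1 rfl
  have m50 : s1.mem 50 = st.mem 50 := f1.mem 50 rfl
  have m53 : s1.mem 53 = st.mem 53 := f1.mem 53 rfl
  rw [exec_seq, exec_seq] at e1
  have h2 := kerInit_spec (n := 6) (by norm_num) s1
  have f2 := frame_exec (kerInit 6) s1
  rw [hs1.r6, ← hN] at h2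
  set s2 := (kerInit 6).exec s1
  have hs2 := hs1.of_frame f2 rfl
  have h3 := loop_rep (i := 15) (x := 5)
    (p := loop 16 5 (flat 30 15 16 5 ;; equation 6 (eqSub 8 ⟨50, [18, 30]⟩ ;;
        loop 17 5 (idxAdd 31 17 9 ;; arith .mul ⟨42, []⟩ ⟨53, [17, 15]⟩ ⟨53, [17, 16]⟩ ;;
          eqAdd 31 ⟨42, []⟩))))
    (fun p w => ∀ q < N, -st.mem 50 [i, p * N + q] * w 0 +
      ∑ j ∈ Finset.range N, st.mem 53 [j, p] * st.mem 53 [j, q] * w (j + 1) = 0) h2 (by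
      intro p hp s3 f3 r3 S' h3
      have hs3 := hs2.of_frame f3 rfl
      have := loop_rep (i := 16) (x := 5)
        (p := flat 30 15 16 5 ;; equation 6 (eqSub 8 ⟨50, [18, 30]⟩ ;;
          loop 17 5 (idxAdd 31 17 9 ;; arith .mul ⟨42, []⟩ ⟨53, [17, 15]⟩ ⟨53, [17, 16]⟩ ;;
            eqAdd 31 ⟨42, []⟩)))
        (fun q w => -st.mem 50 [i, p * N + q] * w 0 +
          ∑ j ∈ Finset.range N, st.mem 53 [j, p] * st.mem 53 [j, q] * w (j + 1) = 0) h3 (by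
        intro q hq s4 f4 r4 S'' h4
        have hs4 := hs3.of_frame f4 rfl
        have fl := frame_exec (flat 30 15 16 5) s4
        have e15 : s4.reg 15 = p := by rw [f4.reg 15 rfl, r3]
        have l30 : ((flat 30 15 16 5).exec s4).reg 30 = p * N + q := by
          rw [exec_flat_reg_self] <;> simp [e15, r4, hs4.r5, hN]
        rw [exec_seq]
        have hV : V ((flat 30 15 16 5).exec s4) = V s4 := by funext i j; simp [V]
        rw [← hV] at h4
        set s5 := (flat 30 15 16 5).exec s4
        have hs5 := hs4.of_frame fl rfl
        refine equation_spec h4 (by rw [hs5.r6, hN]) _ (by norm_num) rfl rfl ?_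
        intro w s6 f6
        have hs6 := hs5.of_frame f6 rfl
        have g30 : s6.reg 30 = p * N + q := by rw [f6.reg 30 rfl, l30]
        have g18 : s6.reg 18 = i := by
          rw [f6.reg 18 rfl, fl.reg 18 rfl, f4.reg 18 rfl, f3.reg 18 rfl, f2.reg 18 rfl, r1]
        have g15 : s6.reg 15 = p := by rw [f6.reg 15 rfl, fl.reg 15 rfl, e15]
        have g16 : s6.reg 16 = q := by rw [f6.reg 16 rfl, fl.reg 16 rfl, r4]
        have g50 : s6.mem 50 = st.mem 50 := by
          rw [f6.mem 50 rfl, fl.mem 50 rfl, f4.mem 50 rfl, f3.mem 50 rfl, f2.mem 50 rfl, m50]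
        have g53 : s6.mem 53 = st.mem 53 := by
          rw [f6.mem 53 rfl, fl.mem 53 rfl, f4.mem 53 rfl, f3.mem 53 rfl, f2.mem 53 rfl, m53]
        have f7 := frame_exec (eqSub 8 ⟨50, [18, 30]⟩) s6
        have hs7 := hs6.of_frame f7 rfl
        rw [exec_seq, loop_ev (fun j => st.mem 53 [j, p] * st.mem 53 [j, q] * w (j + 1)),
          ev_eqSub _ (by rw [hs6.r8]; omega)]
        · simp only [hs7.r5]
          simp [g30, g18, g50, hs6.r8, hN, add_assoc]
        · intro j hj s8 f8 r8
          have hs8 := hs7.of_frame f8 rfl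
          rw [hs7.r5, ← hN] at hj
          have k15 : s8.reg 15 = p := by rw [f8.reg 15 rfl, f7.reg 15 rfl, g15]
          have k16 : s8.reg 16 = q := by rw [f8.reg 16 rfl, f7.reg 16 rfl, g16]
          have k53 : s8.mem 53 = st.mem 53 := by rw [f8.mem 53 rfl, f7.mem 53 rfl, g53]
          rw [exec_seq, exec_seq, ev_eqAdd _ (by simp [r8, hs8.r9]; omega),
            ev_congr (st := s8) (by
              rw [exec_arith, State.set_mem_of_ne _ _ _ (by decide)]; rfl)]
          simp [ArithOp.eval, r8, hs8.r9, k15, k16, k53])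
      rwa [hs3.r5, ← hN] at this)
  have f3 := frame_exec (loop 15 5 (loop 16 5 (flat 30 15 16 5 ;;
    equation 6 (eqSub 8 ⟨50, [18, 30]⟩ ;;
        loop 17 5 (idxAdd 31 17 9 ;; arith .mul ⟨42, []⟩ ⟨53, [17, 15]⟩ ⟨53, [17, 16]⟩ ;;
          eqAdd 31 ⟨42, []⟩))))) s2
  rw [hs2.r5, ← hN] at h3
  set s3 := (loop 15 5 (loop 16 5 (flat 30 15 16 5 ;; equation 6 (eqSub 8 ⟨50, [18, 30]⟩ ;;
        loop 17 5 (idxAdd 31 17 9 ;; arith .mul ⟨42, []⟩ ⟨53, [17, 15]⟩ ⟨53, [17, 16]⟩ ;;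
          eqAdd 31 ⟨42, []⟩))))).exec s2
  have hs3 := hs2.of_frame f3 rfl
  obtain ⟨x, hx⟩ := hx
  have h4 : Rep (N + 1) (V s3) fun w => ∀ t : ℕ × ℕ, (t.1 < N ∧ t.2 < N) →
      -st.mem 50 [i, t.1 * N + t.2] * w 0 + ∑ j ∈ Finset.range N,
        st.mem 53 [j, t.1] * st.mem 53 [j, t.2] * w (j + 1) = 0 :=
    h3.congr_prop fun w => by
      simp only [true_and, Prod.forall, and_imp]
      exact ⟨fun h p q hp hq => h p hp q hq, fun h p hp q hq => h p q hp hq⟩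
  intro p hp q hq
  rw [← h4.solve ⟨x, fun t ht => hx t.1 ht.1 t.2 ht.2⟩ (p, q) ⟨hp, hq⟩]
  refine Finset.sum_congr rfl fun j hj => ?_
  rw [e1 _ rfl]
  obtain ⟨s4, f4, r4, -, e4⟩ := loop_row (d := 10) (m := 0) (k := j) (i := 17) (x := 5)
    (p := idxAdd 31 17 9 ;; copy ⟨10, [17, 18]⟩ ⟨21, [8, 31]⟩) (st := s3)
    (by rw [hs3.r5, ← hN]; exact Finset.mem_range.1 hj) rfl rfl
  have hs4 := hs3.of_frame f4 rfl
  have e18 : s4.reg 18 = i := by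
    rw [f4.reg 18 rfl, f3.reg 18 rfl, f2.reg 18 rfl, r1]
  rw [e4 _ rfl]
  simp [e18, r4, hs4.r8, hs4.r9, f4.mem 21 rfl, V]

/-- Arrays `11`, `12` `:=` the factors of the rank-1 matrices in array `53`: the first column, and
the first row divided by its first entry. -/
def factorProg : Prog :=
  loop 15 5 (ifIdxLt 15 4
    (loop 16 0 (flat 30 16 8 1 ;; copy ⟨11, [15, 16]⟩ ⟨53, [15, 30]⟩) ;;
     loop 16 1 (arith .div ⟨12, [15, 16]⟩ ⟨53, [15, 16]⟩ ⟨53, [15, 8]⟩))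
    (idxConst 14 0))

theorem factorProg_spec {n₁ n₂ n₃ : ℕ} {st : State} (hs : Sizes n₁ n₂ n₃ st) {N s : ℕ}
    (hN : N = n₁ * n₂) (hsr : st.reg 4 = s) (hsN : s ≤ N) {l : ℕ} (hl : l < s) :
    (∀ i < n₁, (factorProg.exec st).mem 11 [l, i] = st.mem 53 [l, i * n₂]) ∧
      ∀ j < n₂, (factorProg.exec st).mem 12 [l, j] = st.mem 53 [l, j] / st.mem 53 [l, 0] := by
  rw [factorProg]
  constructor
  · intro i hi
    obtain ⟨s1, f1, r1, -, e1⟩ := loop_row (d := 11) (m := 0) (k := l) (i := 15) (x := 5)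
      (p := ifIdxLt 15 4
        (loop 16 0 (flat 30 16 8 1 ;; copy ⟨11, [15, 16]⟩ ⟨53, [15, 30]⟩) ;;
         loop 16 1 (arith .div ⟨12, [15, 16]⟩ ⟨53, [15, 16]⟩ ⟨53, [15, 8]⟩))
        (idxConst 14 0)) (st := st) (by rw [hs.r5, ← hN]; omega) rfl rfl
    have hs1 := hs.of_frame f1 rfl
    have k4 : s1.reg 4 = s := by rw [f1.reg 4 rfl, hsr]
    rw [e1 _ rfl, exec_ifIdxLt, if_pos (by rw [r1, k4]; exact hl), exec_seq,
      (frame_exec (loop 16 1 (arith .div ⟨12, [15, 16]⟩ ⟨53, [15, 16]⟩ ⟨53, [15, 8]⟩)) _).mem 11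
        rfl]
    obtain ⟨s2, f2, r2, -, e2⟩ := loop_row (d := 11) (m := 1) (k := i) (i := 16) (x := 0)
      (p := flat 30 16 8 1 ;; copy ⟨11, [15, 16]⟩ ⟨53, [15, 30]⟩) (st := s1)
      (by rwa [hs1.r0]) rfl rfl
    have hs2 := hs1.of_frame f2 rfl
    rw [e2 _ rfl]
    simp [exec_flat_reg, r2, f2.reg 15 rfl, r1, hs2.r1, hs2.r8, f2.mem 53 rfl, f1.mem 53 rfl]
  · intro j hj
    obtain ⟨s1, f1, r1, -, e1⟩ := loop_row (d := 12) (m := 0) (k := l) (i := 15) (x := 5)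
      (p := ifIdxLt 15 4
        (loop 16 0 (flat 30 16 8 1 ;; copy ⟨11, [15, 16]⟩ ⟨53, [15, 30]⟩) ;;
         loop 16 1 (arith .div ⟨12, [15, 16]⟩ ⟨53, [15, 16]⟩ ⟨53, [15, 8]⟩))
        (idxConst 14 0)) (st := st) (by rw [hs.r5, ← hN]; omega) rfl rfl
    have hs1 := hs.of_frame f1 rfl
    have k4 : s1.reg 4 = s := by rw [f1.reg 4 rfl, hsr]
    rw [e1 _ rfl, exec_ifIdxLt, if_pos (by rw [r1, k4]; exact hl), exec_seq]
    have f2 := frame_exec (loop 16 0 (flat 30 16 8 1 ;; copy ⟨11, [15, 16]⟩ ⟨53, [15, 30]⟩)) s1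
    set s2 := (loop 16 0 (flat 30 16 8 1 ;; copy ⟨11, [15, 16]⟩ ⟨53, [15, 30]⟩)).exec s1
    have hs2 := hs1.of_frame f2 rfl
    obtain ⟨s3, f3, r3, -, e3⟩ := loop_row (d := 12) (m := 1) (k := j) (i := 16) (x := 1)
      (p := arith .div ⟨12, [15, 16]⟩ ⟨53, [15, 16]⟩ ⟨53, [15, 8]⟩) (st := s2)
      (by rwa [hs2.r1]) rfl rfl
    have hs3 := hs2.of_frame f3 rfl
    rw [e3 _ rfl]
    simp [ArithOp.eval, r3, f3.reg 15 rfl, f2.reg 15 rfl, r1, hs3.r8, f3.mem 53 rfl,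
      f2.mem 53 rfl, f1.mem 53 rfl]

/-- Array `13` `:=` the third factors. The rows of array `53` from `s` on are zero and do not affect
the system. -/
def thirdProg : Prog :=
  loop 18 2 (kerInit 6 ;;
    loop 15 0 (loop 16 1 (flat 30 15 16 1 ;; equation 6 (eqSub 8 ⟨0, [15, 16, 18]⟩ ;;
      loop 17 5 (idxAdd 31 17 9 ;; eqAdd 31 ⟨53, [17, 30]⟩)))) ;;
    loop 17 5 (idxAdd 31 17 9 ;; copy ⟨13, [17, 18]⟩ ⟨21, [8, 31]⟩))

theorem thirdProg_spec {n₁ n₂ n₃ : ℕ} {st : State} (hs : Sizes n₁ n₂ n₃ st) {N : ℕ}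
    (hN : N = n₁ * n₂) {k : ℕ} (hk : k < n₃)
    (hx : ∃ x : ℕ → ℝ, ∀ i < n₁, ∀ j < n₂, ∑ l ∈ Finset.range N,
      st.mem 53 [l, i * n₂ + j] * x l = st.mem 0 [i, j, k]) :
    ∀ i < n₁, ∀ j < n₂, ∑ l ∈ Finset.range N,
      st.mem 53 [l, i * n₂ + j] * (thirdProg.exec st).mem 13 [l, k] = st.mem 0 [i, j, k] := by
  rw [thirdProg]
  obtain ⟨s1, f1, r1, -, e1⟩ := loop_row (d := 13) (m := 1) (k := k) (i := 18) (x := 2)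
    (p := kerInit 6 ;;
      loop 15 0 (loop 16 1 (flat 30 15 16 1 ;; equation 6 (eqSub 8 ⟨0, [15, 16, 18]⟩ ;;
        loop 17 5 (idxAdd 31 17 9 ;; eqAdd 31 ⟨53, [17, 30]⟩)))) ;;
      loop 17 5 (idxAdd 31 17 9 ;; copy ⟨13, [17, 18]⟩ ⟨21, [8, 31]⟩)) (st := st)
    (by rw [hs.r2]; exact hk) rfl rfl
  have hs1 := hs.of_frame f1 rfl
  have m0 : s1.mem 0 = st.mem 0 := f1.mem 0 rfl
  have m53 : s1.mem 53 = st.mem 53 := f1.mem 53 rfl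
  rw [exec_seq, exec_seq] at e1
  have h2 := kerInit_spec (n := 6) (by norm_num) s1
  have f2 := frame_exec (kerInit 6) s1
  rw [hs1.r6, ← hN] at h2
  set s2 := (kerInit 6).exec s1
  have hs2 := hs1.of_frame f2 rfl
  have h3 := loop_rep (i := 15) (x := 0)
    (p := loop 16 1 (flat 30 15 16 1 ;; equation 6 (eqSub 8 ⟨0, [15, 16, 18]⟩ ;;
        loop 17 5 (idxAdd 31 17 9 ;; eqAdd 31 ⟨53, [17, 30]⟩))))
    (fun i w => ∀ j < n₂, -st.mem 0 [i, j, k] * w 0 +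
      ∑ l ∈ Finset.range N, st.mem 53 [l, i * n₂ + j] * w (l + 1) = 0) h2 (by
      intro i hi s3 f3 r3 S' h3
      have hs3 := hs2.of_frame f3 rfl
      have := loop_rep (i := 16) (x := 1)
        (p := flat 30 15 16 1 ;; equation 6 (eqSub 8 ⟨0, [15, 16, 18]⟩ ;;
          loop 17 5 (idxAdd 31 17 9 ;; eqAdd 31 ⟨53, [17, 30]⟩)))
        (fun j w => -st.mem 0 [i, j, k] * w 0 +
          ∑ l ∈ Finset.range N, st.mem 53 [l, i * n₂ + j] * w (l + 1) = 0) h3 (by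
        intro j hj s4 f4 r4 S'' h4
        have hs4 := hs3.of_frame f4 rfl
        have fl := frame_exec (flat 30 15 16 1) s4
        have e15 : s4.reg 15 = i := by rw [f4.reg 15 rfl, r3]
        have l30 : ((flat 30 15 16 1).exec s4).reg 30 = i * n₂ + j := by
          rw [exec_flat_reg_self] <;> simp [e15, r4, hs4.r1]
        rw [exec_seq]
        have hV : V ((flat 30 15 16 1).exec s4) = V s4 := by funext i j; simp [V]
        rw [← hV] at h4
        set s5 := (flat 30 15 16 1).exec s4
        have hs5 := hs4.of_frame fl rfl
        refine equation_spec h4 (by rw [hs5.r6, hN]) _ (by norm_num) rfl rfl ?_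
        intro w s6 f6
        have hs6 := hs5.of_frame f6 rfl
        have g30 : s6.reg 30 = i * n₂ + j := by rw [f6.reg 30 rfl, l30]
        have g18 : s6.reg 18 = k := by
          rw [f6.reg 18 rfl, fl.reg 18 rfl, f4.reg 18 rfl, f3.reg 18 rfl, f2.reg 18 rfl, r1]
        have g15 : s6.reg 15 = i := by rw [f6.reg 15 rfl, fl.reg 15 rfl, e15]
        have g16 : s6.reg 16 = j := by rw [f6.reg 16 rfl, fl.reg 16 rfl, r4]
        have g0 : s6.mem 0 = st.mem 0 := by
          rw [f6.mem 0 rfl, fl.mem 0 rfl, f4.mem 0 rfl, f3.mem 0 rfl, f2.mem 0 rfl, m0]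
        have g53 : s6.mem 53 = st.mem 53 := by
          rw [f6.mem 53 rfl, fl.mem 53 rfl, f4.mem 53 rfl, f3.mem 53 rfl, f2.mem 53 rfl, m53]
        have f7 := frame_exec (eqSub 8 ⟨0, [15, 16, 18]⟩) s6
        have hs7 := hs6.of_frame f7 rfl
        rw [exec_seq, loop_ev (fun l => st.mem 53 [l, i * n₂ + j] * w (l + 1)),
          ev_eqSub _ (by rw [hs6.r8]; omega)]
        · simp only [hs7.r5]
          simp [g15, g16, g18, g0, hs6.r8, hN, add_assoc]
        · intro l hl s8 f8 r8
          have hs8 := hs7.of_frame f8 rfl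
          rw [hs7.r5, ← hN] at hl
          have k30 : s8.reg 30 = i * n₂ + j := by rw [f8.reg 30 rfl, f7.reg 30 rfl, g30]
          have k53 : s8.mem 53 = st.mem 53 := by rw [f8.mem 53 rfl, f7.mem 53 rfl, g53]
          rw [exec_seq, ev_eqAdd _ (by simp [r8, hs8.r9]; omega), exec_idxAdd, ev_setReg]
          simp [r8, hs8.r9, k30, k53])
      rwa [hs3.r1] at this)
  have f3 := frame_exec (loop 15 0 (loop 16 1 (flat 30 15 16 1 ;;
    equation 6 (eqSub 8 ⟨0, [15, 16, 18]⟩ ;;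
      loop 17 5 (idxAdd 31 17 9 ;; eqAdd 31 ⟨53, [17, 30]⟩))))) s2
  rw [hs2.r0] at h3
  set s3 := (loop 15 0 (loop 16 1 (flat 30 15 16 1 ;; equation 6 (eqSub 8 ⟨0, [15, 16, 18]⟩ ;;
      loop 17 5 (idxAdd 31 17 9 ;; eqAdd 31 ⟨53, [17, 30]⟩))))).exec s2
  have hs3 := hs2.of_frame f3 rfl
  obtain ⟨x, hx⟩ := hx
  have h4 : Rep (N + 1) (V s3) fun w => ∀ t : ℕ × ℕ, (t.1 < n₁ ∧ t.2 < n₂) →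
      -st.mem 0 [t.1, t.2, k] * w 0 + ∑ l ∈ Finset.range N,
        st.mem 53 [l, t.1 * n₂ + t.2] * w (l + 1) = 0 :=
    h3.congr_prop fun w => by
      simp only [true_and, Prod.forall, and_imp]
      exact ⟨fun h p q hp hq => h p hp q hq, fun h p hp q hq => h p q hp hq⟩
  intro i hi j hj
  rw [← h4.solve ⟨x, fun t ht => hx t.1 ht.1 t.2 ht.2⟩ (i, j) ⟨hi, hj⟩]
  refine Finset.sum_congr rfl fun l hl => ?_
  rw [e1 _ rfl]
  obtain ⟨s4, f4, r4, -, e4⟩ := loop_row (d := 13) (m := 0) (k := l) (i := 17) (x := 5)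
    (p := idxAdd 31 17 9 ;; copy ⟨13, [17, 18]⟩ ⟨21, [8, 31]⟩) (st := s3)
    (by rw [hs3.r5, ← hN]; exact Finset.mem_range.1 hl) rfl rfl
  have hs4 := hs3.of_frame f4 rfl
  have e18 : s4.reg 18 = k := by
    rw [f4.reg 18 rfl, f3.reg 18 rfl, f2.reg 18 rfl, r1]
  rw [e4 _ rfl]
  simp [e18, r4, hs4.r8, hs4.r9, f4.mem 21 rfl, V]

/-- Array `2` `:=` the matrices in array `50`, with all indices separated. -/
def outP : Prog :=
  loop 14 5 (loop 15 0 (loop 16 1 (loop 17 0 (loop 18 1 (flat 32 15 16 1 ;; flat 33 17 18 1 ;;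
    flat 30 32 33 5 ;; copy ⟨2, [14, 15, 16, 17, 18]⟩ ⟨50, [14, 30]⟩)))))

theorem outP_spec {n₁ n₂ n₃ : ℕ} {st : State} (hs : Sizes n₁ n₂ n₃ st) {N : ℕ}
    (hN : N = n₁ * n₂) {l a b c d : ℕ} (hl : l < N) (ha : a < n₁) (hb : b < n₂) (hc : c < n₁)
    (hd : d < n₂) : (outP.exec st).mem 2 [l, a, b, c, d] =
      st.mem 50 [l, (a * n₂ + b) * N + (c * n₂ + d)] := by
  rw [outP]
  obtain ⟨s1, f1, r1, -, e1⟩ := loop_row (d := 2) (m := 0) (k := l) (i := 14) (x := 5)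
    (p := loop 15 0 (loop 16 1 (loop 17 0 (loop 18 1 (flat 32 15 16 1 ;; flat 33 17 18 1 ;;
    flat 30 32 33 5 ;; copy ⟨2, [14, 15, 16, 17, 18]⟩ ⟨50, [14, 30]⟩))))) (st := st)
    (by rw [hs.r5, ← hN]; exact hl) rfl rfl
  have hs1 := hs.of_frame f1 rfl
  obtain ⟨s2, f2, r2, -, e2⟩ := loop_row (d := 2) (m := 1) (k := a) (i := 15) (x := 0)
    (p := loop 16 1 (loop 17 0 (loop 18 1 (flat 32 15 16 1 ;; flat 33 17 18 1 ;;
    flat 30 32 33 5 ;; copy ⟨2, [14, 15, 16, 17, 18]⟩ ⟨50, [14, 30]⟩)))) (st := s1)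
    (by rwa [hs1.r0]) rfl rfl
  have hs2 := hs1.of_frame f2 rfl
  obtain ⟨s3, f3, r3, -, e3⟩ := loop_row (d := 2) (m := 2) (k := b) (i := 16) (x := 1)
    (p := loop 17 0 (loop 18 1 (flat 32 15 16 1 ;; flat 33 17 18 1 ;;
    flat 30 32 33 5 ;; copy ⟨2, [14, 15, 16, 17, 18]⟩ ⟨50, [14, 30]⟩))) (st := s2)
    (by rwa [hs2.r1]) rfl rfl
  have hs3 := hs2.of_frame f3 rfl
  obtain ⟨s4, f4, r4, -, e4⟩ := loop_row (d := 2) (m := 3) (k := c) (i := 17) (x := 0)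
    (p := loop 18 1 (flat 32 15 16 1 ;; flat 33 17 18 1 ;;
    flat 30 32 33 5 ;; copy ⟨2, [14, 15, 16, 17, 18]⟩ ⟨50, [14, 30]⟩)) (st := s3)
    (by rwa [hs3.r0]) rfl rfl
  have hs4 := hs3.of_frame f4 rfl
  obtain ⟨s5, f5, r5, -, e5⟩ := loop_row (d := 2) (m := 4) (k := d) (i := 18) (x := 1)
    (p := flat 32 15 16 1 ;; flat 33 17 18 1 ;;
    flat 30 32 33 5 ;; copy ⟨2, [14, 15, 16, 17, 18]⟩ ⟨50, [14, 30]⟩) (st := s4)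
    (by rwa [hs4.r1]) rfl rfl
  have hs5 := hs4.of_frame f5 rfl
  rw [e1 _ rfl, e2 _ rfl, e3 _ rfl, e4 _ rfl, e5 _ rfl]
  have k14 : s5.reg 14 = l := by
    rw [f5.reg 14 rfl, f4.reg 14 rfl, f3.reg 14 rfl, f2.reg 14 rfl, r1]
  have k15 : s5.reg 15 = a := by rw [f5.reg 15 rfl, f4.reg 15 rfl, f3.reg 15 rfl, r2]
  have k16 : s5.reg 16 = b := by rw [f5.reg 16 rfl, f4.reg 16 rfl, r3]
  have k17 : s5.reg 17 = c := by rw [f5.reg 17 rfl, r4]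
  have k50 : s5.mem 50 = st.mem 50 := by
    rw [f5.mem 50 rfl, f4.mem 50 rfl, f3.mem 50 rfl, f2.mem 50 rfl, f1.mem 50 rfl]
  simp [exec_flat_reg, k14, k15, k16, k17, r5, hs5.r1, hs5.r5, hN, k50]

/-- Array `d` `:=` the matrix in array `s`, with all indices separated. -/
def outMat (s d : ℕ) : Prog :=
  loop 15 0 (loop 16 1 (loop 17 0 (loop 18 1 (flat 32 15 16 1 ;; flat 33 17 18 1 ;;
    copy ⟨d, [15, 16, 17, 18]⟩ ⟨s, [32, 33]⟩))))

theorem outMat_spec {n₁ n₂ n₃ : ℕ} {st : State} (hs : Sizes n₁ n₂ n₃ st) {s d : ℕ} (hds : d ≠ s)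
    {i j k l : ℕ} (hi : i < n₁) (hj : j < n₂) (hk : k < n₁) (hl : l < n₂) :
    ((outMat s d).exec st).mem d [i, j, k, l] = st.mem s [i * n₂ + j, k * n₂ + l] := by
  rw [outMat]
  have hw : ∀ m i, [15, 16, 17, 18][m]? = some i → writesAt d m i (flat 32 15 16 1 ;;
      flat 33 17 18 1 ;; copy ⟨d, [15, 16, 17, 18]⟩ ⟨s, [32, 33]⟩) := by
    intro m i h
    simp [flat, copy, writesAt, h]
  obtain ⟨s2, f2, r2, -, e2⟩ := loop_row (d := d) (m := 0) (k := i) (i := 15) (x := 0)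
    (p := loop 16 1 (loop 17 0 (loop 18 1 (flat 32 15 16 1 ;; flat 33 17 18 1 ;;
    copy ⟨d, [15, 16, 17, 18]⟩ ⟨s, [32, 33]⟩)))) (st := st)
    (by rwa [hs.r0]) (hw 0 15 rfl) rfl
  have hs2 := hs.of_frame f2 rfl
  obtain ⟨s3, f3, r3, -, e3⟩ := loop_row (d := d) (m := 1) (k := j) (i := 16) (x := 1)
    (p := loop 17 0 (loop 18 1 (flat 32 15 16 1 ;; flat 33 17 18 1 ;;
    copy ⟨d, [15, 16, 17, 18]⟩ ⟨s, [32, 33]⟩))) (st := s2)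
    (by rwa [hs2.r1]) (hw 1 16 rfl) rfl
  have hs3 := hs2.of_frame f3 rfl
  obtain ⟨s4, f4, r4, -, e4⟩ := loop_row (d := d) (m := 2) (k := k) (i := 17) (x := 0)
    (p := loop 18 1 (flat 32 15 16 1 ;; flat 33 17 18 1 ;;
    copy ⟨d, [15, 16, 17, 18]⟩ ⟨s, [32, 33]⟩)) (st := s3)
    (by rwa [hs3.r0]) (hw 2 17 rfl) rfl
  have hs4 := hs3.of_frame f4 rfl
  obtain ⟨s5, f5, r5, -, e5⟩ := loop_row (d := d) (m := 3) (k := l) (i := 18) (x := 1)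
    (p := flat 32 15 16 1 ;; flat 33 17 18 1 ;;
    copy ⟨d, [15, 16, 17, 18]⟩ ⟨s, [32, 33]⟩) (st := s4)
    (by rwa [hs4.r1]) (hw 3 18 rfl) rfl
  have hs5 := hs4.of_frame f5 rfl
  rw [e2 _ rfl, e3 _ rfl, e4 _ rfl, e5 _ rfl]
  have k15 : s5.reg 15 = i := by rw [f5.reg 15 rfl, f4.reg 15 rfl, f3.reg 15 rfl, r2]
  have k16 : s5.reg 16 = j := by rw [f5.reg 16 rfl, f4.reg 16 rfl, r3]
  have k17 : s5.reg 17 = k := by rw [f5.reg 17 rfl, r4]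
  have hm : ([d].contains s) = false := by simpa using hds.symm
  have hms : s ∉ [d] := by simpa using hds.symm
  have km : s5.mem s = st.mem s := by
    rw [f5.mem s (by simp [flat, copy, wm, hds.symm]),
      f4.mem s (by simp [flat, copy, wm, hds.symm]),
      f3.mem s (by simp [flat, copy, wm, hds.symm]),
      f2.mem s (by simp [flat, copy, wm, hds.symm])]
  simp [exec_flat_reg, k15, k16, k17, r5, hs5.r1, km, hds]

/-- Arrays `8`, `9` `:=` the eigenvectors in array `53`, with all indices separated. -/
def outX : Prog :=
  loop 14 5 (loop 15 0 (loop 16 1 (flat 30 15 16 1 ;;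
    copy ⟨8, [14, 15, 16]⟩ ⟨53, [14, 30]⟩ ;; copy ⟨9, [14, 15, 16]⟩ ⟨53, [14, 30]⟩)))

theorem outX_spec {n₁ n₂ n₃ : ℕ} {st : State} (hs : Sizes n₁ n₂ n₃ st) {N : ℕ}
    (hN : N = n₁ * n₂) {l a b : ℕ} (hl : l < N) (ha : a < n₁) (hb : b < n₂) :
    (outX.exec st).mem 8 [l, a, b] = st.mem 53 [l, a * n₂ + b] ∧
      (outX.exec st).mem 9 [l, a, b] = st.mem 53 [l, a * n₂ + b] := by
  have key : ∀ d, d = 8 ∨ d = 9 → (outX.exec st).mem d [l, a, b] =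
      st.mem 53 [l, a * n₂ + b] := by
    intro d hd
    have hw : ∀ m i, [14, 15, 16][m]? = some i → writesAt d m i (flat 30 15 16 1 ;;
        copy ⟨8, [14, 15, 16]⟩ ⟨53, [14, 30]⟩ ;; copy ⟨9, [14, 15, 16]⟩ ⟨53, [14, 30]⟩) := by
      intro m i h
      simp [flat, copy, writesAt, h]
    rw [outX]
    obtain ⟨s1, f1, r1, -, e1⟩ := loop_row (d := d) (m := 0) (k := l) (i := 14) (x := 5)
      (p := loop 15 0 (loop 16 1 (flat 30 15 16 1 ;;
        copy ⟨8, [14, 15, 16]⟩ ⟨53, [14, 30]⟩ ;; copy ⟨9, [14, 15, 16]⟩ ⟨53, [14, 30]⟩)))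
      (st := st) (by rw [hs.r5, ← hN]; exact hl) (hw 0 14 rfl) rfl
    have hs1 := hs.of_frame f1 rfl
    obtain ⟨s2, f2, r2, -, e2⟩ := loop_row (d := d) (m := 1) (k := a) (i := 15) (x := 0)
      (p := loop 16 1 (flat 30 15 16 1 ;;
        copy ⟨8, [14, 15, 16]⟩ ⟨53, [14, 30]⟩ ;; copy ⟨9, [14, 15, 16]⟩ ⟨53, [14, 30]⟩))
      (st := s1) (by rwa [hs1.r0]) (hw 1 15 rfl) rfl
    have hs2 := hs1.of_frame f2 rfl
    obtain ⟨s3, f3, r3, -, e3⟩ := loop_row (d := d) (m := 2) (k := b) (i := 16) (x := 1)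
      (p := flat 30 15 16 1 ;;
        copy ⟨8, [14, 15, 16]⟩ ⟨53, [14, 30]⟩ ;; copy ⟨9, [14, 15, 16]⟩ ⟨53, [14, 30]⟩)
      (st := s2) (by rwa [hs2.r1]) (hw 2 16 rfl) rfl
    have hs3 := hs2.of_frame f3 rfl
    rw [e1 _ rfl, e2 _ rfl, e3 _ rfl]
    have k14 : s3.reg 14 = l := by rw [f3.reg 14 rfl, f2.reg 14 rfl, r1]
    have k15 : s3.reg 15 = a := by rw [f3.reg 15 rfl, r2]
    have k53 : s3.mem 53 = st.mem 53 := by rw [f3.mem 53 rfl, f2.mem 53 rfl, f1.mem 53 rfl]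
    rcases hd with rfl | rfl <;>
      simp [exec_flat_reg, k14, k15, r3, hs3.r1, k53]
  exact ⟨key 8 (.inl rfl), key 9 (.inr rfl)⟩

/-- The sizes of the index ranges. -/
def sizesProg₁ : Prog := idxConst 5 0 ;; loop 10 0 (idxAdd 5 5 1)

/-- The sizes of the index ranges, continued. -/
def sizesProg₂ : Prog :=
  idxConst 7 0 ;; loop 10 5 (idxAdd 7 7 5) ;; idxConst 9 1 ;; idxAdd 6 5 9 ;; idxConst 8 0

theorem sizesProg_spec {st : State} :
    Sizes (st.reg 0) (st.reg 1) (st.reg 2) (sizesProg₂.exec (sizesProg₁.exec st)) := by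
  have f1 := frame_exec sizesProg₁ st
  have h5 : (sizesProg₁.exec st).reg 5 = st.reg 0 * st.reg 1 := by
    have := loop_induction (i := 10) (x := 0) (p := idxAdd 5 5 1) (st := st.setReg 5 0)
      (fun t s => s.reg 5 = t * st.reg 1) (by simp) (by
        intro k hk s f ih
        have := f.reg 1 rfl
        simp at this
        simp [ih, this, add_mul])
    simpa [sizesProg₁] using this
  set s1 := sizesProg₁.exec st
  have h7 := loop_induction (i := 10) (x := 5) (p := idxAdd 7 7 5) (st := s1.setReg 7 0)
      (fun t s => s.reg 7 = t * s1.reg 5) (by simp) (by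
        intro k hk s f ih
        have := f.reg 5 rfl
        simp at this
        simp [ih, this, add_mul])
  have f2 := frame_exec (loop 10 5 (idxAdd 7 7 5)) (s1.setReg 7 0)
  simp only [sizesProg₂, exec_seq, exec_idxConst, exec_idxAdd]
  set s2 := (loop 10 5 (idxAdd 7 7 5)).exec (s1.setReg 7 0)
  have a5 : s2.reg 5 = st.reg 0 * st.reg 1 := by rw [f2.reg 5 rfl]; simp [h5]
  constructor
  · simp [f2.reg 0 rfl, f1.reg 0 rfl]
  · simp [f2.reg 1 rfl, f1.reg 1 rfl]
  · simp [f2.reg 2 rfl, f1.reg 2 rfl]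
  · simp [a5]
  · simp [a5]
  · simp [h7, h5]
  · simp
  · simp

end Prog
end JLV

namespace JLV

open Matrix

/-! ### Polynomial functions and generic properties -/

/-- `F` is a polynomial function of the real vector `w`. -/
def IsPoly {σ : Type} (F : (σ → ℝ) → ℝ) : Prop :=
  ∃ p : MvPolynomial σ ℝ, ∀ w, F w = MvPolynomial.eval w p

namespace IsPoly

variable {σ : Type} {F G : (σ → ℝ) → ℝ}

theorem const (r : ℝ) : IsPoly fun _ : σ → ℝ => r := ⟨MvPolynomial.C r, by simp⟩

theorem coord (i : σ) : IsPoly fun w : σ → ℝ => w i := ⟨MvPolynomial.X i, by simp⟩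

theorem mul (hF : IsPoly F) (hG : IsPoly G) : IsPoly fun w => F w * G w := by
  obtain ⟨p, hp⟩ := hF
  obtain ⟨q, hq⟩ := hG
  exact ⟨p * q, by simp [hp, hq]⟩

theorem sub (hF : IsPoly F) (hG : IsPoly G) : IsPoly fun w => F w - G w := by
  obtain ⟨p, hp⟩ := hF
  obtain ⟨q, hq⟩ := hG
  exact ⟨p - q, by simp [hp, hq]⟩

theorem sum {ι : Type} (s : Finset ι) {F : ι → (σ → ℝ) → ℝ} (h : ∀ i, IsPoly (F i)) :
    IsPoly fun w => ∑ i ∈ s, F i w := by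
  choose p hp using h
  exact ⟨∑ i ∈ s, p i, by simp [hp]⟩

theorem det {ι : Type} [Fintype ι] [DecidableEq ι] {M : (σ → ℝ) → Matrix ι ι ℝ}
    (h : ∀ i j, IsPoly fun w => M w i j) : IsPoly fun w => (M w).det := by
  choose p hp using h
  refine ⟨(Matrix.of p).det, fun w => ?_⟩
  have h2 : (MvPolynomial.eval w).mapMatrix (Matrix.of p) = M w := by
    ext i j
    exact (hp i j w).symm
  rw [RingHom.map_det, h2]

theorem adjugate {ι : Type} [Fintype ι] [DecidableEq ι] {M : (σ → ℝ) → Matrix ι ι ℝ}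
    (h : ∀ i j, IsPoly fun w => M w i j) (i j : ι) : IsPoly fun w => (M w).adjugate i j := by
  choose p hp using h
  refine ⟨(Matrix.of p).adjugate i j, fun w => ?_⟩
  have h1 := RingHom.map_adjugate (MvPolynomial.eval w) (Matrix.of p)
  have h2 : (MvPolynomial.eval w).mapMatrix (Matrix.of p) = M w := by
    ext i j
    exact (hp i j w).symm
  rw [h2] at h1
  exact (congrFun (congrFun h1 i) j).symm

theorem generically (hF : IsPoly F) (h : ∃ w, F w ≠ 0) : Generically fun w => F w ≠ 0 := by
  obtain ⟨p, hp⟩ := hF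
  obtain ⟨w, hw⟩ := h
  exact ⟨p, fun h0 => hw (by simp [hp, h0]), fun w hw => by rwa [← hp] at hw⟩

end IsPoly

namespace Generically

variable {σ : Type} {P Q : (σ → ℝ) → Prop}

theorem of_forall (h : ∀ w, P w) : Generically P := ⟨1, one_ne_zero, fun w _ => h w⟩

theorem mono (hP : Generically P) (h : ∀ w, P w → Q w) : Generically Q := by
  obtain ⟨p, hp, hp'⟩ := hP
  exact ⟨p, hp, fun w hw => h w (hp' w hw)⟩

theorem and (hP : Generically P) (hQ : Generically Q) : Generically fun w => P w ∧ Q w := by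
  obtain ⟨p, hp, hp'⟩ := hP
  obtain ⟨q, hq, hq'⟩ := hQ
  refine ⟨p * q, mul_ne_zero hp hq, fun w hw => ?_⟩
  rw [map_mul] at hw
  exact ⟨hp' w (left_ne_zero_of_mul hw), hq' w (right_ne_zero_of_mul hw)⟩

theorem forall_fintype {ι : Type} [Fintype ι] {P : ι → (σ → ℝ) → Prop}
    (h : ∀ i, Generically (P i)) : Generically fun w => ∀ i, P i w := by
  choose p hp hp' using h
  refine ⟨∏ i, p i, Finset.prod_ne_zero_iff.2 fun i _ => hp i, fun w hw i => hp' i w ?_⟩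
  rw [map_prod] at hw
  exact Finset.prod_ne_zero_iff.1 hw i (Finset.mem_univ i)

theorem of_imp {p : Prop} (h : p → Generically P) : Generically fun w => p → P w := by
  by_cases hp : p
  · exact (h hp).mono fun w hw _ => hw
  · exact of_forall fun w hp' => absurd hp' hp

theorem exists_point (hP : Generically P) : ∃ w, P w := by
  obtain ⟨p, hp, hp'⟩ := hP
  by_contra! h
  refine hp (MvPolynomial.funext fun w => ?_)
  rw [map_zero]
  by_contra hw
  exact h w (hp' w hw)

/-- If a family of vectors that depend polynomially on `w` is linearly independent for one `w`,
then it is so generically: the Gram determinant is a polynomial in `w`. -/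
theorem independent {κ τ : Type} [Fintype κ] [Fintype τ]
    {F : (σ → ℝ) → κ → τ → ℝ} (hF : ∀ k t, IsPoly fun w => F w k t)
    (h : ∃ w, ∀ y : κ → ℝ, (∀ t, ∑ k, y k * F w k t = 0) → y = 0) :
    Generically fun w => ∀ y : κ → ℝ, (∀ t, ∑ k, y k * F w k t = 0) → y = 0 := by
  classical
  let G : (σ → ℝ) → Matrix κ κ ℝ := fun w => Matrix.of fun k k' => ∑ t, F w k t * F w k' t
  have hG : ∀ w y k, (G w *ᵥ y) k = ∑ t, F w k t * ∑ k', y k' * F w k' t := by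
    intro w y k
    simp only [G, mulVec, dotProduct, of_apply, Finset.sum_mul, Finset.mul_sum]
    rw [Finset.sum_comm]
    exact Finset.sum_congr rfl fun _ _ => Finset.sum_congr rfl fun _ _ => by ring
  refine (IsPoly.generically (F := fun w => (G w).det) (.det fun i j => .sum _ fun t =>
    (hF i t).mul (hF j t)) ?_).mono fun w hw y hy => ?_
  · obtain ⟨w, hw⟩ := h
    refine ⟨w, fun h0 => ?_⟩
    obtain ⟨y, hy, hGy⟩ := exists_mulVec_eq_zero_iff.2 h0
    refine hy (hw y fun t => ?_)
    have h1 : ∑ t, (∑ k, y k * F w k t) ^ 2 = 0 := by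
      have h2 : y ⬝ᵥ G w *ᵥ y = 0 := by rw [hGy, dotProduct_zero]
      rw [← h2]
      have h3 : ∀ k, y k * (G w *ᵥ y) k = ∑ t, y k * F w k t * ∑ k', y k' * F w k' t := by
        intro k
        rw [hG, Finset.mul_sum]
        exact Finset.sum_congr rfl fun _ _ => by ring
      rw [dotProduct, Finset.sum_congr rfl fun k _ => h3 k, Finset.sum_comm]
      exact Finset.sum_congr rfl fun t _ => by rw [sq, Finset.sum_mul]
    exact pow_eq_zero_iff two_ne_zero |>.1
      ((Finset.sum_eq_zero_iff_of_nonneg fun _ _ => sq_nonneg _).1 h1 t (Finset.mem_univ t))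
  · refine eq_zero_of_mulVec_eq_zero hw (funext fun k => ?_)
    rw [hG]
    simp [hy]

end Generically

/-! ### Generic components -/

/-- The entry `(aˡ bˡ)(p) (aˡ bˡ)(q)` at the position `f i = (p, q)`. -/
def sampleMatrix {n₁ n₂ R : ℕ} (a : Fin R → Fin n₁ → ℝ) (b : Fin R → Fin n₂ → ℝ)
    (f : Fin R → (Fin n₁ × Fin n₂) × (Fin n₁ × Fin n₂)) : Matrix (Fin R) (Fin R) ℝ :=
  Matrix.of fun l i => a l (f i).1.1 * b l (f i).1.2 * (a l (f i).2.1 * b l (f i).2.2)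

/-- The coefficients `∑ᵢ αᵢ adj(M)ᵢₗ`, where `M` is the sample matrix for `f` and `αᵢ` is entry
`(i₀, j₀, i)` of the tensor. The adjugate is used instead of the inverse in order to have
polynomials in the components. -/
def sampleCoef {n₁ n₂ n₃ R : ℕ} (hR : R ≤ n₃) (a : Fin R → Fin n₁ → ℝ) (b : Fin R → Fin n₂ → ℝ)
    (c : Fin R → Fin n₃ → ℝ) (f : Fin R → (Fin n₁ × Fin n₂) × (Fin n₁ × Fin n₂))
    (i₀ : Fin n₁) (j₀ : Fin n₂) (l : Fin R) : ℝ :=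
  ∑ i : Fin R, (∑ m, a m i₀ * b m j₀ * c m (Fin.castLE hR i)) * (sampleMatrix a b f).adjugate i l

/-- The conditions on the components under which the algorithm succeeds. The entries `(i₀, j₀)` and
`(i₀, j₁)` of the slices are the coefficients that the program uses. -/
structure Good {n₁ n₂ n₃ R : ℕ} (hR : R ≤ n₃) (i₀ : Fin n₁) (j₀ j₁ : Fin n₂)
    (a : Fin R → Fin n₁ → ℝ) (b : Fin R → Fin n₂ → ℝ) (c : Fin R → Fin n₃ → ℝ) : Prop where
  /-- the matrices `aˡ ⊗ bˡ` are linearly independent -/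
  indep : ∀ y : Fin R → ℝ, (∀ t : Fin n₁ × Fin n₂, ∑ l, y l * (a l t.1 * b l t.2) = 0) → y = 0
  /-- the tensors `(aˡ ∧ aᵏ) ⊗ (bˡ ∧ bᵏ)`, `l < k`, are linearly independent; a linear combination
  is written as a symmetric matrix `Y` with zero diagonal -/
  core : ∀ Y : Fin R × Fin R → ℝ, (∀ l k, Y (l, k) = Y (k, l)) → (∀ l, Y (l, l) = 0) →
    (∀ A C B D, ∑ t, Y t * (a t.1 A * a t.2 C * (b t.1 B * b t.2 D - b t.1 D * b t.2 B)) = 0) →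
      Y = 0
  /-- the first slices of the tensor span the space of the slices -/
  slices : (Matrix.of fun l k : Fin R => c l (Fin.castLE hR k)).det ≠ 0
  corner : ∀ l, a l i₀ * b l j₀ ≠ 0
  /-- the entries `(i₀, j₀)`, `(i₀, j₁)` of the first slices, as coefficients for a basis `Pᵢ` dual
  to `R` matrix entries, give contractions with nonzero coefficients and distinct ratios; the
  positions of these entries are not known, hence the quantification over `f` -/
  coef : ∀ f, (sampleMatrix a b f).det ≠ 0 →
    (∀ l, sampleCoef hR a b c f i₀ j₀ l ≠ 0) ∧ (∀ l, sampleCoef hR a b c f i₀ j₁ l ≠ 0) ∧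
    ∀ l k, l ≠ k → sampleCoef hR a b c f i₀ j₀ l * sampleCoef hR a b c f i₀ j₁ k -
      sampleCoef hR a b c f i₀ j₀ k * sampleCoef hR a b c f i₀ j₁ l ≠ 0

section Witness

variable {n₁ n₂ R : ℕ}

/-- The vector `e_{⌊l/r⌋+1} + l e₀`. -/
def witnessA (n₁ r : ℕ) (l : Fin R) (i : Fin n₁) : ℝ :=
  if (i : ℕ) = 0 then (l : ℝ) else if (i : ℕ) = l / r + 1 then 1 else 0

/-- The vector `(1, l, l², …)`. -/
def witnessB (n₂ : ℕ) (l : Fin R) (j : Fin n₂) : ℝ := (l : ℝ) ^ (j : ℕ)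

/-- Up to `n₂` of the vectors `bˡ` have a dual family, by Lagrange interpolation. -/
theorem exists_dual_witnessB {S : Finset (Fin R)} (hS : S.card ≤ n₂) {l₀ : Fin R} (hl : l₀ ∈ S) :
    ∃ φ : Fin n₂ → ℝ, ∀ l ∈ S, ∑ j, φ j * witnessB n₂ l j = if l = l₀ then 1 else 0 := by
  have hinj : Set.InjOn (fun l : Fin R => ((l : ℕ) : ℝ)) S := fun x _ y _ h =>
    Fin.ext (by
      have h' : ((x : ℕ) : ℝ) = ((y : ℕ) : ℝ) := h
      exact_mod_cast h')
  set p := Lagrange.basis S (fun l : Fin R => ((l : ℕ) : ℝ)) l₀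
  have hdeg : p.natDegree < n₂ := by
    have h1 : p.degree = ((S.card - 1 : ℕ) : WithBot ℕ) := Lagrange.degree_basis hinj hl
    have h2 := Polynomial.natDegree_eq_of_degree_eq_some h1
    have h3 := Finset.card_pos.2 ⟨l₀, hl⟩
    omega
  refine ⟨fun j => p.coeff j, fun l hl' => ?_⟩
  have h := Polynomial.eval_eq_sum_range' hdeg ((l : ℕ) : ℝ)
  rw [Finset.sum_range] at h
  simp only [witnessB]
  rw [← h]
  split
  · next h1 => rw [h1]; exact Lagrange.eval_basis_self hinj hl
  · next h1 => exact
      Lagrange.eval_basis_of_ne (v := fun l : Fin R => ((l : ℕ) : ℝ)) (Ne.symm h1) hl'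

/-- The indices in the blocks `i` and `i'`. -/
def blocks (R r i i' : ℕ) : Finset (Fin R) := {l | (l : ℕ) / r = i ∨ (l : ℕ) / r = i'}

theorem card_blocks_le {r : ℕ} (hr : 0 < r) (i i' : ℕ) : (blocks R r i i').card ≤ 2 * r := by
  have h : ∀ i, ({l | (l : ℕ) / r = i} : Finset (Fin R)).card ≤ r := by
    intro i
    refine (Finset.card_le_card_of_injOn (t := Finset.range r) (fun l : Fin R => (l : ℕ) % r)
      (fun l _ => by simpa using Nat.mod_lt _ hr) fun x hx y hy hxy => ?_).trans
      (Finset.card_range r).le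
    simp only [Finset.coe_filter, Finset.mem_univ, true_and, Set.mem_ofPred_eq] at hx hy hxy
    refine Fin.ext ?_
    rw [← Nat.div_add_mod x r, ← Nat.div_add_mod y r, hx, hy, hxy]
  rw [blocks, Finset.filter_or]
  have h1 := h i
  have h2 := h i'
  exact (Finset.card_union_le _ _).trans (by omega)

theorem witness_indep {r : ℕ} (hr : 0 < r) (h2r : 2 * r ≤ n₂) (hR : R ≤ (n₁ - 1) * r)
    (y : Fin R → ℝ)
    (hy : ∀ t : Fin n₁ × Fin n₂, ∑ l, y l * (witnessA n₁ r l t.1 * witnessB n₂ l t.2) = 0) :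
    y = 0 := by
  funext l₀
  have hl₀ : (l₀ : ℕ) / r < n₁ - 1 := Nat.div_lt_of_lt_mul (by rw [mul_comm]; omega)
  obtain ⟨φ, hφ⟩ := exists_dual_witnessB (n₂ := n₂) (S := blocks R r (l₀ / r) (l₀ / r))
    ((card_blocks_le hr _ _).trans h2r) (l₀ := l₀) (by simp [blocks])
  have h : ∑ j, φ j * ∑ l, y l *
      (witnessA n₁ r l ⟨l₀ / r + 1, Nat.add_lt_of_lt_sub hl₀⟩ * witnessB n₂ l j) = 0 :=
    Finset.sum_eq_zero fun j _ => by rw [hy (_, j), mul_zero]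
  simp only [Finset.mul_sum] at h
  rw [Finset.sum_comm, Finset.sum_eq_single_of_mem l₀ (Finset.mem_univ _)] at h
  · have := hφ l₀ (by simp [blocks])
    rw [if_pos rfl] at this
    have h' : y l₀ * ∑ j, φ j * witnessB n₂ l₀ j = 0 := by
      rw [Finset.mul_sum, ← h]
      exact Finset.sum_congr rfl fun j _ => by simp [witnessA]; ring
    rwa [this, mul_one] at h'
  · intro l _ hl
    by_cases hb : (l : ℕ) / r = l₀ / r
    · have := hφ l (by simp [blocks, hb])
      rw [if_neg hl] at this
      rw [← mul_zero (y l), ← this, Finset.mul_sum]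
      exact Finset.sum_congr rfl fun j _ => by simp [witnessA, hb]; ring
    · exact Finset.sum_eq_zero fun j _ => by simp [witnessA, Ne.symm hb]

/-- The coordinates `e_{i+1} ∧ e_{i'+1}` of `aˡ ∧ aᵏ` separate pairs in different blocks, and the
coordinates `e_{i+1} ∧ e₀` then separate pairs in the same block. -/
theorem witness_core {r : ℕ} (hr : 0 < r) (h2r : 2 * r ≤ n₂) (hR : R ≤ (n₁ - 1) * r)
    (Y : Fin R × Fin R → ℝ) (hsymm : ∀ l k, Y (l, k) = Y (k, l)) (hdiag : ∀ l, Y (l, l) = 0)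
    (hY : ∀ A C B D, ∑ t, Y t * (witnessA n₁ r t.1 A * witnessA n₁ r t.2 C *
      (witnessB n₂ t.1 B * witnessB n₂ t.2 D - witnessB n₂ t.1 D * witnessB n₂ t.2 B)) = 0) :
    Y = 0 := by
  have hlt : ∀ l : Fin R, (l : ℕ) / r < n₁ - 1 := fun l =>
    Nat.div_lt_of_lt_mul (by rw [mul_comm]; omega)
  -- apply a pair of functionals in the second mode
  have key : ∀ (A C : Fin n₁) (φ ψ : Fin n₂ → ℝ), ∑ t : Fin R × Fin R,
      Y t * (witnessA n₁ r t.1 A * witnessA n₁ r t.2 C *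
      ((∑ j, φ j * witnessB n₂ t.1 j) * (∑ j, ψ j * witnessB n₂ t.2 j) -
        (∑ j, ψ j * witnessB n₂ t.1 j) * (∑ j, φ j * witnessB n₂ t.2 j))) = 0 := by
    intro A C φ ψ
    have h : ∑ B, ∑ D, φ B * ψ D * ∑ t : Fin R × Fin R,
        Y t * (witnessA n₁ r t.1 A * witnessA n₁ r t.2 C *
        (witnessB n₂ t.1 B * witnessB n₂ t.2 D - witnessB n₂ t.1 D * witnessB n₂ t.2 B)) = 0 :=
      Finset.sum_eq_zero fun B _ => Finset.sum_eq_zero fun D _ => by rw [hY, mul_zero]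
    rw [← h]
    simp_rw [Finset.mul_sum (s := (Finset.univ : Finset (Fin R × Fin R)))]
    rw [Finset.sum_congr rfl fun B _ => Finset.sum_comm, Finset.sum_comm]
    refine Finset.sum_congr rfl fun t _ => ?_
    rw [mul_comm (∑ j, ψ j * witnessB n₂ t.1 j), Finset.sum_mul_sum, Finset.sum_mul_sum,
      ← Finset.sum_sub_distrib]
    simp_rw [← Finset.sum_sub_distrib]
    rw [Finset.mul_sum, Finset.mul_sum]
    refine Finset.sum_congr rfl fun B _ => ?_
    rw [Finset.mul_sum, Finset.mul_sum]
    exact Finset.sum_congr rfl fun D _ => by ring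
  have step1 : ∀ l₀ k₀ : Fin R, (l₀ : ℕ) / r ≠ k₀ / r → Y (l₀, k₀) = 0 := by
    intro l₀ k₀ hne
    have hlk : l₀ ≠ k₀ := fun h => hne (by rw [h])
    have hcard := (card_blocks_le (R := R) hr (l₀ / r) (k₀ / r)).trans h2r
    obtain ⟨φ, hφ⟩ := exists_dual_witnessB hcard (l₀ := l₀) (by simp [blocks])
    obtain ⟨ψ, hψ⟩ := exists_dual_witnessB hcard (l₀ := k₀) (by simp [blocks])
    have h := key ⟨l₀ / r + 1, Nat.add_lt_of_lt_sub (hlt l₀)⟩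
      ⟨k₀ / r + 1, Nat.add_lt_of_lt_sub (hlt k₀)⟩ φ ψ
    rw [Finset.sum_eq_single_of_mem (l₀, k₀) (Finset.mem_univ _)] at h
    · rw [hφ l₀ (by simp [blocks]), hψ l₀ (by simp [blocks]), hφ k₀ (by simp [blocks]),
        hψ k₀ (by simp [blocks])] at h
      simpa [witnessA, hlk, hlk.symm] using h
    · rintro ⟨l, k⟩ - hlk'
      by_cases hl : (l : ℕ) / r = l₀ / r
      · by_cases hk : (k : ℕ) / r = k₀ / r
        · have e1 : l ≠ k₀ := fun h => hne (by rw [← hl, h])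
          rw [hφ l (by simp [blocks, hl]), hψ l (by simp [blocks, hl]),
            hφ k (by simp [blocks, hk]), hψ k (by simp [blocks, hk]), if_neg e1]
          by_cases e2 : l = l₀
          · have e3 : k ≠ k₀ := fun h => hlk' (by rw [e2, h])
            simp [e3]
          · simp [e2]
        · simp [witnessA, Ne.symm hk]
      · simp [witnessA, Ne.symm hl]
  have step2 : ∀ l₀ k₀ : Fin R, (l₀ : ℕ) / r = k₀ / r → Y (l₀, k₀) = 0 := by
    intro l₀ k₀ heq
    by_cases hlk : l₀ = k₀
    · rw [hlk, hdiag]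
    have hcard := (card_blocks_le (R := R) hr (l₀ / r) (l₀ / r)).trans h2r
    obtain ⟨φ, hφ⟩ := exists_dual_witnessB hcard (l₀ := l₀) (by simp [blocks])
    obtain ⟨ψ, hψ⟩ := exists_dual_witnessB hcard (l₀ := k₀) (by simp [blocks, heq])
    have h := key ⟨l₀ / r + 1, Nat.add_lt_of_lt_sub (hlt l₀)⟩
      ⟨0, (Nat.zero_le _).trans_lt (Nat.add_lt_of_lt_sub (hlt l₀))⟩ φ ψ
    have hpair : ((l₀, k₀) : Fin R × Fin R) ≠ (k₀, l₀) := fun h => hlk (Prod.ext_iff.1 h).1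
    rw [← Finset.sum_subset (Finset.subset_univ {(l₀, k₀), (k₀, l₀)}),
      Finset.sum_pair hpair] at h
    · dsimp only at h
      rw [hφ l₀ (by simp [blocks]), hψ l₀ (by simp [blocks]), hφ k₀ (by simp [blocks, heq]),
        hψ k₀ (by simp [blocks, heq]), hsymm k₀ l₀] at h
      have hne : ((k₀ : ℕ) : ℝ) - ((l₀ : ℕ) : ℝ) ≠ 0 :=
        sub_ne_zero.2 fun h' => hlk (Fin.ext (by exact_mod_cast h'.symm))
      simp [witnessA, heq, hlk, Ne.symm hlk] at h
      have h' : Y (l₀, k₀) * (((k₀ : ℕ) : ℝ) - ((l₀ : ℕ) : ℝ)) = 0 := by linarith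
      exact (mul_eq_zero.1 h').resolve_right hne
    · rintro ⟨l, k⟩ - hlk'
      simp only [Finset.mem_insert, Finset.mem_singleton, Prod.mk.injEq, not_or, not_and] at hlk'
      by_cases hl : (l : ℕ) / r = l₀ / r
      · by_cases hk : (k : ℕ) / r = l₀ / r
        · rw [hφ l (by simp [blocks, hl]), hψ l (by simp [blocks, hl]),
            hφ k (by simp [blocks, hk]), hψ k (by simp [blocks, hk])]
          by_cases e2 : l = l₀
          · by_cases e3 : l = k₀
            · exact absurd (e2.symm.trans e3) hlk
            · simp [e2, hlk, hlk'.1 e2]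
          · by_cases e3 : l = k₀
            · simp [e3, Ne.symm hlk, hlk'.2 e3]
            · simp [e2, e3]
        · rw [step1 l k (by rw [hl]; exact Ne.symm hk), zero_mul]
      · simp [witnessA, Ne.symm hl]
  funext ⟨l, k⟩
  by_cases h : (l : ℕ) / r = k / r
  · exact step2 l k h
  · exact step1 l k h

end Witness

end JLV

namespace JLV

open Matrix

/-! ### The conditions hold generically -/

section GenericGood

variable {n₁ n₂ n₃ R : ℕ}

/-- The components, listed as one real vector. -/
def toVector (a : Fin R → Fin n₁ → ℝ) (b : Fin R → Fin n₂ → ℝ) (c : Fin R → Fin n₃ → ℝ) :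
    Fin R × (Fin n₁ ⊕ (Fin n₂ ⊕ Fin n₃)) → ℝ :=
  fun p => Sum.elim (a p.1) (Sum.elim (b p.1) (c p.1)) p.2

theorem generic_indep {r : ℕ} (hr : 0 < r) (h2r : 2 * r ≤ n₂) (hR : R ≤ (n₁ - 1) * r) :
    GenericComponents n₁ n₂ n₃ R fun a b _ => ∀ y : Fin R → ℝ,
      (∀ t : Fin n₁ × Fin n₂, ∑ l, y l * (a l t.1 * b l t.2) = 0) → y = 0 :=
  Generically.independent (F := fun (w : Fin R × (Fin n₁ ⊕ (Fin n₂ ⊕ Fin n₃)) → ℝ) l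
      (t : Fin n₁ × Fin n₂) => w (l, Sum.inl t.1) * w (l, Sum.inr (Sum.inl t.2)))
    (fun _ _ => .mul (.coord _) (.coord _))
    ⟨toVector (witnessA n₁ r) (witnessB n₂) 0, witness_indep hr h2r hR⟩

theorem generic_core {r : ℕ} (hr : 0 < r) (h2r : 2 * r ≤ n₂) (hR : R ≤ (n₁ - 1) * r) :
    GenericComponents n₁ n₂ n₃ R fun a b _ => ∀ Y : Fin R × Fin R → ℝ,
      (∀ l k, Y (l, k) = Y (k, l)) → (∀ l, Y (l, l) = 0) →
      (∀ A C B D, ∑ t, Y t * (a t.1 A * a t.2 C * (b t.1 B * b t.2 D - b t.1 D * b t.2 B)) = 0) →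
      Y = 0 := by
  -- the three conditions on `Y` form one linear system
  let F : (Fin R × (Fin n₁ ⊕ (Fin n₂ ⊕ Fin n₃)) → ℝ) → Fin R × Fin R →
      ((Fin R × Fin R) ⊕ Fin R) ⊕ (Fin n₁ × Fin n₁ × Fin n₂ × Fin n₂) → ℝ := fun w t e =>
    match e with
    | .inl (.inl (l, k)) => (if t = (l, k) then 1 else 0) - (if t = (k, l) then 1 else 0)
    | .inl (.inr l) => if t = (l, l) then 1 else 0
    | .inr (A, C, B, D) => w (t.1, Sum.inl A) * w (t.2, Sum.inl C) *
        (w (t.1, Sum.inr (Sum.inl B)) * w (t.2, Sum.inr (Sum.inl D)) -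
          w (t.1, Sum.inr (Sum.inl D)) * w (t.2, Sum.inr (Sum.inl B)))
  have hF : ∀ w (Y : Fin R × Fin R → ℝ), (∀ e, ∑ t, Y t * F w t e = 0) ↔
      (∀ l k, Y (l, k) = Y (k, l)) ∧ (∀ l, Y (l, l) = 0) ∧
      ∀ A C B D, ∑ t, Y t * F w t (.inr (A, C, B, D)) = 0 := by
    intro w Y
    constructor
    · intro h
      refine ⟨fun l k => ?_, fun l => ?_, fun A C B D => h (.inr (A, C, B, D))⟩
      · have := h (.inl (.inl (l, k)))
        simp only [F, mul_sub, Finset.sum_sub_distrib, mul_ite, mul_one, mul_zero,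
          Finset.sum_ite_eq', Finset.mem_univ, if_true] at this
        exact sub_eq_zero.1 this
      · simpa [F] using h (.inl (.inr l))
    · rintro ⟨h1, h2, h3⟩ ((⟨l, k⟩ | l) | ⟨A, C, B, D⟩)
      · simp only [F, mul_sub, Finset.sum_sub_distrib, mul_ite, mul_one, mul_zero,
          Finset.sum_ite_eq', Finset.mem_univ, if_true]
        exact sub_eq_zero.2 (h1 l k)
      · simpa [F] using h2 l
      · exact h3 A C B D
  refine (Generically.independent (F := F) ?_ ⟨toVector (witnessA n₁ r) (witnessB n₂) 0,
    fun Y hY => ?_⟩).mono fun w hw Y h1 h2 h3 => hw Y ((hF w Y).2 ⟨h1, h2, h3⟩)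
  · rintro t ((⟨l, k⟩ | l) | ⟨A, C, B, D⟩)
    · exact .const _
    · exact .const _
    · exact .mul (.mul (.coord _) (.coord _))
        (.sub (.mul (.coord _) (.coord _)) (.mul (.coord _) (.coord _)))
  · obtain ⟨h1, h2, h3⟩ := (hF _ Y).1 hY
    exact witness_core hr h2r hR Y h1 h2 h3

theorem generic_slices (hR : R ≤ n₃) : GenericComponents n₁ n₂ n₃ R fun _ _ c =>
    (Matrix.of fun l k : Fin R => c l (Fin.castLE hR k)).det ≠ 0 := by
  refine IsPoly.generically (.det fun l k => .coord _)
    ⟨toVector 0 0 fun l k => if (l : ℕ) = k then 1 else 0, ?_⟩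
  have : (Matrix.of fun l k : Fin R => if (l : ℕ) = (Fin.castLE hR k : Fin n₃) then (1 : ℝ) else 0)
      = 1 := by
    ext l k
    simp [Matrix.one_apply, Fin.ext_iff]
  exact (congrArg Matrix.det this).trans_ne (by simp)

theorem generic_corner (i₀ : Fin n₁) (j₀ : Fin n₂) : GenericComponents n₁ n₂ n₃ R fun a b _ =>
    ∀ l, a l i₀ * b l j₀ ≠ 0 :=
  .forall_fintype fun _ => IsPoly.generically (.mul (.coord _) (.coord _))
    ⟨toVector 1 1 0, by simp [toVector]⟩

theorem generic_pair_minors (i₀ : Fin n₁) {j₀ j₁ : Fin n₂} (hj : j₀ ≠ j₁) :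
    GenericComponents n₁ n₂ n₃ R fun a b _ => ∀ l k, l ≠ k →
      a l i₀ * b l j₀ * (a k i₀ * b k j₁) - a k i₀ * b k j₀ * (a l i₀ * b l j₁) ≠ 0 := by
  refine .forall_fintype fun l => .forall_fintype fun k => ?_
  by_cases hlk : l = k
  · exact .of_forall fun w h => absurd hlk h
  · refine (IsPoly.generically (.sub
      (.mul (.mul (.coord _) (.coord _)) (.mul (.coord _) (.coord _)))
      (.mul (.mul (.coord _) (.coord _)) (.mul (.coord _) (.coord _))))
      ⟨toVector 1 (fun l j => if j = j₀ then 1 else (l : ℝ)) 0, ?_⟩).mono fun w hw _ => hw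
    have : ((k : ℕ) : ℝ) - ((l : ℕ) : ℝ) ≠ 0 :=
      sub_ne_zero.2 fun h' => hlk (Fin.ext (by exact_mod_cast h'.symm))
    simpa [toVector, hj.symm] using this

theorem isPoly_sampleMatrix (f : Fin R → (Fin n₁ × Fin n₂) × (Fin n₁ × Fin n₂)) (l i : Fin R) :
    IsPoly fun w : Fin R × (Fin n₁ ⊕ (Fin n₂ ⊕ Fin n₃)) → ℝ =>
      sampleMatrix (fun l i => w (l, Sum.inl i)) (fun l j => w (l, Sum.inr (Sum.inl j))) f l i :=
  .mul (.mul (.coord _) (.coord _)) (.mul (.coord _) (.coord _))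

theorem isPoly_sampleCoef (hR : R ≤ n₃) (f : Fin R → (Fin n₁ × Fin n₂) × (Fin n₁ × Fin n₂))
    (i₀ : Fin n₁) (j₀ : Fin n₂) (l : Fin R) :
    IsPoly fun w : Fin R × (Fin n₁ ⊕ (Fin n₂ ⊕ Fin n₃)) → ℝ =>
      sampleCoef hR (fun l i => w (l, Sum.inl i)) (fun l j => w (l, Sum.inr (Sum.inl j)))
        (fun l k => w (l, Sum.inr (Sum.inr k))) f i₀ j₀ l :=
  .sum _ fun _ => .mul (.sum _ fun _ => .mul (.mul (.coord _) (.coord _)) (.coord _))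
    (.adjugate (isPoly_sampleMatrix f) _ _)

/-- If `c` is the sample matrix itself, the coefficients are multiples of `aˡ(i₀) bˡ(j₀)`. -/
theorem sampleCoef_self (hR : R ≤ n₃) (a : Fin R → Fin n₁ → ℝ) (b : Fin R → Fin n₂ → ℝ)
    (f : Fin R → (Fin n₁ × Fin n₂) × (Fin n₁ × Fin n₂)) (i₀ : Fin n₁) (j₀ : Fin n₂) (l : Fin R) :
    sampleCoef hR a b
      (fun m k => if h : (k : ℕ) < R then sampleMatrix a b f m ⟨k, h⟩ else 0) f i₀ j₀ l =
      a l i₀ * b l j₀ * (sampleMatrix a b f).det := by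
  have h : ∀ m, ∑ i, sampleMatrix a b f m i * (sampleMatrix a b f).adjugate i l =
      if m = l then (sampleMatrix a b f).det else 0 := by
    intro m
    rw [← Matrix.mul_apply, Matrix.mul_adjugate, Matrix.smul_apply, Matrix.one_apply, smul_eq_mul,
      mul_ite, mul_one, mul_zero]
  simp only [sampleCoef, Fin.val_castLE, Fin.is_lt, dif_pos, Fin.eta, Finset.sum_mul]
  rw [Finset.sum_comm]
  have h' : ∀ m, ∑ i, a m i₀ * b m j₀ * sampleMatrix a b f m i * (sampleMatrix a b f).adjugate i l =
      a m i₀ * b m j₀ * if m = l then (sampleMatrix a b f).det else 0 := by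
    intro m
    rw [← h m, Finset.mul_sum]
    exact Finset.sum_congr rfl fun i _ => by ring
  rw [Finset.sum_congr rfl fun m _ => h' m]
  simp

/-- The conditions on the coefficients hold for `c` as in `sampleCoef_self`, unless the determinant
vanishes identically. -/
theorem generic_coef (hR : R ≤ n₃) (i₀ : Fin n₁) {j₀ j₁ : Fin n₂} (hj : j₀ ≠ j₁) :
    GenericComponents n₁ n₂ n₃ R fun a b c => ∀ f, (sampleMatrix a b f).det ≠ 0 →
    (∀ l, sampleCoef hR a b c f i₀ j₀ l ≠ 0) ∧ (∀ l, sampleCoef hR a b c f i₀ j₁ l ≠ 0) ∧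
    ∀ l k, l ≠ k → sampleCoef hR a b c f i₀ j₀ l * sampleCoef hR a b c f i₀ j₁ k -
      sampleCoef hR a b c f i₀ j₀ k * sampleCoef hR a b c f i₀ j₁ l ≠ 0 := by
  refine .forall_fintype fun f => ?_
  by_cases hf : ∃ w : Fin R × (Fin n₁ ⊕ (Fin n₂ ⊕ Fin n₃)) → ℝ,
      (sampleMatrix (fun l i => w (l, Sum.inl i)) (fun l j => w (l, Sum.inr (Sum.inl j))) f).det ≠ 0
  swap
  · exact .of_forall fun w h => absurd ⟨w, h⟩ hf
  obtain ⟨w, ⟨hdet, h0⟩, h1, h01⟩ := Generically.exists_point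
    (((IsPoly.generically (.det (isPoly_sampleMatrix f)) hf).and
      (generic_corner (n₃ := n₃) i₀ j₀)).and
      ((generic_corner (n₃ := n₃) i₀ j₁).and (generic_pair_minors i₀ hj)))
  set a : Fin R → Fin n₁ → ℝ := fun l i => w (l, Sum.inl i)
  set b : Fin R → Fin n₂ → ℝ := fun l j => w (l, Sum.inr (Sum.inl j))
  set c : Fin R → Fin n₃ → ℝ :=
    fun m k => if h : (k : ℕ) < R then sampleMatrix a b f m ⟨k, h⟩ else 0
  have e := sampleCoef_self hR a b f i₀
  refine Generically.mono ((Generically.forall_fintype fun l => IsPoly.generically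
      (isPoly_sampleCoef hR f i₀ j₀ l) ⟨toVector a b c, ?_⟩).and
    ((Generically.forall_fintype fun l => IsPoly.generically
      (isPoly_sampleCoef hR f i₀ j₁ l) ⟨toVector a b c, ?_⟩).and
    (Generically.forall_fintype fun l => Generically.forall_fintype fun k =>
      Generically.of_imp (p := l ≠ k) fun hlk => IsPoly.generically
      (.sub (.mul (isPoly_sampleCoef hR f i₀ j₀ l) (isPoly_sampleCoef hR f i₀ j₁ k))
        (.mul (isPoly_sampleCoef hR f i₀ j₀ k) (isPoly_sampleCoef hR f i₀ j₁ l)))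
      ⟨toVector a b c, ?_⟩))) fun w hw _ => hw
  · exact (e j₀ l).trans_ne (mul_ne_zero (h0 l) hdet)
  · exact (e j₁ l).trans_ne (mul_ne_zero (h1 l) hdet)
  · change sampleCoef hR a b c f i₀ j₀ l * sampleCoef hR a b c f i₀ j₁ k -
      sampleCoef hR a b c f i₀ j₀ k * sampleCoef hR a b c f i₀ j₁ l ≠ 0
    rw [e, e, e, e]
    have := mul_ne_zero (h01 l k hlk) (pow_ne_zero 2 hdet)
    intro h
    exact this (by rw [← h]; ring)

theorem generic_good (hn₂ : 2 ≤ n₂) (hR : R ≤ n₃) (hR' : R ≤ (n₁ - 1) * (n₂ / 2)) (i₀ : Fin n₁)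
    {j₀ j₁ : Fin n₂} (hj : j₀ ≠ j₁) : GenericComponents n₁ n₂ n₃ R (Good hR i₀ j₀ j₁) := by
  have hr : 0 < n₂ / 2 := by omega
  have h2r : 2 * (n₂ / 2) ≤ n₂ := by omega
  exact ((((generic_indep (n₃ := n₃) hr h2r hR').and (generic_core (n₃ := n₃) hr h2r hR')).and
    (generic_slices hR)).and ((generic_corner i₀ j₀).and (generic_coef hR i₀ hj))).mono
    fun w ⟨⟨⟨h1, h2⟩, h3⟩, h4, h5⟩ => ⟨h1, h2, h3, h4, h5⟩

/-- Rounding is harmless, as `⌊n₂ / 2⌋ ≥ (n₂ - 2) / 2`. -/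
theorem le_of_le_min (hn₁ : 2 ≤ n₁)
    (h : (R : ℝ) ≤ min ((1 / 2 : ℝ) * ((n₁ : ℝ) - 1) * ((n₂ : ℝ) - 2)) (n₃ : ℝ)) :
    R ≤ n₃ ∧ R ≤ (n₁ - 1) * (n₂ / 2) := by
  refine ⟨by exact_mod_cast h.trans (min_le_right _ _), ?_⟩
  have h1 := h.trans (min_le_left _ _)
  have h2 : ((n₁ - 1 : ℕ) : ℝ) = (n₁ : ℝ) - 1 := by
    rw [Nat.cast_sub (by omega), Nat.cast_one]
  have h3 : (n₂ : ℝ) - 2 ≤ 2 * ((n₂ / 2 : ℕ) : ℝ) := by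
    have : n₂ ≤ 2 * (n₂ / 2) + 2 := by omega
    have : (n₂ : ℝ) ≤ 2 * ((n₂ / 2 : ℕ) : ℝ) + 2 := by exact_mod_cast this
    linarith
  have h4 : (0 : ℝ) ≤ ((n₁ - 1 : ℕ) : ℝ) := Nat.cast_nonneg _
  have h5 : (R : ℝ) ≤ ((n₁ - 1 : ℕ) : ℝ) * ((n₂ / 2 : ℕ) : ℝ) := by
    rw [← h2] at h1
    nlinarith
  exact_mod_cast h5

end GenericGood

end JLV

namespace JLV

open Matrix

/-! ### Simultaneously diagonal matrices -/

/-- A symmetric matrix with columns in the column span of `X`. -/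
theorem eq_of_symm_of_mul_eq {ι κ : Type} [Fintype ι] [Fintype κ] {X : Matrix ι κ ℝ}
    {L : Matrix κ ι ℝ}
    {Q : Matrix ι ι ℝ} (hQ : Qᵀ = Q) (hXQ : X * L * Q = Q) :
    Q = X * (L * Q * Lᵀ) * Xᵀ := by
  have e : Q = Q * (X * L)ᵀ := by
    rw [← transpose_inj, transpose_mul, transpose_transpose, hQ, hXQ]
  calc Q = X * L * (Q * (X * L)ᵀ) := by rw [← e, hXQ]
    _ = _ := by rw [transpose_mul]; simp only [Matrix.mul_assoc]

theorem mul_diagonal_mul_apply {ι κ : Type} [Fintype κ] [DecidableEq κ]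
    (X : Matrix ι κ ℝ) (L : Matrix κ ι ℝ) (e : κ → ℝ) (p q : ι) :
    (X * diagonal e * L) p q = ∑ l, X p l * e l * L l q := by
  simp only [Matrix.mul_apply (N := L), mul_diagonal]

section Diagonal

variable {ι κ : Type} [Fintype ι] [Fintype κ] [DecidableEq κ]

theorem IsPseudoInverse.unique {A S S' : Matrix ι ι ℝ} (h : IsPseudoInverse A S)
    (h' : IsPseudoInverse A S') : S = S' := by
  have e1 : A * S = A * S' := by
    have : A * S * (A * S') = A * S' := by rw [← Matrix.mul_assoc, h.mul_mul_left]
    rw [← h'.symm_left, ← this, transpose_mul, h.symm_left, h'.symm_left, ← Matrix.mul_assoc,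
      h'.mul_mul_left]
  have e2 : S * A = S' * A := by
    have : S' * A * (S * A) = S' * A := by
      rw [Matrix.mul_assoc, ← Matrix.mul_assoc A, h.mul_mul_left]
    rw [← h'.symm_right, ← this, transpose_mul, h.symm_right, h'.symm_right, Matrix.mul_assoc,
      ← Matrix.mul_assoc A, h'.mul_mul_left]
  rw [← h.mul_mul_right, e2, Matrix.mul_assoc, e1, ← Matrix.mul_assoc, h'.mul_mul_right]

/-- `L` is the orthogonal left inverse of the matrix `X` with independent columns: `X * L` is the
orthogonal projection onto the column span. -/
structure IsOrthLeftInverse (X : Matrix ι κ ℝ) (L : Matrix κ ι ℝ) : Prop where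
  mul_eq_one : L * X = 1
  symm : (X * L)ᵀ = X * L

namespace IsOrthLeftInverse

variable {X : Matrix ι κ ℝ} {L : Matrix κ ι ℝ}

theorem exists_of_injective (h : ∀ v, X *ᵥ v = 0 → v = 0) : ∃ L, IsOrthLeftInverse X L := by
  have hdet : IsUnit (Xᵀ * X).det := by
    rw [isUnit_iff_ne_zero]
    intro h0
    obtain ⟨v, hv, hv'⟩ := exists_mulVec_eq_zero_iff.2 h0
    refine hv (h v (dotProduct_self_eq_zero.1 ?_))
    rw [dotProduct_mulVec, ← mulVec_transpose, mulVec_mulVec, hv', zero_dotProduct]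
  refine ⟨(Xᵀ * X)⁻¹ * Xᵀ, ?_, ?_⟩
  · rw [Matrix.mul_assoc, nonsing_inv_mul _ hdet]
  · rw [transpose_mul, transpose_mul, transpose_transpose, transpose_nonsing_inv, transpose_mul,
      transpose_transpose, Matrix.mul_assoc]

variable (h : IsOrthLeftInverse X L)
include h

theorem transpose_mul_eq_one : Xᵀ * Lᵀ = 1 := by
  rw [← transpose_mul, h.mul_eq_one, transpose_one]

theorem mul_diag_mul (d e : κ → ℝ) :
    X * diagonal d * Xᵀ * (Lᵀ * diagonal e * L) = X * diagonal (d * e) * L := by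
  have : X * diagonal d * Xᵀ * (Lᵀ * diagonal e * L) =
      X * diagonal d * (Xᵀ * Lᵀ) * diagonal e * L := by simp only [Matrix.mul_assoc]
  rw [this, h.transpose_mul_eq_one, Matrix.mul_one, Matrix.mul_assoc X, diagonal_mul_diagonal']
  rfl

theorem transpose_diag_mul (d e : κ → ℝ) :
    (Lᵀ * diagonal d * L * (X * diagonal e * Xᵀ))ᵀ = X * diagonal (e * d) * L := by
  rw [← h.mul_diag_mul, transpose_mul]
  simp only [transpose_mul, transpose_transpose, diagonal_transpose, Matrix.mul_assoc]

theorem isPseudoInverse {d : κ → ℝ} (hd : ∀ l, d l ≠ 0) :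
    IsPseudoInverse (X * diagonal d * Xᵀ) (Lᵀ * diagonal d⁻¹ * L) := by
  have e1 : d * d⁻¹ = 1 := funext fun l => mul_inv_cancel₀ (hd l)
  have e2 : X * diagonal d * Xᵀ * (Lᵀ * diagonal d⁻¹ * L) = X * L := by
    rw [h.mul_diag_mul, e1]
    simp
  have e3 : Lᵀ * diagonal d⁻¹ * L * (X * diagonal d * Xᵀ) = X * L := by
    rw [← transpose_inj, h.transpose_diag_mul, e1, h.symm]
    simp
  refine ⟨?_, ?_, ?_, ?_⟩
  · rw [e2]
    have : X * L * (X * diagonal d * Xᵀ) = X * (L * X) * diagonal d * Xᵀ := by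
      simp only [Matrix.mul_assoc]
    rw [this, h.mul_eq_one, Matrix.mul_one]
  · rw [e3, ← h.symm, transpose_mul]
    have : Lᵀ * Xᵀ * (Lᵀ * diagonal d⁻¹ * L) = Lᵀ * (Xᵀ * Lᵀ) * diagonal d⁻¹ * L := by
      simp only [Matrix.mul_assoc]
    rw [this, h.transpose_mul_eq_one, Matrix.mul_one]
  · rw [e2, h.symm]
  · rw [e3, h.symm]

theorem injective_diag {d e : κ → ℝ} (hde : X * diagonal d * Xᵀ = X * diagonal e * Xᵀ) : d = e := by
  have : ∀ d : κ → ℝ, L * (X * diagonal d * Xᵀ) * Lᵀ = diagonal d := by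
    intro d
    have : L * (X * diagonal d * Xᵀ) * Lᵀ = L * X * diagonal d * (Xᵀ * Lᵀ) := by
      simp only [Matrix.mul_assoc]
    rw [this, h.mul_eq_one, h.transpose_mul_eq_one, Matrix.one_mul, Matrix.mul_one]
  exact diagonal_injective (by rw [← this d, hde, this e])

theorem mulVec_injective {v w : κ → ℝ} (hvw : X *ᵥ v = X *ᵥ w) : v = w := by
  rw [← one_mulVec v, ← one_mulVec w, ← h.mul_eq_one, ← mulVec_mulVec, hvw, mulVec_mulVec]

theorem pow_diag (δ : κ → ℝ) [DecidableEq ι] (k : ℕ) :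
    (X * diagonal δ * L) ^ (k + 1) = X * diagonal (δ ^ (k + 1)) * L := by
  induction k with
  | zero => simp
  | succ k ih =>
    have : X * diagonal (δ ^ (k + 1)) * L * (X * diagonal δ * L) =
        X * diagonal (δ ^ (k + 1)) * (L * X) * diagonal δ * L := by simp only [Matrix.mul_assoc]
    rw [pow_succ, ih, this, h.mul_eq_one, Matrix.mul_one, Matrix.mul_assoc X,
      diagonal_mul_diagonal']
    rfl

theorem eq_zero_of_mul_diag_eq_zero {e : κ → ℝ} (he : X * diagonal e * L = 0) : e = 0 := by
  have : L * (X * diagonal e * L) * X = L * X * diagonal e * (L * X) := by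
    simp only [Matrix.mul_assoc]
  rw [he, h.mul_eq_one, Matrix.mul_zero, Matrix.zero_mul, Matrix.one_mul, Matrix.mul_one] at this
  exact diagonal_injective (by rw [← this, Pi.zero_def, diagonal_zero])

theorem mulVec_col (δ : κ → ℝ) (l : κ) : (X * diagonal δ * L) *ᵥ X.col l = δ l • X.col l := by
  have : (X * diagonal δ * L) *ᵥ X.col l = X *ᵥ (diagonal δ *ᵥ ((L * X) *ᵥ Pi.single l 1)) := by
    rw [← mulVec_single_one X l]
    simp only [mulVec_mulVec, Matrix.mul_assoc]
  rw [this, h.mul_eq_one, one_mulVec]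
  ext p
  simp [mulVec, dotProduct, diagonal_apply, Pi.single_apply, mul_comm]

/-- An eigenvector for a nonzero eigenvalue is `X w` with an eigenvector `w` of `diagonal δ`. -/
theorem exists_of_eigenvector {δ : κ → ℝ} {ν : ℝ} {v : ι → ℝ} (hν : ν ≠ 0) (hv : v ≠ 0)
    (hM : (X * diagonal δ * L) *ᵥ v = ν • v) :
    ∃ w : κ → ℝ, w ≠ 0 ∧ v = X *ᵥ w ∧ ∀ l, δ l * w l = ν * w l := by
  have e1 : X *ᵥ (diagonal δ *ᵥ (L *ᵥ v)) = ν • v := by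
    rw [← hM]
    simp only [mulVec_mulVec, Matrix.mul_assoc]
  have e2 : diagonal δ *ᵥ (L *ᵥ v) = ν • L *ᵥ v := by
    rw [← mulVec_smul, ← e1, mulVec_mulVec _ L X, h.mul_eq_one, one_mulVec]
  have e3 : v = X *ᵥ (L *ᵥ v) := by
    rw [e2, mulVec_smul] at e1
    exact (smul_right_injective _ hν e1).symm
  refine ⟨L *ᵥ v, fun h0 => hv (by rw [e3, h0, mulVec_zero]), e3, fun l => ?_⟩
  have := congrFun e2 l
  rwa [mulVec_diagonal] at this

theorem exists_eigenvalue {δ : κ → ℝ} {ν : ℝ} {v : ι → ℝ} (hν : ν ≠ 0) (hv : v ≠ 0)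
    (hM : (X * diagonal δ * L) *ᵥ v = ν • v) : ∃ l, δ l = ν := by
  obtain ⟨w, hw, -, h2⟩ := h.exists_of_eigenvector hν hv hM
  obtain ⟨l, hl⟩ := Function.ne_iff.1 hw
  exact ⟨l, mul_right_cancel₀ hl (h2 l)⟩

theorem exists_eq_smul {δ : κ → ℝ} (hδ : Function.Injective δ) {l : κ} {v : ι → ℝ}
    (hl : δ l ≠ 0) (hv : v ≠ 0) (hM : (X * diagonal δ * L) *ᵥ v = δ l • v) :
    ∃ t : ℝ, t ≠ 0 ∧ v = t • X.col l := by
  obtain ⟨w, hw, h1, h2⟩ := h.exists_of_eigenvector hl hv hM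
  have h3 : ∀ k, k ≠ l → w k = 0 := fun k hk => by
    by_contra h0
    exact hk (hδ (mul_right_cancel₀ h0 (h2 k)))
  have h4 : w = w l • Pi.single l 1 := by
    ext k
    by_cases hk : k = l
    · rw [hk]; simp
    · simp [h3 k hk, hk]
  refine ⟨w l, fun h0 => hw (by rw [h4, h0, zero_smul]), ?_⟩
  rw [h1, h4, mulVec_smul, mulVec_single_one]
  simp

theorem isNonzeroEigensystem {s : ℕ} {δ : κ → ℝ} (hδ : Function.Injective δ) (hδ₀ : ∀ l, δ l ≠ 0)
    (π : Fin s ≃ κ) {w : Fin s → ι → ℝ} (hw : ∀ j, ∃ t : ℝ, t ≠ 0 ∧ w j = t • X.col (π j)) :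
    IsNonzeroEigensystem (X * diagonal δ * L) (fun j => δ (π j)) w where
  eigenvalue_ne_zero j := hδ₀ _
  injective := hδ.comp π.injective
  eigenvector_ne_zero j h0 := by
    obtain ⟨t, ht, hj⟩ := hw j
    have h1 : X.col (π j) = 0 := (smul_eq_zero.1 (hj.symm.trans h0)).resolve_left ht
    have h2 : Pi.single (π j) (1 : ℝ) = (0 : κ → ℝ) := h.mulVec_injective (by
      rw [mulVec_single_one, h1, mulVec_zero])
    simpa using congrFun h2 (π j)
  mulVec_eq j := by
    obtain ⟨t, -, hj⟩ := hw j
    rw [hj, mulVec_smul, h.mulVec_col, smul_comm]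
  complete ν v hν hv hM := by
    obtain ⟨l, hl⟩ := h.exists_eigenvalue hν hv hM
    exact ⟨π.symm l, by simpa using hl⟩

end IsOrthLeftInverse

theorem IsNonzeroEigensystem.le_rank {s : ℕ} {M : Matrix ι ι ℝ} {μ : Fin s → ℝ}
    {w : Fin s → ι → ℝ} (h : IsNonzeroEigensystem M μ w) : s ≤ M.rank := by
  classical
  have h1 : LinearIndependent ℝ w :=
    Module.End.eigenvectors_linearIndependent' M.mulVecLin μ h.injective w fun j =>
      Module.End.hasEigenvector_iff.2 ⟨Module.End.mem_eigenspace_iff.2 (h.mulVec_eq j),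
        h.eigenvector_ne_zero j⟩
  have h2 : ∀ j, w j ∈ LinearMap.range M.mulVecLin := fun j =>
    ⟨(μ j)⁻¹ • w j, by
      rw [map_smul, mulVecLin_apply, h.mulVec_eq, smul_smul,
        inv_mul_cancel₀ (h.eigenvalue_ne_zero j), one_smul]⟩
  have h3 : LinearIndependent ℝ fun j => (⟨w j, h2 j⟩ : LinearMap.range M.mulVecLin) :=
    LinearIndependent.of_comp (LinearMap.range M.mulVecLin).subtype h1
  simpa [Matrix.rank] using h3.fintype_card_le_finrank

theorem ne_zero_of_le_rank [DecidableEq ι] {X : Matrix ι κ ℝ} {d : κ → ℝ}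
    (h : Fintype.card κ ≤ (X * diagonal d * Xᵀ).rank) (l : κ) : d l ≠ 0 := by
  have h1 : Fintype.card κ ≤ Fintype.card {i // d i ≠ 0} := by
    rw [← rank_diagonal]
    exact h.trans ((rank_mul_le_left _ _).trans (rank_mul_le_right _ _))
  intro h0
  exact absurd h1 (not_le.2 (Fintype.card_subtype_lt (x := l) (by simpa using h0)))

end Diagonal

end JLV

namespace JLV

open Matrix

/-! ### The space of symmetric tensors cut out by the minors -/

section Minors

variable {n₁ n₂ n₃ R : ℕ}

/-- The matrix with columns `aˡ ⊗ bˡ`. -/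
def factorMatrix (a : Fin R → Fin n₁ → ℝ) (b : Fin R → Fin n₂ → ℝ) :
    Matrix (Fin n₁ × Fin n₂) (Fin R) ℝ :=
  Matrix.of fun p l => a l p.1 * b l p.2

theorem mem_minorsPerp_iff {Q : Mat2 n₁ n₂} (hQ : Qᵀ = Q) :
    Q ∈ minorsPerp n₁ n₂ ↔ ∀ A B C D, Q (A, B) (C, D) = Q (A, D) (C, B) := by
  have hs : ∀ p q, Q p q = Q q p := fun p q => (congrFun (congrFun hQ q) p)
  have h1 : ∀ p q : Fin n₁ × Fin n₂,
      pairing (vee (Pi.single p 1) (Pi.single q 1)) Q = Q p q := by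
    intro p q
    simp only [pairing, vee, LinearMap.coe_mk, AddHom.coe_mk, Matrix.add_apply, Matrix.smul_apply,
      vecMulVec_apply, Pi.single_apply, smul_eq_mul, mul_add, Finset.sum_add_distrib, mul_ite,
      mul_one, mul_zero,
      Finset.sum_ite_eq', Finset.mem_univ, if_true]
    rw [hs q p]
    ring
  have h2 : ∀ A B C D, pairing (minorTensor A B C D) Q =
      Q (A, B) (C, D) - Q (A, D) (C, B) := by
    intro A B C D
    rw [← h1 (A, B), ← h1 (A, D)]
    simp only [pairing, minorTensor, LinearMap.coe_mk, AddHom.coe_mk, Matrix.sub_apply, mul_sub,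
      Finset.sum_sub_distrib]
  simp only [minorsPerp, Submodule.mem_iInf, LinearMap.mem_ker, h2, sub_eq_zero]
  refine ⟨fun h A B C D => ?_, fun h A B C D _ _ => h A B C D⟩
  rcases lt_trichotomy A C with hAC | rfl | hAC
  · rcases lt_trichotomy B D with hBD | rfl | hBD
    · exact h A B C D hAC hBD
    · rfl
    · exact (h A D C B hAC hBD).symm
  · exact hs _ _
  · rw [hs (A, B), hs (A, D)]
    rcases lt_trichotomy B D with hBD | rfl | hBD
    · exact (h C B A D hAC hBD).symm
    · rfl
    · exact h C D A B hAC hBD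

theorem mem_symSquare_columns {X : Matrix (Fin n₁ × Fin n₂) (Fin R) ℝ} {Q : Mat2 n₁ n₂}
    (hQ : Q ∈ symSquare (Submodule.span ℝ (Set.range X.col))) :
    ∃ S : Matrix (Fin R) (Fin R) ℝ, Sᵀ = S ∧ Q = X * S * Xᵀ := by
  rw [symSquare] at hQ
  induction hQ using Submodule.span_induction with
  | mem Q h =>
    obtain ⟨u, hu, v, hv, rfl⟩ := h
    rw [← range_mulVecLin] at hu hv
    obtain ⟨f, rfl⟩ := hu
    obtain ⟨g, rfl⟩ := hv
    refine ⟨(1 / 2 : ℝ) • vecMulVec f g + (1 / 2 : ℝ) • vecMulVec g f, ?_, ?_⟩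
    · rw [transpose_add, transpose_smul, transpose_smul, transpose_vecMulVec, transpose_vecMulVec,
        add_comm]
    · simp only [vee, Matrix.mul_add, Matrix.add_mul, Matrix.mul_smul, Matrix.smul_mul,
        mul_vecMulVec, vecMulVec_mul, vecMul_transpose, mulVecLin_apply]
  | zero => exact ⟨0, by simp⟩
  | add Q Q' _ _ h h' =>
    obtain ⟨S, hS, rfl⟩ := h
    obtain ⟨S', hS', rfl⟩ := h'
    exact ⟨S + S', by rw [transpose_add, hS, hS'], by rw [Matrix.mul_add, Matrix.add_mul]⟩
  | smul t Q _ h =>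
    obtain ⟨S, hS, rfl⟩ := h
    exact ⟨t • S, by rw [transpose_smul, hS], by rw [Matrix.mul_smul, Matrix.smul_mul]⟩

theorem mul_diagonal_mul_transpose (X : Matrix (Fin n₁ × Fin n₂) (Fin R) ℝ) (d : Fin R → ℝ) :
    X * diagonal d * Xᵀ = ∑ l, d l • vecMulVec (X.col l) (X.col l) := by
  ext p q
  simp only [Matrix.sum_apply, Matrix.smul_apply, vecMulVec_apply, smul_eq_mul,
    Matrix.mul_apply (N := Xᵀ), mul_diagonal, transpose_apply, col_apply]
  exact Finset.sum_congr rfl fun _ _ => by ring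

theorem diag_mem_symSquare (X : Matrix (Fin n₁ × Fin n₂) (Fin R) ℝ) (d : Fin R → ℝ) :
    X * diagonal d * Xᵀ ∈ symSquare (Submodule.span ℝ (Set.range X.col)) := by
  rw [mul_diagonal_mul_transpose]
  refine Submodule.sum_mem _ fun l _ => Submodule.smul_mem _ _ (Submodule.subset_span
    ⟨X.col l, Submodule.subset_span ⟨l, rfl⟩, X.col l, Submodule.subset_span ⟨l, rfl⟩, ?_⟩)
  rw [vee, ← add_smul]
  norm_num

theorem diag_apply (a : Fin R → Fin n₁ → ℝ) (b : Fin R → Fin n₂ → ℝ) (d : Fin R → ℝ)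
    (p q : Fin n₁ × Fin n₂) :
    (factorMatrix a b * diagonal d * (factorMatrix a b)ᵀ) p q =
      ∑ l, d l * (a l p.1 * b l p.2 * (a l q.1 * b l q.2)) := by
  rw [mul_diagonal_mul_transpose]
  simp [Matrix.sum_apply, vecMulVec_apply, factorMatrix]

theorem transpose_diag (X : Matrix (Fin n₁ × Fin n₂) (Fin R) ℝ) (d : Fin R → ℝ) :
    (X * diagonal d * Xᵀ)ᵀ = X * diagonal d * Xᵀ := by
  simp [Matrix.mul_assoc]

theorem diag_mem_minorsPerp (a : Fin R → Fin n₁ → ℝ) (b : Fin R → Fin n₂ → ℝ) (d : Fin R → ℝ) :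
    factorMatrix a b * diagonal d * (factorMatrix a b)ᵀ ∈ minorsPerp n₁ n₂ := by
  rw [mem_minorsPerp_iff (transpose_diag _ _)]
  intro A B C D
  rw [diag_apply, diag_apply]
  exact Finset.sum_congr rfl fun l _ => by ring

namespace Good

variable {hR : R ≤ n₃} {i₀ : Fin n₁} {j₀ j₁ : Fin n₂} {a : Fin R → Fin n₁ → ℝ}
  {b : Fin R → Fin n₂ → ℝ} {c : Fin R → Fin n₃ → ℝ} (h : Good hR i₀ j₀ j₁ a b c)
include h

theorem exists_orthLeftInverse : ∃ L, IsOrthLeftInverse (factorMatrix a b) L :=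
  IsOrthLeftInverse.exists_of_injective fun v hv => h.indep v fun t => by
    refine Eq.trans ?_ (congrFun hv t)
    exact Finset.sum_congr rfl fun l _ => mul_comm _ _

/-- A symmetric combination of the `xˡ ⊗ xᵏ` that satisfies the minor equations is diagonal. -/
theorem isDiag {S : Matrix (Fin R) (Fin R) ℝ} (hS : Sᵀ = S)
    (hperp : factorMatrix a b * S * (factorMatrix a b)ᵀ ∈ minorsPerp n₁ n₂) :
    S = diagonal fun l => S l l := by
  have hsymm : ∀ l k, S l k = S k l := fun l k => congrFun (congrFun hS k) l
  have happ : ∀ p q, (factorMatrix a b * S * (factorMatrix a b)ᵀ) p q =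
      ∑ t : Fin R × Fin R, S t.1 t.2 * (a t.1 p.1 * b t.1 p.2 * (a t.2 q.1 * b t.2 q.2)) := by
    intro p q
    simp only [Matrix.mul_apply, factorMatrix, of_apply, transpose_apply, Finset.sum_mul]
    rw [Fintype.sum_prod_type, Finset.sum_comm]
    exact Finset.sum_congr rfl fun l _ => Finset.sum_congr rfl fun k _ => by ring
  rw [mem_minorsPerp_iff (by
    rw [transpose_mul, transpose_mul, transpose_transpose, hS, Matrix.mul_assoc])] at hperp
  have h0 := h.core (fun t => if t.1 = t.2 then 0 else S t.1 t.2)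
    (fun l k => by simp only [eq_comm (a := k), hsymm k l]) (fun l => by simp) (fun A C B D => by
      have h1 := sub_eq_zero.2 (hperp A B C D)
      rw [happ, happ, ← Finset.sum_sub_distrib] at h1
      rw [← h1]
      refine Finset.sum_congr rfl fun t _ => ?_
      split
      · next h2 => rw [h2]; ring
      · ring)
  ext l k
  by_cases hlk : l = k
  · simp [hlk]
  · simpa [hlk] using congrFun h0 (l, k)

theorem col_mem_span_slices (l : Fin R) : (factorMatrix a b).col l ∈ Submodule.span ℝ (Set.range
    fun (k : Fin R) (p : Fin n₁ × Fin n₂) => cpTensor a b c p.1 p.2 (Fin.castLE hR k)) := by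
  set M : Matrix (Fin R) (Fin R) ℝ := Matrix.of fun l k => c l (Fin.castLE hR k) with hM
  have hMM : M * M⁻¹ = 1 := mul_nonsing_inv _ (isUnit_iff_ne_zero.2 h.slices)
  have : (factorMatrix a b).col l = ∑ k, M⁻¹ k l •
      fun p : Fin n₁ × Fin n₂ => cpTensor a b c p.1 p.2 (Fin.castLE hR k) := by
    ext p
    simp only [Finset.sum_apply, Pi.smul_apply, smul_eq_mul, cpTensor, Finset.mul_sum]
    rw [Finset.sum_comm]
    have h1 : ∀ m, ∑ k, M⁻¹ k l * (a m p.1 * b m p.2 * c m (Fin.castLE hR k)) =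
        a m p.1 * b m p.2 * (M * M⁻¹) m l := by
      intro m
      rw [Matrix.mul_apply, Finset.mul_sum]
      exact Finset.sum_congr rfl fun k _ => by simp only [hM, of_apply]; ring
    rw [Finset.sum_congr rfl fun m _ => h1 m, hMM]
    simp [Matrix.one_apply, factorMatrix]
  rw [this]
  exact Submodule.sum_mem _ fun k _ => Submodule.smul_mem _ _ (Submodule.subset_span ⟨k, rfl⟩)

theorem span_slices : Submodule.span ℝ (Set.range
    fun (k : Fin R) (p : Fin n₁ × Fin n₂) => cpTensor a b c p.1 p.2 (Fin.castLE hR k)) =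
      Submodule.span ℝ (Set.range (factorMatrix a b).col) := by
  refine le_antisymm (Submodule.span_le.2 ?_) (Submodule.span_le.2 ?_)
  · rintro _ ⟨k, rfl⟩
    rw [← range_mulVecLin]
    refine ⟨fun l => c l (Fin.castLE hR k), ?_⟩
    ext p
    simp [mulVec, dotProduct, factorMatrix, cpTensor]
  · rintro _ ⟨l, rfl⟩
    exact h.col_mem_span_slices l

theorem colSpan_eq :
    colSpan (cpTensor a b c) = Submodule.span ℝ (Set.range (factorMatrix a b).col) := by
  refine le_antisymm (Submodule.span_le.2 ?_) ?_
  · rintro _ ⟨k, rfl⟩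
    rw [← range_mulVecLin]
    refine ⟨fun l => c l k, ?_⟩
    ext p
    simp [mulVec, dotProduct, factorMatrix, cpTensor]
  · rw [← h.span_slices]
    refine Submodule.span_mono ?_
    rintro _ ⟨k, rfl⟩
    exact ⟨_, rfl⟩

theorem isBasisOf_slices : IsBasisOf
    (fun (k : Fin R) (p : Fin n₁ × Fin n₂) => cpTensor a b c p.1 p.2 (Fin.castLE hR k))
    (colSpan (cpTensor a b c)) := by
  refine ⟨?_, by rw [h.colSpan_eq, h.span_slices]⟩
  obtain ⟨L, hL⟩ := h.exists_orthLeftInverse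
  have h1 : LinearIndependent ℝ (factorMatrix a b).col :=
    mulVec_injective_iff.1 fun v w hvw => hL.mulVec_injective hvw
  rw [linearIndependent_iff_card_eq_finrank_span, Set.finrank, h.span_slices]
  exact linearIndependent_iff_card_eq_finrank_span.1 h1

/-- The intersection of `S²(U)` and the orthogonal complement of the minors is the span of the
`xˡ ⊗ xˡ`. -/
theorem mem_inter_iff {Q : Mat2 n₁ n₂} :
    Q ∈ symSquare (colSpan (cpTensor a b c)) ⊓ minorsPerp n₁ n₂ ↔
      ∃ d : Fin R → ℝ, Q = factorMatrix a b * diagonal d * (factorMatrix a b)ᵀ := by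
  rw [Submodule.mem_inf, h.colSpan_eq]
  constructor
  · rintro ⟨h1, h2⟩
    obtain ⟨S, hS, rfl⟩ := mem_symSquare_columns h1
    exact ⟨fun l => S l l, by rw [← h.isDiag hS h2]⟩
  · rintro ⟨d, rfl⟩
    exact ⟨diag_mem_symSquare _ _, diag_mem_minorsPerp _ _ _⟩

theorem basis_inter {s : ℕ} {P : Fin s → Mat2 n₁ n₂}
    (hP : IsBasisOf P (symSquare (colSpan (cpTensor a b c)) ⊓ minorsPerp n₁ n₂)) : s = R ∧
    ∃ Z : Fin s → Fin R → ℝ, LinearIndependent ℝ Z ∧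
      ∀ i, P i = factorMatrix a b * diagonal (Z i) * (factorMatrix a b)ᵀ := by
  obtain ⟨L, hL⟩ := h.exists_orthLeftInverse
  let D : (Fin R → ℝ) →ₗ[ℝ] Mat2 n₁ n₂ :=
    { toFun := fun d => factorMatrix a b * diagonal d * (factorMatrix a b)ᵀ
      map_add' := fun d e => by
        rw [← Matrix.add_mul, ← Matrix.mul_add, diagonal_add]
        rfl
      map_smul' := fun t d => by
        rw [diagonal_smul, Matrix.mul_smul, Matrix.smul_mul, RingHom.id_apply] }
  have hD : Function.Injective D := fun d e hde => hL.injective_diag hde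
  have hrange : Submodule.span ℝ (Set.range P) = LinearMap.range D := by
    rw [hP.2]
    ext Q
    rw [h.mem_inter_iff]
    exact ⟨fun ⟨d, hd⟩ => ⟨d, hd.symm⟩, fun ⟨d, hd⟩ => ⟨d, hd.symm⟩⟩
  have hmem : ∀ i, ∃ d, D d = P i := fun i => by
    have : P i ∈ Submodule.span ℝ (Set.range P) := Submodule.subset_span ⟨i, rfl⟩
    rwa [hrange] at this
  choose Z hZ using hmem
  refine ⟨?_, Z, LinearIndependent.of_comp D ?_, fun i => (hZ i).symm⟩
  · have h1 := finrank_span_eq_card hP.1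
    rw [hrange, LinearMap.finrank_range_of_inj hD] at h1
    simpa using h1.symm
  · have : D ∘ Z = P := funext hZ
    rw [this]
    exact hP.1

end Good

end Minors

end JLV

namespace JLV

open Matrix

/-! ### Runs of the algorithm -/

section Runs

variable {n₁ n₂ n₃ R : ℕ}

theorem sum_smul_diag (X : Matrix (Fin n₁ × Fin n₂) (Fin R) ℝ) {s : ℕ} (α : Fin s → ℝ)
    {P : Fin s → Mat2 n₁ n₂} {Z : Fin s → Fin R → ℝ} (hZ : ∀ i, P i = X * diagonal (Z i) * Xᵀ) :
    ∑ i, α i • P i = X * diagonal (fun l => ∑ i, α i * Z i l) * Xᵀ := by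
  have : diagonal (fun l => ∑ i, α i * Z i l) = ∑ i, α i • diagonal (Z i) := by
    ext l k
    by_cases hlk : l = k <;> simp [Matrix.sum_apply, hlk]
  rw [this, Matrix.mul_sum, Matrix.sum_mul]
  exact Finset.sum_congr rfl fun i _ => by rw [hZ, Matrix.mul_smul, Matrix.smul_mul]

/-- Two factorizations of a rank-1 matrix. -/
theorem exists_scalars_of_factor {m n : ℕ} {a a' : Fin m → ℝ} {b b' : Fin n → ℝ} {t : ℝ}
    (ht : t ≠ 0)
    {i₀ : Fin m} {j₀ : Fin n} (h₀ : a i₀ * b j₀ ≠ 0) (h : ∀ i j, a' i * b' j = t * (a i * b j)) :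
    ∃ κ ν : ℝ, κ ≠ 0 ∧ ν ≠ 0 ∧ a' = κ • a ∧ b' = ν • b ∧ κ * ν = t := by
  have h1 : a' i₀ * b' j₀ ≠ 0 := by
    rw [h]
    exact mul_ne_zero ht h₀
  have ha := left_ne_zero_of_mul h₀
  have hb := right_ne_zero_of_mul h₀
  have ha' := left_ne_zero_of_mul h1
  have hb' := right_ne_zero_of_mul h1
  refine ⟨t * b j₀ / b' j₀, t * a i₀ / a' i₀, by positivity, by positivity, funext fun i => ?_,
    funext fun j => ?_, ?_⟩
  · rw [Pi.smul_apply, smul_eq_mul, div_mul_eq_mul_div, eq_div_iff hb', h]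
    ring
  · rw [Pi.smul_apply, smul_eq_mul, div_mul_eq_mul_div, eq_div_iff ha', mul_comm, h]
    ring
  · rw [div_mul_div_comm, div_eq_iff (mul_ne_zero hb' ha'), mul_comm (b' j₀), h]
    ring

namespace Good

variable {hR : R ≤ n₃} {i₀ : Fin n₁} {j₀ j₁ : Fin n₂} {a : Fin R → Fin n₁ → ℝ}
  {b : Fin R → Fin n₂ → ℝ} {c : Fin R → Fin n₃ → ℝ} (h : Good hR i₀ j₀ j₁ a b c)
include h

/-- The `R` distinct eigenvalues force both contractions to have rank `R`, so all their coefficients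
are nonzero; the eigenvectors are then multiples of the `aˡ ⊗ bˡ`. -/
theorem recovers {r s : ℕ} {t : Transcript n₁ n₂ n₃ r s} (ht : IsRun (cpTensor a b c) t) :
    Recovers t a b c := by
  have hinter := ht.intersection
  rw [ht.basis.2] at hinter
  obtain ⟨hs, Z, -, hZ⟩ := h.basis_inter hinter
  obtain rfl : R = s := hs.symm
  obtain ⟨L, hL⟩ := h.exists_orthLeftInverse
  set X := factorMatrix a b with hX
  have hA : t.A = X * diagonal (fun l => ∑ i, t.α i * Z i l) * Xᵀ := sum_smul_diag X t.α hZ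
  have hB : t.B = X * diagonal (fun l => ∑ i, t.β i * Z i l) * Xᵀ := sum_smul_diag X t.β hZ
  set dα : Fin R → ℝ := fun l => ∑ i, t.α i * Z i l
  set dβ : Fin R → ℝ := fun l => ∑ i, t.β i * Z i l
  have hrank := ht.eigenX.le_rank
  have hα : ∀ l, dα l ≠ 0 := ne_zero_of_le_rank (X := X) (by
    rw [Fintype.card_fin, ← hA]
    exact hrank.trans (rank_mul_le_left _ _))
  have hβ : ∀ l, dβ l ≠ 0 := ne_zero_of_le_rank (X := X) (by
    rw [Fintype.card_fin, ← hB]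
    refine hrank.trans ((rank_mul_le_right _ _).trans ?_)
    rw [← ht.pinvB.mul_mul_right]
    exact (rank_mul_le_left _ _).trans (rank_mul_le_right _ _))
  have hBinv : t.Binv = Lᵀ * diagonal dβ⁻¹ * L := by
    refine ht.pinvB.unique ?_
    rw [hB]
    exact hL.isPseudoInverse hβ
  have heig := ht.eigenX
  rw [hA, hBinv, hL.mul_diag_mul] at heig
  set δ := dα * dβ⁻¹
  have hδ₀ : ∀ l, δ l ≠ 0 := fun l => mul_ne_zero (hα l) (inv_ne_zero (hβ l))
  choose f hf using fun j => hL.exists_eigenvalue (heig.eigenvalue_ne_zero j)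
    (heig.eigenvector_ne_zero j) (heig.mulVec_eq j)
  have hfinj : Function.Injective f := fun j j' hj => heig.injective (by rw [← hf, ← hf, hj])
  let π : Fin R ≃ Fin R := Equiv.ofBijective f (Finite.injective_iff_bijective.1 hfinj)
  have hδ : Function.Injective δ := by
    intro l k hlk
    obtain ⟨j, rfl⟩ := π.surjective l
    obtain ⟨j', rfl⟩ := π.surjective k
    have : t.μ j = t.μ j' := by rw [← hf, ← hf]; exact hlk
    rw [heig.injective this]
  have hx : ∀ j, ∃ τ : ℝ, τ ≠ 0 ∧ t.x j = τ • X.col (π j) := fun j =>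
    hL.exists_eq_smul hδ (hδ₀ _) (heig.eigenvector_ne_zero j) (by
      have : δ (π j) = t.μ j := hf j
      rw [this]
      exact heig.mulVec_eq j)
  choose τ hτ hx using hx
  have hc : ∀ j, t.c j = (τ j)⁻¹ • c (π j) := by
    intro j
    ext k
    have h1 := h.indep (fun l => τ (π.symm l) * t.c (π.symm l) k - c l k) (fun p => by
      have h2 := ht.solveC p.1 p.2 k
      rw [cpTensor, ← Equiv.sum_comp π.symm fun l => t.x l (p.1, p.2) * t.c l k] at h2
      refine Eq.trans ?_ (sub_eq_zero.2 h2.symm)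
      rw [← Finset.sum_sub_distrib, Finset.sum_congr rfl fun l _ => ?_]
      rw [hx]
      simp [hX, factorMatrix]
      ring)
    have h2 := congrFun h1 (π j)
    simp only [Equiv.symm_apply_apply, Pi.zero_apply] at h2
    rw [Pi.smul_apply, smul_eq_mul, eq_inv_mul_iff_mul_eq₀ (hτ j)]
    exact sub_eq_zero.1 h2
  refine ⟨π, fun l => ?_⟩
  obtain ⟨κ, ν, hκ, hν, ha, hb, hκν⟩ := exists_scalars_of_factor (hτ l) (h.corner (π l))
    (a' := t.a l) (b' := t.b l) fun i j => by
      rw [← ht.factor, hx]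
      simp [hX, factorMatrix]
  exact ⟨κ, ν, hκ, hν, ha, hb, by rw [hκν, hc]⟩

/-- A criterion for completed runs: the contractions have nonzero coefficients with distinct
ratios, and the eigenvectors are multiples of the `aˡ ⊗ bˡ`. -/
theorem isRun {r : ℕ} {t : Transcript n₁ n₂ n₃ r R} {Z : Fin R → Fin R → ℝ}
    (hu : IsBasisOf t.u (colSpan (cpTensor a b c)))
    (hP : IsBasisOf t.P (symSquare (colSpan (cpTensor a b c)) ⊓ minorsPerp n₁ n₂))
    (hZ : ∀ i, t.P i = factorMatrix a b * diagonal (Z i) * (factorMatrix a b)ᵀ)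
    (hα : ∀ l, ∑ i, t.α i * Z i l ≠ 0) (hβ : ∀ l, ∑ i, t.β i * Z i l ≠ 0)
    (hαβ : Function.Injective fun l => (∑ i, t.α i * Z i l) / ∑ i, t.β i * Z i l)
    (hAinv : IsPseudoInverse t.A t.Ainv) (hBinv : IsPseudoInverse t.B t.Binv)
    (π : Fin R ≃ Fin R)
    (hμ : ∀ j, t.μ j = (∑ i, t.α i * Z i (π j)) / ∑ i, t.β i * Z i (π j))
    (hx : ∀ j, ∃ τ : ℝ, τ ≠ 0 ∧ t.x j = τ • (factorMatrix a b).col (π j))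
    (hy : t.y = t.x)
    (hz : ∀ i, t.P i = ∑ j, t.z j i • vecMulVec (t.x j) (t.y j))
    (hab : ∀ l i j, t.x l (i, j) = t.a l i * t.b l j)
    (hc : ∀ i j k, cpTensor a b c i j k = ∑ l, t.x l (i, j) * t.c l k) :
    IsRun (cpTensor a b c) t := by
  obtain ⟨L, hL⟩ := h.exists_orthLeftInverse
  set X := factorMatrix a b
  have hA : t.A = X * diagonal (fun l => ∑ i, t.α i * Z i l) * Xᵀ := sum_smul_diag X t.α hZ
  have hB : t.B = X * diagonal (fun l => ∑ i, t.β i * Z i l) * Xᵀ := sum_smul_diag X t.β hZ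
  set dα : Fin R → ℝ := fun l => ∑ i, t.α i * Z i l
  set dβ : Fin R → ℝ := fun l => ∑ i, t.β i * Z i l
  have hBinv' : t.Binv = Lᵀ * diagonal dβ⁻¹ * L := by
    refine hBinv.unique ?_
    rw [hB]
    exact hL.isPseudoInverse hβ
  have hAinv' : t.Ainv = Lᵀ * diagonal dα⁻¹ * L := by
    refine hAinv.unique ?_
    rw [hA]
    exact hL.isPseudoInverse hα
  have hδ : Function.Injective (dα * dβ⁻¹) := fun l k hlk => hαβ (by
    simpa only [Pi.mul_apply, Pi.inv_apply, ← div_eq_mul_inv] using hlk)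
  have hδ' : ∀ l, (dβ * dα⁻¹) l = ((dα * dβ⁻¹) l)⁻¹ := fun l => by
    simp [mul_comm]
  have hμ' : ∀ j, t.μ j = (dα * dβ⁻¹) (π j) := fun j => by
    rw [hμ, Pi.mul_apply, Pi.inv_apply, div_eq_mul_inv]
  refine ⟨hu, by rwa [hu.2], hAinv, hBinv, ?_, ?_, hz, hab, hc⟩
  · rw [hA, hBinv', hL.mul_diag_mul, show t.μ = fun j => (dα * dβ⁻¹) (π j) from funext hμ']
    exact hL.isNonzeroEigensystem hδ (fun l => mul_ne_zero (hα l) (inv_ne_zero (hβ l))) π hx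
  · rw [hB, hAinv', hL.transpose_diag_mul, hy,
      show (fun j => (t.μ j)⁻¹) = fun j => (dβ * dα⁻¹) (π j) from funext fun j => by rw [hμ', hδ']]
    exact hL.isNonzeroEigensystem (fun l k hlk => hδ (inv_injective
      ((hδ' l).symm.trans (hlk.trans (hδ' k)))))
      (fun l => mul_ne_zero (hβ l) (inv_ne_zero (hα l))) π hx

end Good

theorem injective_div {κ : Type} {d e : κ → ℝ} (he : ∀ l, e l ≠ 0)
    (h : ∀ l k, l ≠ k → d l * e k - d k * e l ≠ 0) : Function.Injective fun l => d l / e l := by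
  intro l k hlk
  by_contra hne
  exact h l k hne (sub_eq_zero.2 ((div_eq_div_iff (he l) (he k)).1 hlk))

namespace Good

variable {hR : R ≤ n₃} {i₀ : Fin n₁} {j₀ j₁ : Fin n₂} {a : Fin R → Fin n₁ → ℝ}
  {b : Fin R → Fin n₂ → ℝ} {c : Fin R → Fin n₃ → ℝ} (h : Good hR i₀ j₀ j₁ a b c)
include h

theorem generically_exists_isRun {r s : ℕ} {u : Fin r → Mat n₁ n₂} {P : Fin s → Mat2 n₁ n₂}
    (hu : IsBasisOf u (colSpan (cpTensor a b c)))
    (hP : IsBasisOf P (symSquare (Submodule.span ℝ (Set.range u)) ⊓ minorsPerp n₁ n₂)) :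
    Generically fun w : Fin s ⊕ Fin s → ℝ =>
      ∃ t : Transcript n₁ n₂ n₃ r s, IsRun (cpTensor a b c) t ∧ t.u = u ∧ t.P = P ∧
        t.α = (fun i => w (Sum.inl i)) ∧ t.β = (fun i => w (Sum.inr i)) := by
  rw [hu.2] at hP
  obtain ⟨hs, Z, hZi, hZ⟩ := h.basis_inter hP
  obtain rfl : R = s := hs.symm
  -- the coefficients `1, …, 1` and `1, …, R` show that the conditions are not void
  have hZu : IsUnit (Matrix.of Z) := linearIndependent_rows_iff_isUnit.1 hZi
  have hsolve : ∀ d : Fin R → ℝ, ∃ α : Fin R → ℝ, ∀ l, ∑ i, α i * Z i l = d l := by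
    intro d
    refine ⟨d ᵥ* (Matrix.of Z)⁻¹, fun l => ?_⟩
    have : (d ᵥ* (Matrix.of Z)⁻¹) ᵥ* Matrix.of Z = d := by
      rw [vecMul_vecMul, nonsing_inv_mul _ ((isUnit_iff_isUnit_det _).1 hZu), vecMul_one]
    exact congrFun this l
  obtain ⟨α₀, hα₀⟩ := hsolve 1
  obtain ⟨β₀, hβ₀⟩ := hsolve fun l => (l : ℕ) + 1
  have hpα : ∀ l, IsPoly fun w : Fin R ⊕ Fin R → ℝ => ∑ i, w (Sum.inl i) * Z i l := fun l =>
    .sum _ fun i => .mul (.coord _) (.const _)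
  have hpβ : ∀ l, IsPoly fun w : Fin R ⊕ Fin R → ℝ => ∑ i, w (Sum.inr i) * Z i l := fun l =>
    .sum _ fun i => .mul (.coord _) (.const _)
  have hgen := (Generically.forall_fintype fun l => (hpα l).generically
      ⟨Sum.elim α₀ β₀, by simp [hα₀]⟩).and
    ((Generically.forall_fintype fun l => (hpβ l).generically ⟨Sum.elim α₀ β₀, by
      simp only [Sum.elim_inr, hβ₀]
      positivity⟩).and
    (Generically.forall_fintype fun l => Generically.forall_fintype fun k =>
      Generically.of_imp (p := l ≠ k) fun hlk =>
        (((hpα l).mul (hpβ k)).sub ((hpα k).mul (hpβ l))).generically ⟨Sum.elim α₀ β₀, by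
          simp only [Sum.elim_inl, Sum.elim_inr, hα₀, hβ₀, Pi.one_apply, one_mul]
          refine sub_ne_zero.2 fun h' => hlk (Fin.ext ?_)
          have := add_right_cancel h'
          exact_mod_cast this.symm⟩))
  refine hgen.mono fun w ⟨hα, hβ, hαβ⟩ => ?_
  obtain ⟨L, hL⟩ := h.exists_orthLeftInverse
  set X := factorMatrix a b with hX
  set dα : Fin R → ℝ := fun l => ∑ i, w (Sum.inl i) * Z i l
  set dβ : Fin R → ℝ := fun l => ∑ i, w (Sum.inr i) * Z i l
  let t : Transcript n₁ n₂ n₃ r R :=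
    { u := u
      P := P
      α := fun i => w (Sum.inl i)
      β := fun i => w (Sum.inr i)
      Ainv := Lᵀ * diagonal dα⁻¹ * L
      Binv := Lᵀ * diagonal dβ⁻¹ * L
      μ := fun l => dα l / dβ l
      x := X.col
      y := X.col
      z := fun l i => Z i l
      a := a
      b := b
      c := c }
  have hA : t.A = X * diagonal dα * Xᵀ := sum_smul_diag X t.α hZ
  have hB : t.B = X * diagonal dβ * Xᵀ := sum_smul_diag X t.β hZ
  refine ⟨t, h.isRun (Z := Z) hu hP hZ hα hβ (injective_div hβ hαβ) ?_ ?_ (Equiv.refl _)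
    (fun _ => rfl) (fun j => ⟨1, one_ne_zero, (one_smul _ _).symm⟩) rfl (fun i => ?_)
    (fun _ _ _ => rfl) (fun _ _ _ => rfl), rfl, rfl, rfl, rfl⟩
  · rw [hA]
    exact hL.isPseudoInverse hα
  · rw [hB]
    exact hL.isPseudoInverse hβ
  · exact (hZ i).trans (mul_diagonal_mul_transpose _ _)

end Good

end Runs

end JLV

namespace JLV

open Matrix Prog

/-! ### Arrays as matrices -/

section Arrays

variable {n₁ n₂ n₃ R : ℕ}

/-- The position of a pair of indices in a flattened array. -/
def flatIndex (p : Fin n₁ × Fin n₂) : ℕ := p.1 * n₂ + p.2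

theorem flatIndex_lt (p : Fin n₁ × Fin n₂) : flatIndex p < n₁ * n₂ := flat_lt p.1.2 p.2.2

theorem flat_inj {m x x' y y' : ℕ} (hy : y < m) (hy' : y' < m) (h : x * m + y = x' * m + y') :
    x = x' ∧ y = y' := by
  have h1 := congrArg (· / m) h
  have h2 := congrArg (· % m) h
  simp only [Nat.mul_add_mod', Nat.mod_eq_of_lt hy, Nat.mod_eq_of_lt hy'] at h2
  refine ⟨?_, h2⟩
  subst h2
  exact Nat.eq_of_mul_eq_mul_right (by omega) (Nat.add_right_cancel h)

theorem flatIndex_injective : Function.Injective (flatIndex (n₁ := n₁) (n₂ := n₂)) := by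
  intro p q h
  obtain ⟨h1, h2⟩ := flat_inj p.2.2 q.2.2 h
  exact Prod.ext (Fin.ext h1) (Fin.ext h2)

theorem exists_flatIndex {i : ℕ} (hi : i < n₁ * n₂) : ∃ p : Fin n₁ × Fin n₂, flatIndex p = i := by
  have h2 : 0 < n₂ := Nat.pos_of_ne_zero fun h => by simp [h] at hi
  exact ⟨(⟨i / n₂, Nat.div_lt_of_lt_mul (by rwa [mul_comm])⟩, ⟨i % n₂, Nat.mod_lt _ h2⟩),
    Nat.div_add_mod' i n₂⟩

/-- The position of a pair of pairs of indices in a flattened array. -/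
def flatIndex₂ (t : (Fin n₁ × Fin n₂) × (Fin n₁ × Fin n₂)) : ℕ :=
  flatIndex t.1 * (n₁ * n₂) + flatIndex t.2

theorem flatIndex₂_lt (t : (Fin n₁ × Fin n₂) × (Fin n₁ × Fin n₂)) :
    flatIndex₂ t < n₁ * n₂ * (n₁ * n₂) := flat_lt (flatIndex_lt _) (flatIndex_lt _)

theorem flatIndex₂_injective : Function.Injective (flatIndex₂ (n₁ := n₁) (n₂ := n₂)) := by
  intro p q h
  obtain ⟨h1, h2⟩ := flat_inj (flatIndex_lt _) (flatIndex_lt _) h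
  exact Prod.ext (flatIndex_injective h1) (flatIndex_injective h2)

theorem exists_flatIndex₂ {i : ℕ} (hi : i < n₁ * n₂ * (n₁ * n₂)) :
    ∃ t : (Fin n₁ × Fin n₂) × (Fin n₁ × Fin n₂), flatIndex₂ t = i := by
  have h2 : 0 < n₁ * n₂ := Nat.pos_of_ne_zero fun h => by simp [h] at hi
  obtain ⟨p, hp⟩ := exists_flatIndex (Nat.div_lt_of_lt_mul hi)
  obtain ⟨q, hq⟩ := exists_flatIndex (Nat.mod_lt i h2)
  exact ⟨(p, q), by rw [flatIndex₂, hp, hq, Nat.div_add_mod']⟩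

theorem sum_range_flat (g : ℕ → ℝ) :
    ∑ i ∈ Finset.range (n₁ * n₂), g i = ∑ p : Fin n₁ × Fin n₂, g (flatIndex p) := by
  symm
  refine Finset.sum_bij (fun p _ => flatIndex p) (fun p _ => Finset.mem_range.2 (flatIndex_lt p))
    (fun p _ q _ h => flatIndex_injective h) (fun i hi => ?_) fun _ _ => rfl
  obtain ⟨p, hp⟩ := exists_flatIndex (Finset.mem_range.1 hi)
  exact ⟨p, Finset.mem_univ _, hp⟩

theorem sum_range_of_le {s N : ℕ} (hs : s ≤ N) {g : ℕ → ℝ} (h : ∀ i, s ≤ i → g i = 0) :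
    ∑ i ∈ Finset.range N, g i = ∑ i : Fin s, g i := by
  rw [← Finset.sum_range g, Finset.sum_subset (Finset.range_mono hs)]
  intro i _ hi
  exact h i (by simpa using hi)

/-- The array `a`, as a matrix. -/
def mat (n₁ n₂ : ℕ) (st : State) (a : ℕ) : Mat2 n₁ n₂ :=
  Matrix.of fun p q => st.mem a [flatIndex p, flatIndex q]

/-- Row `l` of the array `a`, as a vector. -/
def vec (n₁ n₂ : ℕ) (st : State) (a l : ℕ) : Mat n₁ n₂ := fun p => st.mem a [l, flatIndex p]

/-- A vector of length `(n₁ n₂)²`, as a matrix. -/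
def tens (n₁ n₂ : ℕ) (w : ℕ → ℝ) : Mat2 n₁ n₂ :=
  Matrix.of fun p q => w (flatIndex₂ (p, q))

theorem mat_congr {st st' : State} {a : ℕ} (h : st'.mem a = st.mem a) :
    mat n₁ n₂ st' a = mat n₁ n₂ st a := by
  rw [mat, h]
  rfl

theorem mat_mulVec (st : State) (a : ℕ) (w : ℕ → ℝ) (p : Fin n₁ × Fin n₂) :
    (mat n₁ n₂ st a *ᵥ fun q => w (flatIndex q)) p =
      ∑ q ∈ Finset.range (n₁ * n₂), st.mem a [flatIndex p, q] * w q := by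
  rw [sum_range_flat fun q => st.mem a [flatIndex p, q] * w q]
  rfl

theorem mat_mul (st : State) (a b : ℕ) (p q : Fin n₁ × Fin n₂) :
    (mat n₁ n₂ st a * mat n₁ n₂ st b) p q =
      ∑ i ∈ Finset.range (n₁ * n₂), st.mem a [flatIndex p, i] * st.mem b [i, flatIndex q] := by
  rw [sum_range_flat fun i => st.mem a [flatIndex p, i] * st.mem b [i, flatIndex q]]
  rfl

/-- The extension of a vector by zero. -/
noncomputable def extend (v : Mat n₁ n₂) : ℕ → ℝ := Function.extend flatIndex v 0

@[simp] theorem extend_flatIndex (v : Mat n₁ n₂) (p : Fin n₁ × Fin n₂) :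
    extend v (flatIndex p) = v p := flatIndex_injective.extend_apply _ _ _

end Arrays

/-! ### The linear algebra done by the program -/

section Stages

variable {n₁ n₂ n₃ R : ℕ} {st : State}

theorem matmul_mat (hs : Sizes n₁ n₂ n₃ st) {x y d : ℕ} (hx : x ∉ [24, 40, d])
    (hy : y ∉ [24, 40, d]) (hd : d ∉ [24, 40]) :
    mat n₁ n₂ ((matmul x y d).exec st) d = mat n₁ n₂ st x * mat n₁ n₂ st y := by
  ext p q
  rw [mat_mul]
  exact matmul_spec hs rfl hx hy hd (flatIndex_lt p) (flatIndex_lt q)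

theorem contract_mat (hs : Sizes n₁ n₂ n₃ st) {c d s : ℕ} (hc : c ∉ [24, 40, d])
    (hd : d ∉ [24, 40, 50]) (hsN : s ≤ n₁ * n₂) (h0 : ∀ l, s ≤ l → ∀ j, st.mem 50 [l, j] = 0) :
    mat n₁ n₂ ((contract c d).exec st) d =
      ∑ i : Fin s, st.mem c [i] • tens n₁ n₂ fun j => st.mem 50 [i, j] := by
  ext p q
  refine (contract_spec hs rfl hc hd (flatIndex_lt p) (flatIndex_lt q)).trans ?_
  rw [sum_range_of_le hsN fun i hi => by rw [h0 i hi, mul_zero], Matrix.sum_apply]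
  rfl

theorem powProg_mat (hs : Sizes n₁ n₂ n₃ st) {k : ℕ} (hk : k ≤ n₁ * n₂) :
    Matrix.of (fun p q : Fin n₁ × Fin n₂ =>
      (powProg.exec st).mem 39 [k, flatIndex p, flatIndex q]) = mat n₁ n₂ st 38 ^ (k + 1) := by
  obtain ⟨h0, h1⟩ := powProg_spec hs rfl
  induction k with
  | zero =>
    ext p q
    rw [pow_one]
    exact h0 _ (flatIndex_lt p) _ (flatIndex_lt q)
  | succ k ih =>
    ext p q
    rw [pow_succ, ← ih (by omega)]
    refine (h1 k hk _ (flatIndex_lt p) _ (flatIndex_lt q)).trans ?_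
    rw [sum_range_flat fun i => (powProg.exec st).mem 39 [k, flatIndex p, i] *
      st.mem 38 [i, flatIndex q]]
    rfl

variable {X : Matrix (Fin n₁ × Fin n₂) (Fin R) ℝ} {L : Matrix (Fin R) (Fin n₁ × Fin n₂) ℝ}

/-- The matrix in array `25` has the column span of `X` as its kernel. -/
def HasKernel (X : Matrix (Fin n₁ × Fin n₂) (Fin R) ℝ) (st : State) : Prop :=
  ∀ v, mat n₁ n₂ st 25 *ᵥ v = 0 ↔ ∃ w, v = X *ᵥ w

theorem HasKernel.congr (h : HasKernel X st) {st' : State} (h' : st'.mem 25 = st.mem 25) :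
    HasKernel X st' := by
  rw [HasKernel, mat_congr h']
  exact h

/-- On a symmetric `A` with column span `U`, the pseudo-inverse `G` is determined by `A² G = A`
together with the condition that its columns are in `U`. -/
theorem pinv_mat (hL : IsOrthLeftInverse X L) (hs : Sizes n₁ n₂ n₃ st) {a d : ℕ}
    (ha : a ∉ [20, 21, 22, 23, 24, 26, 36, 40, d])
    (hd : d ∉ [20, 21, 22, 23, 24, 25, 26, 36, 40]) (hK : HasKernel X st) {e : Fin R → ℝ}
    (he : ∀ l, e l ≠ 0) (hA : mat n₁ n₂ st a = X * diagonal e * Xᵀ) :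
    mat n₁ n₂ ((pinv a d).exec st) d = Lᵀ * diagonal e⁻¹ * L := by
  set A := mat n₁ n₂ st a with hAdef
  set G := Lᵀ * diagonal e⁻¹ * L with hG
  have hAG := hL.isPseudoInverse he
  rw [← hA] at hAG
  have hAT : Aᵀ = A := by rw [hA, transpose_diag]
  have hGT : Gᵀ = G := by simp [hG, Matrix.mul_assoc]
  -- the rows of the pseudo-inverse solve the equations
  have hcond : ∀ (x : ℕ → ℝ) (p : Fin n₁ × Fin n₂), ((∀ q < n₁ * n₂,
      ∑ p ∈ Finset.range (n₁ * n₂), (∑ l ∈ Finset.range (n₁ * n₂), st.mem a [p, l] *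
        st.mem a [l, q]) * x p = st.mem a [flatIndex p, q]) ∧
      ∀ j < n₁ * n₂, ∑ p ∈ Finset.range (n₁ * n₂), st.mem 25 [j, p] * x p = 0) ↔
      (A * A) *ᵥ (fun q => x (flatIndex q)) = A.row p ∧
        mat n₁ n₂ st 25 *ᵥ (fun q => x (flatIndex q)) = 0 := by
    intro x p
    have e1 : ∀ q : Fin n₁ × Fin n₂, ((A * A) *ᵥ (fun q => x (flatIndex q))) q =
        ∑ p ∈ Finset.range (n₁ * n₂), (∑ l ∈ Finset.range (n₁ * n₂), st.mem a [p, l] *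
        st.mem a [l, flatIndex q]) * x p := by
      intro q
      have : A * A = (A * A)ᵀ := by rw [transpose_mul, hAT]
      rw [this, sum_range_flat fun p => (∑ l ∈ Finset.range (n₁ * n₂), st.mem a [p, l] *
        st.mem a [l, flatIndex q]) * x p]
      simp only [mulVec, dotProduct, transpose_apply, hAdef, mat_mul]
    constructor
    · rintro ⟨h1, h2⟩
      refine ⟨funext fun q => ?_, funext fun q => ?_⟩
      · rw [e1, h1 _ (flatIndex_lt q)]
        rfl
      · rw [mat_mulVec, h2 _ (flatIndex_lt q)]
        rfl
    · rintro ⟨h1, h2⟩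
      refine ⟨fun q hq => ?_, fun q hq => ?_⟩
      · obtain ⟨q, rfl⟩ := exists_flatIndex hq
        rw [← e1, h1]
        rfl
      · obtain ⟨q, rfl⟩ := exists_flatIndex hq
        rw [← mat_mulVec, h2]
        rfl
  have hAAG : A * A * G = A := by
    rw [Matrix.mul_assoc, ← hAG.symm_left, transpose_mul, hGT, hAT, ← Matrix.mul_assoc,
      hAG.mul_mul_left]
  ext p q
  have hsol : (A * A) *ᵥ G.row p = A.row p ∧ mat n₁ n₂ st 25 *ᵥ G.row p = 0 := by
    have hrow : G.row p = G *ᵥ Pi.single p 1 := by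
      rw [mulVec_single_one]
      nth_rewrite 1 [← hGT]
      rfl
    rw [hrow]
    constructor
    · rw [mulVec_mulVec, hAAG, mulVec_single_one]
      nth_rewrite 1 [← hAT]
      rfl
    · rw [hK]
      refine ⟨L *ᵥ (G *ᵥ Pi.single p 1), ?_⟩
      rw [mulVec_mulVec, mulVec_mulVec, ← Matrix.mul_assoc, ← hL.symm, transpose_mul, hG,
        ← Matrix.mul_assoc, Matrix.mul_assoc Lᵀ Xᵀ, ← Matrix.mul_assoc Lᵀ,
        Matrix.mul_assoc Lᵀ Xᵀ, hL.transpose_mul_eq_one, Matrix.mul_one]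
  obtain ⟨h1, h2⟩ := (hcond _ p).1 (pinv_spec hs rfl ha hd (flatIndex_lt p)
    ⟨extend (G.row p), (hcond _ p).2 (by simp only [extend_flatIndex]; exact hsol)⟩)
  set y : Mat n₁ n₂ := fun q => ((pinv a d).exec st).mem d [flatIndex p, flatIndex q]
  -- the solution is unique
  obtain ⟨w, hw⟩ := (hK _).1 h2
  obtain ⟨w', hw'⟩ := (hK _).1 hsol.2
  have h3 : (A * A) *ᵥ (X *ᵥ w) = (A * A) *ᵥ (X *ᵥ w') := by rw [← hw, ← hw', h1, hsol.1]
  have h4 : (X * L) *ᵥ (X *ᵥ w) = (X * L) *ᵥ (X *ᵥ w') := by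
    have : G * G * (A * A) = X * L := by
      have e1 : G * A = X * L := by
        rw [← transpose_inj, hA, hG, hL.transpose_diag_mul,
          show e * e⁻¹ = 1 from funext fun l => mul_inv_cancel₀ (he l), hL.symm]
        simp
      rw [Matrix.mul_assoc, ← Matrix.mul_assoc G A, e1, hA, ← Matrix.mul_assoc (X * L),
        ← Matrix.mul_assoc (X * L), Matrix.mul_assoc X L X, hL.mul_eq_one, Matrix.mul_one, ← hA, e1]
    rw [← this, ← mulVec_mulVec, h3, mulVec_mulVec]
  rw [mulVec_mulVec, mulVec_mulVec, Matrix.mul_assoc, hL.mul_eq_one, Matrix.mul_one] at h4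
  have h5 : y = G.row p := by rw [hw, hw', h4]
  exact congrFun h5 q

theorem eigProg_vec (hL : IsOrthLeftInverse X L) (hs : Sizes n₁ n₂ n₃ st) (hsr : st.reg 4 = R)
    (hsN : R ≤ n₁ * n₂) {δ : Fin R → ℝ} (hδ : Function.Injective δ) (hδ₀ : ∀ l, δ l ≠ 0)
    (hM : mat n₁ n₂ st 38 = X * diagonal δ * L) {π : Fin R ≃ Fin R}
    (hπ : ∀ j : Fin R, st.mem 7 [j] = δ (π j)) (j : Fin R) :
    ∃ τ : ℝ, τ ≠ 0 ∧ vec n₁ n₂ (eigProg.exec st) 53 j = τ • X.col (π j) := by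
  have hcond : ∀ w : ℕ → ℝ, ((∀ p < n₁ * n₂, ∑ q ∈ Finset.range (n₁ * n₂), st.mem 38 [p, q] * w q =
      st.mem 7 [(j : ℕ)] * w p) ∧ ∃ k < n₁ * n₂, w k ≠ 0) ↔
      (mat n₁ n₂ st 38 *ᵥ fun q => w (flatIndex q)) = δ (π j) • (fun q => w (flatIndex q)) ∧
        (fun q : Fin n₁ × Fin n₂ => w (flatIndex q)) ≠ 0 := by
    intro w
    rw [hπ]
    constructor
    · rintro ⟨h1, k, hk, hk'⟩
      obtain ⟨q, rfl⟩ := exists_flatIndex hk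
      refine ⟨funext fun p => ?_, fun h0 => hk' (congrFun h0 q)⟩
      rw [mat_mulVec, h1 _ (flatIndex_lt p)]
      rfl
    · rintro ⟨h1, h2⟩
      obtain ⟨q, hq⟩ := Function.ne_iff.1 h2
      refine ⟨fun p hp => ?_, flatIndex q, flatIndex_lt q, hq⟩
      obtain ⟨p, rfl⟩ := exists_flatIndex hp
      rw [← mat_mulVec, h1]
      rfl
  have hsys := hL.isNonzeroEigensystem hδ hδ₀ π (w := fun j => X.col (π j))
    fun j => ⟨1, one_ne_zero, (one_smul _ _).symm⟩
  obtain ⟨h1, h2⟩ := (hcond _).1 (eigProg_spec hs rfl hsr hsN j.2 ⟨extend (X.col (π j)),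
    (hcond _).2 ⟨by simp only [extend_flatIndex, hM]; exact hsys.mulVec_eq j,
      by simp only [extend_flatIndex]; exact hsys.eigenvector_ne_zero j⟩⟩)
  rw [hM] at h1
  exact hL.exists_eq_smul hδ (hδ₀ _) h2 h1

theorem zProg_tens (hs : Sizes n₁ n₂ n₃ st) (hsN : R ≤ n₁ * n₂)
    (h0 : ∀ j, R ≤ j → ∀ p, st.mem 53 [j, p] = 0) {Z : Fin R → Fin R → ℝ}
    (hZ : ∀ i : Fin R, tens n₁ n₂ (fun j => st.mem 50 [i, j]) = X * diagonal (Z i) * Xᵀ)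
    {π : Fin R ≃ Fin R} (hx : ∀ j : Fin R, ∃ τ : ℝ, τ ≠ 0 ∧ vec n₁ n₂ st 53 j = τ • X.col (π j))
    (i : Fin R) : tens n₁ n₂ (fun j => st.mem 50 [i, j]) =
      ∑ j : Fin R, (zProg.exec st).mem 10 [j, i] •
        vecMulVec (vec n₁ n₂ st 53 j) (vec n₁ n₂ st 53 j) := by
  have hcond : ∀ x : ℕ → ℝ, (∀ p < n₁ * n₂, ∀ q < n₁ * n₂, ∑ j ∈ Finset.range (n₁ * n₂),
      st.mem 53 [j, p] * st.mem 53 [j, q] * x j = st.mem 50 [(i : ℕ), p * (n₁ * n₂) + q]) ↔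
      tens n₁ n₂ (fun j => st.mem 50 [i, j]) =
        ∑ j : Fin R, x j • vecMulVec (vec n₁ n₂ st 53 j) (vec n₁ n₂ st 53 j) := by
    intro x
    have e1 : ∀ p q : Fin n₁ × Fin n₂, (∑ j : Fin R, x j • vecMulVec (vec n₁ n₂ st 53 j)
        (vec n₁ n₂ st 53 j)) p q = ∑ j ∈ Finset.range (n₁ * n₂),
        st.mem 53 [j, flatIndex p] * st.mem 53 [j, flatIndex q] * x j := by
      intro p q
      rw [sum_range_of_le hsN fun j hj => by rw [h0 j hj, zero_mul, zero_mul], Matrix.sum_apply]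
      exact Finset.sum_congr rfl fun j _ => mul_comm _ _
    constructor
    · intro h
      ext p q
      rw [e1, h _ (flatIndex_lt p) _ (flatIndex_lt q)]
      rfl
    · intro h p hp q hq
      obtain ⟨p, rfl⟩ := exists_flatIndex hp
      obtain ⟨q, rfl⟩ := exists_flatIndex hq
      rw [← e1, ← h]
      rfl
  choose τ hτ hx using hx
  refine (hcond fun j => (zProg.exec st).mem 10 [j, i]).1
    (zProg_spec hs rfl (i.2.trans_le hsN) ⟨fun j => if h : j < R then
      (τ ⟨j, h⟩)⁻¹ ^ 2 * Z i (π ⟨j, h⟩) else 0, (hcond _).2 ?_⟩)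
  rw [hZ, mul_diagonal_mul_transpose, ← Equiv.sum_comp π]
  refine Finset.sum_congr rfl fun j _ => ?_
  rw [dif_pos j.2, hx, vecMulVec_smul, smul_vecMulVec, smul_smul, smul_smul]
  congr 1
  have := hτ j
  simp only [Fin.eta]
  field_simp

theorem thirdProg_vec (hs : Sizes n₁ n₂ n₃ st) (hsN : R ≤ n₁ * n₂)
    (h0 : ∀ j, R ≤ j → ∀ p, st.mem 53 [j, p] = 0) {a : Fin R → Fin n₁ → ℝ} {b : Fin R → Fin n₂ → ℝ}
    {c : Fin R → Fin n₃ → ℝ} {π : Fin R ≃ Fin R} (hx : ∀ j : Fin R, ∃ τ : ℝ, τ ≠ 0 ∧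
      vec n₁ n₂ st 53 j = τ • (factorMatrix a b).col (π j))
    (hT : ∀ (i : Fin n₁) (j : Fin n₂) (k : Fin n₃), st.mem 0 [i, j, k] = cpTensor a b c i j k)
    (i : Fin n₁) (j : Fin n₂) (k : Fin n₃) :
    cpTensor a b c i j k =
      ∑ l : Fin R, vec n₁ n₂ st 53 l (i, j) * (thirdProg.exec st).mem 13 [l, k] := by
  have e1 : ∀ (x : ℕ → ℝ) (i : Fin n₁) (j : Fin n₂), ∑ l ∈ Finset.range (n₁ * n₂),
      st.mem 53 [l, i * n₂ + j] * x l = ∑ l : Fin R, vec n₁ n₂ st 53 l (i, j) * x l := by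
    intro x i j
    rw [sum_range_of_le hsN fun j hj => by rw [h0 j hj, zero_mul]]
    rfl
  choose τ hτ hx using hx
  rw [← e1 (fun l => (thirdProg.exec st).mem 13 [l, k]), ← hT]
  refine (thirdProg_spec hs rfl k.2 ⟨fun l => if h : l < R then
    (τ ⟨l, h⟩)⁻¹ * c (π ⟨l, h⟩) k else 0, fun i hi j hj => ?_⟩ i i.2 j j.2).symm
  refine (e1 _ ⟨i, hi⟩ ⟨j, hj⟩).trans ((hT ⟨i, hi⟩ ⟨j, hj⟩ k).trans ?_).symm
  rw [cpTensor, ← Equiv.sum_comp π]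
  refine Finset.sum_congr rfl fun l _ => ?_
  rw [dif_pos l.2, hx]
  have := hτ l
  simp only [Fin.eta, Pi.smul_apply, smul_eq_mul, col_apply, factorMatrix, of_apply]
  field_simp

end Stages

end JLV

namespace JLV

open Matrix Prog

section Stages

variable {n₁ n₂ n₃ R : ℕ} {st : State} {X : Matrix (Fin n₁ × Fin n₂) (Fin R) ℝ}
  {L : Matrix (Fin R) (Fin n₁ × Fin n₂) ℝ}

/-- If the monic polynomial of degree `R` with the coefficients `cₖ` has the `R` distinct roots
`δₗ`, then these are all its roots, and `kthRoot` lists them in increasing order. -/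
theorem kthRoot_eq {N : ℕ} (hN : R ≤ N) {δ : Fin R → ℝ} (hδ : Function.Injective δ) {c : ℕ → ℝ}
    (h1 : c R = 1) (h2 : ∀ k, R < k → k ≤ N → c k = 0)
    (h3 : ∀ l, ∑ k ∈ Finset.range R, c k * δ l ^ k + δ l ^ R = 0) :
    ∃ π : Fin R ≃ Fin R, ∀ j : Fin R, kthRoot c N j = δ (π j) := by
  classical
  set p : Polynomial ℝ :=
    ∑ i ∈ Finset.range (N + 1), Polynomial.C (c i) * Polynomial.X ^ i with hp
  have hcoeff : ∀ k, p.coeff k = if k ≤ N then c k else 0 := by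
    intro k
    simp [hp, Polynomial.finsetSum_coeff, Polynomial.coeff_X_pow]
  have hdeg : p.natDegree ≤ R := by
    rw [Polynomial.natDegree_le_iff_coeff_eq_zero]
    intro k hk
    rw [hcoeff]
    split
    · exact h2 k hk ‹_›
    · rfl
  have hp0 : p ≠ 0 := fun h0 => by
    have := hcoeff R
    rw [h0, if_pos hN, h1] at this
    simp at this
  have heval : ∀ l, p.eval (δ l) = 0 := by
    intro l
    rw [← h3 l, Polynomial.eval_eq_sum_range' (Nat.lt_succ_of_le hdeg), Finset.sum_range_succ,
      hcoeff, if_pos hN, h1, one_mul]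
    congr 1
    refine Finset.sum_congr rfl fun k hk => ?_
    rw [hcoeff, if_pos ((Finset.mem_range.1 hk).le.trans hN)]
  have hroots : Finset.univ.image δ = p.roots.toFinset := by
    refine Finset.eq_of_subset_of_card_le (fun x hx => ?_) ?_
    · obtain ⟨l, -, rfl⟩ := Finset.mem_image.1 hx
      rw [Multiset.mem_toFinset, Polynomial.mem_roots hp0]
      exact heval l
    · rw [Finset.card_image_of_injective _ hδ, Finset.card_univ, Fintype.card_fin]
      exact (Multiset.toFinset_card_le _).trans ((Polynomial.card_roots' p).trans hdeg)
  set ls := (Finset.univ.image δ).sort (· ≤ ·) with hls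
  have hlen : ls.length = R := by
    rw [hls, Finset.length_sort, Finset.card_image_of_injective _ hδ, Finset.card_univ,
      Fintype.card_fin]
  have hk : ∀ j : Fin R, kthRoot c N j = ls[(j : ℕ)]'(by rw [hlen]; exact j.2) := by
    intro j
    rw [← List.getD_eq_getElem ls 0 (by rw [hlen]; exact j.2), kthRoot, hls, hroots]
  have hmem : ∀ j : Fin R, ∃ l, δ l = kthRoot c N j := by
    intro j
    have : kthRoot c N j ∈ ls := by
      rw [hk]
      exact List.getElem_mem _
    rw [hls, Finset.mem_sort] at this
    obtain ⟨l, -, hl⟩ := Finset.mem_image.1 this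
    exact ⟨l, hl⟩
  choose f hf using hmem
  have hinj : Function.Injective f := by
    intro j j' hj
    have h4 : kthRoot c N j = kthRoot c N j' := by rw [← hf, ← hf, hj]
    rw [hk, hk] at h4
    exact Fin.ext ((Finset.sort_nodup _ _).getElem_inj_iff.1 h4)
  exact ⟨Equiv.ofBijective f (Finite.injective_iff_bijective.1 hinj), fun j => (hf j).symm⟩

theorem charProg_eigenvalues (hL : IsOrthLeftInverse X L) (hs : Sizes n₁ n₂ n₃ st)
    (hsr : st.reg 4 = R) (hsN : R ≤ n₁ * n₂) {δ : Fin R → ℝ} (hδ : Function.Injective δ)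
    (hδ₀ : ∀ l, δ l ≠ 0)
    (hpow : ∀ k ≤ n₁ * n₂, Matrix.of (fun p q : Fin n₁ × Fin n₂ =>
      st.mem 39 [k, flatIndex p, flatIndex q]) = (X * diagonal δ * L) ^ (k + 1)) :
    ∃ π : Fin R ≃ Fin R, ∀ j : Fin R, (charProg.exec st).mem 7 [j] = δ (π j) := by
  have hentry : ∀ k ≤ n₁ * n₂, ∀ p q : Fin n₁ × Fin n₂,
      st.mem 39 [k, flatIndex p, flatIndex q] = ∑ l, X p l * δ l ^ (k + 1) * L l q := by
    intro k hk p q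
    have := congrFun (congrFun (hpow k hk) p) q
    rw [hL.pow_diag, mul_diagonal_mul_apply] at this
    exact this
  -- a relation between the powers is a relation between the powers of each eigenvalue
  have hrel : ∀ x : ℕ → ℝ, (∀ p < n₁ * n₂, ∀ q < n₁ * n₂,
      st.mem 39 [R, p, q] + ∑ k ∈ Finset.range R, st.mem 39 [k, p, q] * x k = 0) ↔
      ∀ l, ∑ k ∈ Finset.range R, x k * δ l ^ k + δ l ^ R = 0 := by
    intro x
    have e1 : ∀ p q : Fin n₁ × Fin n₂, st.mem 39 [R, flatIndex p, flatIndex q] +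
        ∑ k ∈ Finset.range R, st.mem 39 [k, flatIndex p, flatIndex q] * x k =
        (X * diagonal (fun l => δ l * (∑ k ∈ Finset.range R, x k * δ l ^ k + δ l ^ R)) * L)
          p q := by
      intro p q
      have e2 : ∑ k ∈ Finset.range R, st.mem 39 [k, flatIndex p, flatIndex q] * x k =
          ∑ l, ∑ k ∈ Finset.range R, X p l * δ l ^ (k + 1) * L l q * x k := by
        rw [Finset.sum_comm]
        refine Finset.sum_congr rfl fun k hk => ?_
        rw [hentry k ((Finset.mem_range.1 hk).le.trans hsN), Finset.sum_mul]
      rw [mul_diagonal_mul_apply, hentry R hsN, e2, ← Finset.sum_add_distrib]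
      refine Finset.sum_congr rfl fun l _ => ?_
      have : ∑ k ∈ Finset.range R, X p l * δ l ^ (k + 1) * L l q * x k =
          X p l * (δ l * ∑ k ∈ Finset.range R, x k * δ l ^ k) * L l q := by
        rw [Finset.mul_sum, Finset.mul_sum, Finset.sum_mul]
        exact Finset.sum_congr rfl fun _ _ => by ring
      rw [this]
      ring
    constructor
    · intro h l
      have h0 := hL.eq_zero_of_mul_diag_eq_zero (e := fun l =>
        δ l * (∑ k ∈ Finset.range R, x k * δ l ^ k + δ l ^ R)) (by
          ext p q
          rw [← e1]
          exact h _ (flatIndex_lt p) _ (flatIndex_lt q))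
      exact (mul_eq_zero.1 (congrFun h0 l)).resolve_left (hδ₀ l)
    · intro h p hp q hq
      obtain ⟨p, rfl⟩ := exists_flatIndex hp
      obtain ⟨q, rfl⟩ := exists_flatIndex hq
      rw [e1]
      simp [h]
  obtain ⟨c, h1, h2, h3, h4⟩ := charProg_spec hs rfl hsr hsN
    ⟨fun k => (∏ l, (Polynomial.X - Polynomial.C (δ l))).coeff k, (hrel _).2 fun l => by
      have hm : (∏ l, (Polynomial.X - Polynomial.C (δ l))).Monic :=
        Polynomial.monic_prod_X_sub_C _ _
      have hd : (∏ l, (Polynomial.X - Polynomial.C (δ l))).natDegree = R := by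
        rw [Polynomial.natDegree_finsetProd_X_sub_C_eq_card]
        simp
      have he : (∏ l, (Polynomial.X - Polynomial.C (δ l))).eval (δ l) = 0 := by
        rw [Polynomial.eval_prod]
        exact Finset.prod_eq_zero (Finset.mem_univ l) (by simp)
      rw [Polynomial.eval_eq_sum_range, hd, Finset.sum_range_succ] at he
      rw [Polynomial.Monic, Polynomial.leadingCoeff, hd] at hm
      rwa [hm, one_mul] at he⟩
  obtain ⟨π, hπ⟩ := kthRoot_eq hsN hδ h1 h2 ((hrel c).1 h3)
  exact ⟨π, fun j => by rw [h4 j j.2, hπ]⟩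

theorem forall_mem_span_range_dotProduct {ι κ : Type} [Fintype ι] (f : κ → ι → ℝ) (w : ι → ℝ) :
    (∀ u ∈ Submodule.span ℝ (Set.range f), u ⬝ᵥ w = 0) ↔ ∀ i, f i ⬝ᵥ w = 0 := by
  refine ⟨fun h i => h _ (Submodule.subset_span ⟨i, rfl⟩), fun h u hu => ?_⟩
  induction hu using Submodule.span_induction with
  | mem u hu =>
    obtain ⟨i, rfl⟩ := hu
    exact h i
  | zero => exact zero_dotProduct w
  | add u v _ _ hu hv => rw [add_dotProduct, hu, hv, add_zero]
  | smul t u _ hu => rw [smul_dotProduct, hu, smul_zero]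

namespace Good

variable {hR : R ≤ n₃} {i₀ : Fin n₁} {j₀ j₁ : Fin n₂} {a : Fin R → Fin n₁ → ℝ}
  {b : Fin R → Fin n₂ → ℝ} {c : Fin R → Fin n₃ → ℝ} (h : Good hR i₀ j₀ j₁ a b c)
include h

theorem perpProg_kernel (hL : IsOrthLeftInverse (factorMatrix a b) L) (hs : Sizes n₁ n₂ n₃ st)
    (hT : ∀ (i : Fin n₁) (j : Fin n₂) (k : Fin n₃), st.mem 0 [i, j, k] = cpTensor a b c i j k) :
    HasKernel (factorMatrix a b) (perpProg.exec st) := by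
  set X := factorMatrix a b
  have hrep : Rep (n₁ * n₂) (fun i j => (perpProg.exec st).mem 25 [i, j])
      fun w => Xᵀ *ᵥ (fun p : Fin n₁ × Fin n₂ => w (flatIndex p)) = 0 := by
    refine (perpProg_spec hs).congr_prop fun w => ?_
    have e1 : (Xᵀ *ᵥ (fun p : Fin n₁ × Fin n₂ => w (flatIndex p)) = 0) ↔
        ∀ l, X.col l ⬝ᵥ (fun p : Fin n₁ × Fin n₂ => w (flatIndex p)) = 0 :=
      ⟨fun h l => congrFun h l, fun h => funext h⟩
    rw [e1, ← forall_mem_span_range_dotProduct, ← h.colSpan_eq, colSpan,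
      forall_mem_span_range_dotProduct]
    have e2 : ∀ k : Fin n₃, ∑ i ∈ Finset.range n₁, ∑ j ∈ Finset.range n₂,
        st.mem 0 [i, j, k] * w (i * n₂ + j) =
        (fun p : Fin n₁ × Fin n₂ => cpTensor a b c p.1 p.2 k) ⬝ᵥ fun p => w (flatIndex p) := by
      intro k
      rw [Finset.sum_range, dotProduct, Fintype.sum_prod_type]
      refine Finset.sum_congr rfl fun i _ => ?_
      rw [Finset.sum_range]
      exact Finset.sum_congr rfl fun j _ => by rw [hT]; rfl
    exact ⟨fun h k => by rw [← e2]; exact h k k.2, fun h k hk => (e2 ⟨k, hk⟩).trans (h ⟨k, hk⟩)⟩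
  set K := mat n₁ n₂ (perpProg.exec st) 25 with hK
  have hKX : K * X = 0 := by
    ext p l
    have := congrFun (hrep.row _ (flatIndex_lt p)) l
    rw [Matrix.mul_apply]
    refine Eq.trans ?_ this
    exact Finset.sum_congr rfl fun q _ => mul_comm _ _
  intro v
  refine ⟨fun hv => ⟨L *ᵥ v, ?_⟩, ?_⟩
  · set z := v - X *ᵥ (L *ᵥ v) with hz
    have hXz : Xᵀ *ᵥ z = 0 := by
      rw [hz, mulVec_sub, mulVec_mulVec, mulVec_mulVec, Matrix.mul_assoc, ← hL.symm, transpose_mul,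
        ← Matrix.mul_assoc, hL.transpose_mul_eq_one, Matrix.one_mul, sub_self]
    have hzK : z = z ᵥ* K := by
      ext q
      have := hrep.span (extend z) (by simpa using hXz) _ (flatIndex_lt q)
      rw [sum_range_flat fun i => extend z i * (perpProg.exec st).mem 25 [i, flatIndex q]] at this
      simpa [vecMul, dotProduct, hK, mat] using this
    have h1 : z ⬝ᵥ v = 0 := by
      rw [hzK, ← dotProduct_mulVec, hv, dotProduct_zero]
    have h2 : z ⬝ᵥ X *ᵥ (L *ᵥ v) = 0 := by
      rw [dotProduct_mulVec, ← mulVec_transpose, hXz, zero_dotProduct]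
    have h3 : z ⬝ᵥ z = 0 := by
      nth_rewrite 2 [hz]
      rw [dotProduct_sub, h1, h2, sub_zero]
    exact sub_eq_zero.1 (dotProduct_self_eq_zero.1 h3)
  · rintro ⟨w, rfl⟩
    rw [mulVec_mulVec, hKX, zero_mulVec]

theorem interSystem_rep (hL : IsOrthLeftInverse (factorMatrix a b) L) (hs : Sizes n₁ n₂ n₃ st)
    (hK : HasKernel (factorMatrix a b) st) :
    Rep (n₁ * n₂ * (n₁ * n₂)) (V (interSystem.exec st)) fun w => ∃ d : Fin R → ℝ,
      tens n₁ n₂ w = factorMatrix a b * diagonal d * (factorMatrix a b)ᵀ := by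
  set X := factorMatrix a b
  refine (interSystem_spec hs rfl).congr_prop fun w => ?_
  set Q := tens n₁ n₂ w with hQ
  have e1 : (∀ p < n₁ * n₂, ∀ q < n₁ * n₂, w (p * (n₁ * n₂) + q) - w (q * (n₁ * n₂) + p) = 0) ↔
      Qᵀ = Q := by
    constructor
    · intro h
      ext p q
      exact (sub_eq_zero.1 (h _ (flatIndex_lt p) _ (flatIndex_lt q))).symm
    · intro h p hp q hq
      obtain ⟨p, rfl⟩ := exists_flatIndex hp
      obtain ⟨q, rfl⟩ := exists_flatIndex hq
      exact sub_eq_zero.2 (congrFun (congrFun h q) p)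
  have e2 : (∀ i < n₁ * n₂, ∀ q < n₁ * n₂, ∑ p ∈ Finset.range (n₁ * n₂),
      st.mem 25 [i, p] * w (p * (n₁ * n₂) + q) = 0) ↔ mat n₁ n₂ st 25 * Q = 0 := by
    have : ∀ i q : Fin n₁ × Fin n₂, ∑ p ∈ Finset.range (n₁ * n₂),
        st.mem 25 [flatIndex i, p] * w (p * (n₁ * n₂) + flatIndex q) =
        (mat n₁ n₂ st 25 * Q) i q := fun i q => by
      rw [sum_range_flat fun p => st.mem 25 [flatIndex i, p] * w (p * (n₁ * n₂) + flatIndex q)]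
      rfl
    constructor
    · intro h
      ext i q
      rw [← this]
      exact h _ (flatIndex_lt i) _ (flatIndex_lt q)
    · intro h i hi q hq
      obtain ⟨i, rfl⟩ := exists_flatIndex hi
      obtain ⟨q, rfl⟩ := exists_flatIndex hq
      rw [this, h]
      rfl
  have e3 : (∀ a < n₁, ∀ b < n₂, ∀ c < n₁, ∀ d < n₂, w ((a * n₂ + b) * (n₁ * n₂) + (c * n₂ + d)) -
      w ((a * n₂ + d) * (n₁ * n₂) + (c * n₂ + b)) = 0) ↔
      ∀ A B C D, Q (A, B) (C, D) = Q (A, D) (C, B) :=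
    ⟨fun h A B C D => sub_eq_zero.1 (h A A.2 B B.2 C C.2 D D.2), fun h A hA B hB C hC D hD =>
      sub_eq_zero.2 (h ⟨A, hA⟩ ⟨B, hB⟩ ⟨C, hC⟩ ⟨D, hD⟩)⟩
  rw [e1, e2, e3]
  constructor
  · rintro ⟨h1, h2, h3⟩
    have hXQ : X * L * Q = Q := by
      refine Matrix.ext_of_mulVec_single fun q => ?_
      obtain ⟨v, hv⟩ := (hK (Q *ᵥ Pi.single q 1)).1 (by rw [mulVec_mulVec, h2, zero_mulVec])
      rw [← mulVec_mulVec, hv, mulVec_mulVec, Matrix.mul_assoc, hL.mul_eq_one, Matrix.mul_one]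
    have hS := eq_of_symm_of_mul_eq h1 hXQ
    have hST : (L * Q * Lᵀ)ᵀ = L * Q * Lᵀ := by
      rw [transpose_mul, transpose_mul, transpose_transpose, h1, Matrix.mul_assoc]
    have hdiag := h.isDiag hST (by rw [← hS]; exact (mem_minorsPerp_iff h1).2 h3)
    exact ⟨fun l => (L * Q * Lᵀ) l l, by rw [← hdiag]; exact hS⟩
  · rintro ⟨d, hd⟩
    have h1 : Qᵀ = Q := by rw [hd, transpose_diag]
    refine ⟨h1, ?_, (mem_minorsPerp_iff h1).1 (by rw [hd]; exact diag_mem_minorsPerp _ _ _)⟩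
    refine Matrix.ext_of_mulVec_single fun q => ?_
    rw [← mulVec_mulVec, zero_mulVec, hK]
    exact ⟨_, by rw [hd, Matrix.mul_assoc, ← mulVec_mulVec]⟩

/-- The active rows form a basis `P` of the intersection, dual to the matrix entries at the pivots
`f`. This duality is the last identity. -/
theorem extractProg_basis (hs : Sizes n₁ n₂ n₃ st)
    (hrep : Rep (n₁ * n₂ * (n₁ * n₂)) (V st) fun w => ∃ d : Fin R → ℝ,
      tens n₁ n₂ w = factorMatrix a b * diagonal d * (factorMatrix a b)ᵀ)
    (h0 : ∀ l j, st.mem 50 [l, j] = 0) :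
    (extractProg.exec st).reg 3 = R ∧ (extractProg.exec st).reg 4 = R ∧
    (∀ l, R ≤ l → ∀ j, (extractProg.exec st).mem 50 [l, j] = 0) ∧
    IsBasisOf (fun l : Fin R => tens n₁ n₂ fun j => (extractProg.exec st).mem 50 [l, j])
      (symSquare (colSpan (cpTensor a b c)) ⊓ minorsPerp n₁ n₂) ∧
    ∃ (Z : Matrix (Fin R) (Fin R) ℝ) (f : Fin R → (Fin n₁ × Fin n₂) × (Fin n₁ × Fin n₂)),
      (∀ l : Fin R, tens n₁ n₂ (fun j => (extractProg.exec st).mem 50 [l, j]) =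
        factorMatrix a b * diagonal (Z l) * (factorMatrix a b)ᵀ) ∧
      Z * sampleMatrix a b f = 1 := by
  obtain ⟨h34, f, hf, hsurj, hinj, h50, h50'⟩ := extractProg_spec hs hs.r7 hrep
  set st' := extractProg.exec st
  set s := st'.reg 4 with hsdef
  set P : Fin s → Mat2 n₁ n₂ := fun l => tens n₁ n₂ fun j => st'.mem 50 [l, j] with hP
  have hPV : ∀ (l : Fin s) p q, P l p q = V st (f l) (flatIndex₂ (p, q)) := fun l p q =>
    h50 l l.2 _ (flatIndex₂_lt (p, q))
  choose g hg using fun l : Fin s => exists_flatIndex₂ (hf l l.2).1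
  -- the rows are dual to the coordinates at the pivots
  have hdual : ∀ l k : Fin s, P l (g k).1 (g k).2 = if l = k then 1 else 0 := by
    intro l k
    have h1 : (V st (f k) (f k) = 1 ∧ ∀ i < n₁ * n₂ * (n₁ * n₂), i ≠ f k → V st i (f k) = 0) := by
      refine (hrep.diag _ (hf k k.2).1).resolve_right fun h1 => ?_
      have := h1 _ (hf k k.2).1
      rw [(hf k k.2).2] at this
      exact one_ne_zero this
    rw [hPV, Prod.mk.eta, hg]
    split
    · next hlk => rw [hlk, h1.1]
    · next hlk =>
      exact h1.2 _ (hf l l.2).1 fun h2 => hlk (Fin.ext (hinj l l.2 k k.2 h2))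
  have hmem : ∀ l, ∃ d : Fin R → ℝ, P l = factorMatrix a b * diagonal d * (factorMatrix a b)ᵀ := by
    intro l
    obtain ⟨d, hd⟩ := hrep.row _ (hf l l.2).1
    exact ⟨d, by rw [← hd]; ext p q; exact hPV l p q⟩
  have hbasis : IsBasisOf P (symSquare (colSpan (cpTensor a b c)) ⊓ minorsPerp n₁ n₂) := by
    refine ⟨?_, le_antisymm (Submodule.span_le.2 ?_) fun Q hQ => ?_⟩
    · rw [Fintype.linearIndependent_iff]
      intro e he k
      have := congrFun (congrFun he (g k).1) (g k).2
      rw [Matrix.sum_apply] at this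
      simpa [hdual] using this
    · rintro _ ⟨l, rfl⟩
      exact h.mem_inter_iff.2 (hmem l)
    · obtain ⟨d, hd⟩ := h.mem_inter_iff.1 hQ
      set w : ℕ → ℝ := Function.extend flatIndex₂ (fun t => Q t.1 t.2) 0 with hw
      have hwt : ∀ t, w (flatIndex₂ t) = Q t.1 t.2 := fun t =>
        flatIndex₂_injective.extend_apply _ _ _
      have hwQ : tens n₁ n₂ w = Q := by
        ext p q
        exact hwt (p, q)
      have hsum : Q = ∑ l : Fin s, w (f l) • P l := by
        ext p q
        have h1 := hrep.span w ⟨d, by rw [hwQ, hd]⟩ _ (flatIndex₂_lt (p, q))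
        rw [hwt] at h1
        rw [Matrix.sum_apply]
        refine h1.trans ?_
        symm
        refine Finset.sum_of_injOn (fun l : Fin s => f l) (fun l _ k _ hlk =>
          Fin.ext (hinj l l.2 k k.2 hlk)) (fun l _ => by simpa using (hf l l.2).1) ?_ ?_
        · intro i hi hi'
          have hi := Finset.mem_range.1 hi
          have h2 : V st i i = 0 := by
            by_contra h2
            obtain ⟨l, hl, rfl⟩ := hsurj i hi h2
            exact hi' ⟨⟨l, hl⟩, by simp, rfl⟩
          have h3 := (hrep.diag i hi).resolve_left fun h3 => by
            rw [h3.1] at h2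
            exact one_ne_zero h2
          rw [h3 _ (flatIndex₂_lt _), mul_zero]
        · intro l _
          rw [Matrix.smul_apply, hPV, smul_eq_mul]
      rw [hsum]
      exact Submodule.sum_mem _ fun l _ => Submodule.smul_mem _ _ (Submodule.subset_span ⟨l, rfl⟩)
  obtain ⟨hsR, Z, -, hZ⟩ := h.basis_inter hbasis
  clear_value s
  subst hsR
  refine ⟨h34, rfl, fun l hl j => by rw [h50' l hl, h0], hbasis, Matrix.of Z, g, hZ, ?_⟩
  ext l k
  rw [Matrix.one_apply, ← hdual l k, hZ, diag_apply, Matrix.mul_apply]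
  rfl

end Good

end Stages

end JLV

namespace JLV

open Matrix Prog

/-! ### The program -/

/-- The algorithm, once the sizes of the index ranges are known. The coefficients `α`, `β` are the
first `s` entries of the rows `(0, 0)` and `(0, 1)` of the flattened tensor, and both families of
eigenvectors are the same. -/
def jlvMain : Prog :=
  slicesProg ;; perpProg ;; interSystem ;; extractProg ;; coefProg ;; contract 3 28 ;;
  contract 4 29 ;; pinv 28 51 ;; pinv 29 52 ;; matmul 28 52 38 ;; powProg ;; charProg ;; eigProg ;;
  zProg ;; factorProg ;; thirdProg ;; outP ;; outMat 51 5 ;; outMat 52 6 ;; outX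

/-- A real RAM program for the algorithm. -/
def jlvProg : Prog := sizesProg₁ ;; sizesProg₂ ;; jlvMain

section

variable {n₁ n₂ n₃ R : ℕ} {st : State}

/-- The data in the output arrays, for given numbers `r`, `s`. -/
def readAs (n₁ n₂ n₃ r s : ℕ) (st : State) : Transcript n₁ n₂ n₃ r s where
  u l p := st.mem 1 [l, p.1, p.2]
  P i p q := st.mem 2 [i, p.1, p.2, q.1, q.2]
  α i := st.mem 3 [i]
  β i := st.mem 4 [i]
  Ainv p q := st.mem 5 [p.1, p.2, q.1, q.2]
  Binv p q := st.mem 6 [p.1, p.2, q.1, q.2]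
  μ j := st.mem 7 [j]
  x j p := st.mem 8 [j, p.1, p.2]
  y j p := st.mem 9 [j, p.1, p.2]
  z j i := st.mem 10 [j, i]
  a l i := st.mem 11 [l, i]
  b l j := st.mem 12 [l, j]
  c l k := st.mem 13 [l, k]

/-- If `Z` is the inverse of the sample matrix, then `sampleCoef` is, up to the nonzero factor
`det`, a diagonal coefficient of the contraction of the `Pᵢ`. -/
theorem sampleCoef_eq (hR : R ≤ n₃) (a : Fin R → Fin n₁ → ℝ) (b : Fin R → Fin n₂ → ℝ)
    (c : Fin R → Fin n₃ → ℝ) {f : Fin R → (Fin n₁ × Fin n₂) × (Fin n₁ × Fin n₂)}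
    {Z : Matrix (Fin R) (Fin R) ℝ} (hZ : Z * sampleMatrix a b f = 1) (i₀ : Fin n₁) (j₀ : Fin n₂)
    (l : Fin R) : sampleCoef hR a b c f i₀ j₀ l =
      (sampleMatrix a b f).det * ∑ i, cpTensor a b c i₀ j₀ (Fin.castLE hR i) * Z i l := by
  have hadj : (sampleMatrix a b f).adjugate = (sampleMatrix a b f).det • Z := by
    rw [← Matrix.one_mul (sampleMatrix a b f).adjugate, ← hZ, Matrix.mul_assoc, mul_adjugate,
      Matrix.mul_smul, Matrix.mul_one]
  rw [sampleCoef, hadj, Finset.mul_sum]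
  exact Finset.sum_congr rfl fun i _ => mul_left_comm _ _ _

/-- The rows of arrays `50` and `53` from `s` on have to be zero, as sums over them run up to
`N`. -/
theorem jlvMain_isRun {hR : R ≤ n₃} {h₁ : 0 < n₁} {h₂ : 1 < n₂} {a : Fin R → Fin n₁ → ℝ}
    {b : Fin R → Fin n₂ → ℝ} {c : Fin R → Fin n₃ → ℝ}
    (h : Good hR ⟨0, h₁⟩ ⟨0, zero_lt_one.trans h₂⟩ ⟨1, h₂⟩ a b c) (hRN : R ≤ n₁ * n₂)
    (hs : Sizes n₁ n₂ n₃ st)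
    (hT : ∀ (i : Fin n₁) (j : Fin n₂) (k : Fin n₃), st.mem 0 [i, j, k] = cpTensor a b c i j k)
    (h50 : ∀ l j, st.mem 50 [l, j] = 0) (h53 : ∀ l j, st.mem 53 [l, j] = 0) :
    (jlvMain.exec st).reg 3 = R ∧ (jlvMain.exec st).reg 4 = R ∧
      IsRun (cpTensor a b c) (readAs n₁ n₂ n₃ R R (jlvMain.exec st)) := by
  obtain ⟨L, hL⟩ := h.exists_orthLeftInverse
  have h₂' : 0 < n₂ := zero_lt_one.trans h₂
  simp only [jlvMain, exec_seq]
  have f1 := frame_exec slicesProg st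
  have hu := fun (i : Fin n₁) (j : Fin n₂) (k : Fin n₃) => slicesProg_spec hs i.2 j.2 k.2
  have hs1 := hs.of_frame f1 rfl
  set s1 := slicesProg.exec st
  have f2 := frame_exec perpProg s1
  have hK2 := h.perpProg_kernel hL hs1 (by rwa [f1.mem 0 rfl])
  have hs2 := hs1.of_frame f2 rfl
  set s2 := perpProg.exec s1
  have f3 := frame_exec interSystem s2
  have hrep := h.interSystem_rep hL hs2 hK2
  have hs3 := hs2.of_frame f3 rfl
  set s3 := interSystem.exec s2
  have f4 := frame_exec extractProg s3
  obtain ⟨hr3, hr4, h50', hP, Z, f, hZ, hZM⟩ := h.extractProg_basis hs3 hrep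
    (by rwa [f3.mem 50 rfl, f2.mem 50 rfl, f1.mem 50 rfl])
  have hs4 := hs3.of_frame f4 rfl
  set s4 := extractProg.exec s3
  have f5 := frame_exec coefProg s4
  have hcoef := fun (k : Fin n₃) => coefProg_spec hs4 k.2
  have hs5 := hs4.of_frame f5 rfl
  set s5 := coefProg.exec s4
  have hα' : ∀ i : Fin R, s5.mem 3 [i] = cpTensor a b c ⟨0, h₁⟩ ⟨0, h₂'⟩ (Fin.castLE hR i) := by
    intro i
    refine (hcoef (Fin.castLE hR i)).1.trans ?_
    rw [f4.mem 0 rfl, f3.mem 0 rfl, f2.mem 0 rfl, f1.mem 0 rfl]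
    exact hT ⟨0, h₁⟩ ⟨0, h₂'⟩ _
  have hβ' : ∀ i : Fin R, s5.mem 4 [i] = cpTensor a b c ⟨0, h₁⟩ ⟨1, h₂⟩ (Fin.castLE hR i) := by
    intro i
    refine (hcoef (Fin.castLE hR i)).2.trans ?_
    rw [f4.mem 0 rfl, f3.mem 0 rfl, f2.mem 0 rfl, f1.mem 0 rfl]
    exact hT ⟨0, h₁⟩ ⟨1, h₂⟩ _
  set dα : Fin R → ℝ := fun l => ∑ i : Fin R, s5.mem 3 [i] * Z i l with hdα
  set dβ : Fin R → ℝ := fun l => ∑ i : Fin R, s5.mem 4 [i] * Z i l with hdβ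
  -- the contractions have nonzero coefficients with distinct ratios
  have hdet : (sampleMatrix a b f).det ≠ 0 := by
    intro h0
    have := congrArg Matrix.det hZM
    rw [det_mul, h0, mul_zero, det_one] at this
    exact zero_ne_one this
  have eα : ∀ l, sampleCoef hR a b c f ⟨0, h₁⟩ ⟨0, h₂'⟩ l = (sampleMatrix a b f).det * dα l := by
    intro l
    rw [sampleCoef_eq hR a b c hZM]
    simp only [hdα, hα']
  have eβ : ∀ l, sampleCoef hR a b c f ⟨0, h₁⟩ ⟨1, h₂⟩ l = (sampleMatrix a b f).det * dβ l := by
    intro l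
    rw [sampleCoef_eq hR a b c hZM]
    simp only [hdβ, hβ']
  obtain ⟨hα, hβ, hαβ⟩ := h.coef f hdet
  simp only [eα, eβ] at hα hβ hαβ
  replace hα : ∀ l, dα l ≠ 0 := fun l => right_ne_zero_of_mul (hα l)
  replace hβ : ∀ l, dβ l ≠ 0 := fun l => right_ne_zero_of_mul (hβ l)
  have hinj : Function.Injective fun l => dα l / dβ l := injective_div hβ fun l k hlk h0 =>
    hαβ l k hlk (by linear_combination (sampleMatrix a b f).det ^ 2 * h0)
  have hinj' : Function.Injective (dα * dβ⁻¹) := fun l k hlk => hinj (by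
    simpa only [Pi.mul_apply, Pi.inv_apply, ← div_eq_mul_inv] using hlk)
  have hδ₀ : ∀ l, (dα * dβ⁻¹) l ≠ 0 := fun l => mul_ne_zero (hα l) (inv_ne_zero (hβ l))
  have hZ5 : ∀ l : Fin R, tens n₁ n₂ (fun j => s5.mem 50 [l, j]) =
      factorMatrix a b * diagonal (Z l) * (factorMatrix a b)ᵀ := by rwa [f5.mem 50 rfl]
  have f6 := frame_exec (contract 3 28) s5
  have hA6 := contract_mat (c := 3) (d := 28) (s := R) hs5 (by decide) (by decide) hRN
    (by rwa [f5.mem 50 rfl])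
  rw [sum_smul_diag _ _ hZ5] at hA6
  have hs6 := hs5.of_frame f6 rfl
  set s6 := (contract 3 28).exec s5
  have f7 := frame_exec (contract 4 29) s6
  have hB7 := contract_mat (c := 4) (d := 29) (s := R) hs6 (by decide) (by decide) hRN
    (by rwa [f6.mem 50 rfl, f5.mem 50 rfl])
  rw [f6.mem 50 rfl, f6.mem 4 rfl, sum_smul_diag _ _ hZ5] at hB7
  have hs7 := hs6.of_frame f7 rfl
  set s7 := (contract 4 29).exec s6
  have f8 := frame_exec (pinv 28 51) s7
  have hK7 : HasKernel (factorMatrix a b) s7 := hK2.congr (by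
    rw [f7.mem 25 rfl, f6.mem 25 rfl, f5.mem 25 rfl, f4.mem 25 rfl, f3.mem 25 rfl])
  have hA8 := pinv_mat (a := 28) (d := 51) hL hs7 (by decide) (by decide) hK7 hα
    ((mat_congr (f7.mem 28 rfl)).trans hA6)
  have hs8 := hs7.of_frame f8 rfl
  set s8 := (pinv 28 51).exec s7
  have f9 := frame_exec (pinv 29 52) s8
  have hB9 := pinv_mat (a := 29) (d := 52) hL hs8 (by decide) (by decide)
    (hK7.congr (f8.mem 25 rfl)) hβ ((mat_congr (f8.mem 29 rfl)).trans hB7)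
  have hs9 := hs8.of_frame f9 rfl
  set s9 := (pinv 29 52).exec s8
  have f10 := frame_exec (matmul 28 52 38) s9
  have hM10 := matmul_mat (x := 28) (y := 52) (d := 38) hs9 (by decide) (by decide) (by decide)
  rw [hB9, mat_congr (f9.mem 28 rfl), mat_congr (f8.mem 28 rfl), mat_congr (f7.mem 28 rfl), hA6,
    hL.mul_diag_mul] at hM10
  have hs10 := hs9.of_frame f10 rfl
  set s10 := (matmul 28 52 38).exec s9
  have f11 := frame_exec powProg s10
  have hpow := fun k hk => powProg_mat hs10 (k := k) hk
  have hs11 := hs10.of_frame f11 rfl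
  set s11 := powProg.exec s10
  have hr11 : s11.reg 4 = R := by
    rw [f11.reg 4 rfl, f10.reg 4 rfl, f9.reg 4 rfl, f8.reg 4 rfl, f7.reg 4 rfl, f6.reg 4 rfl,
      f5.reg 4 rfl, hr4]
  have f12 := frame_exec charProg s11
  obtain ⟨π, hπ⟩ := charProg_eigenvalues hL hs11 hr11 hRN hinj' hδ₀ fun k hk => by
    rw [← hM10]
    exact hpow k hk
  have hs12 := hs11.of_frame f12 rfl
  have hr12 : (charProg.exec s11).reg 4 = R := (f12.reg 4 rfl).trans hr11
  set s12 := charProg.exec s11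
  have f13 := frame_exec eigProg s12
  have hx := eigProg_vec hL hs12 hr12 hRN hinj' hδ₀
    ((mat_congr (f12.mem 38 rfl)).trans ((mat_congr (f11.mem 38 rfl)).trans hM10)) hπ
  have h53' : ∀ j, R ≤ j → ∀ p, (eigProg.exec s12).mem 53 [j, p] = 0 := by
    intro j hj p
    rw [eigProg_spec_of_le hs12 rfl hr12 hj, f12.mem 53 rfl, f11.mem 53 rfl, f10.mem 53 rfl,
      f9.mem 53 rfl, f8.mem 53 rfl, f7.mem 53 rfl, f6.mem 53 rfl, f5.mem 53 rfl, f4.mem 53 rfl,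
      f3.mem 53 rfl, f2.mem 53 rfl, f1.mem 53 rfl, h53]
  have hs13 := hs12.of_frame f13 rfl
  have hr13 : (eigProg.exec s12).reg 4 = R := (f13.reg 4 rfl).trans hr12
  set s13 := eigProg.exec s12
  have e50 : s13.mem 50 = s4.mem 50 := by
    rw [f13.mem 50 rfl, f12.mem 50 rfl, f11.mem 50 rfl, f10.mem 50 rfl, f9.mem 50 rfl,
      f8.mem 50 rfl, f7.mem 50 rfl, f6.mem 50 rfl, f5.mem 50 rfl]
  have f14 := frame_exec zProg s13
  have hz := zProg_tens hs13 hRN h53' (by rwa [e50]) hx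
  have hs14 := hs13.of_frame f14 rfl
  have hr14 : (zProg.exec s13).reg 4 = R := (f14.reg 4 rfl).trans hr13
  set s14 := zProg.exec s13
  have f15 := frame_exec factorProg s14
  have hab := fun l : Fin R => factorProg_spec hs14 rfl hr14 hRN l.2
  have hs15 := hs14.of_frame f15 rfl
  set s15 := factorProg.exec s14
  have e53 : s15.mem 53 = s13.mem 53 := by rw [f15.mem 53 rfl, f14.mem 53 rfl]
  have evec : ∀ l, vec n₁ n₂ s15 53 l = vec n₁ n₂ s13 53 l := fun l => by
    funext p
    simp only [vec, e53]
  have f16 := frame_exec thirdProg s15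
  have hc := thirdProg_vec hs15 hRN (by rwa [e53]) (by simpa only [evec] using hx) (by
    rwa [f15.mem 0 rfl, f14.mem 0 rfl, f13.mem 0 rfl, f12.mem 0 rfl, f11.mem 0 rfl, f10.mem 0 rfl,
      f9.mem 0 rfl, f8.mem 0 rfl, f7.mem 0 rfl, f6.mem 0 rfl, f5.mem 0 rfl, f4.mem 0 rfl,
      f3.mem 0 rfl, f2.mem 0 rfl, f1.mem 0 rfl])
  simp only [evec] at hc
  have hs16 := hs15.of_frame f16 rfl
  set s16 := thirdProg.exec s15
  have f17 := frame_exec outP s16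
  have hP17 := fun (l : Fin R) (p q : Fin n₁ × Fin n₂) =>
    outP_spec hs16 rfl (l.2.trans_le hRN) p.1.2 p.2.2 q.1.2 q.2.2
  have hs17 := hs16.of_frame f17 rfl
  set s17 := outP.exec s16
  have f18 := frame_exec (outMat 51 5) s17
  have hA18 := fun (p q : Fin n₁ × Fin n₂) =>
    outMat_spec (s := 51) (d := 5) hs17 (by decide) p.1.2 p.2.2 q.1.2 q.2.2
  have hs18 := hs17.of_frame f18 rfl
  set s18 := (outMat 51 5).exec s17
  have f19 := frame_exec (outMat 52 6) s18
  have hB19 := fun (p q : Fin n₁ × Fin n₂) =>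
    outMat_spec (s := 52) (d := 6) hs18 (by decide) p.1.2 p.2.2 q.1.2 q.2.2
  have hs19 := hs18.of_frame f19 rfl
  set s19 := (outMat 52 6).exec s18
  have f20 := frame_exec outX s19
  have hx20 := fun (l : Fin R) (p : Fin n₁ × Fin n₂) =>
    outX_spec hs19 rfl (l.2.trans_le hRN) p.1.2 p.2.2
  set s20 := outX.exec s19
  -- the contents of the output arrays
  have tu : (readAs n₁ n₂ n₃ R R s20).u = fun (k : Fin R) (p : Fin n₁ × Fin n₂) =>
      cpTensor a b c p.1 p.2 (Fin.castLE hR k) := by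
    funext k p
    rw [← hT, ← hu]
    simp only [readAs, f20.mem 1 rfl, f19.mem 1 rfl, f18.mem 1 rfl, f17.mem 1 rfl, f16.mem 1 rfl,
      f15.mem 1 rfl, f14.mem 1 rfl, f13.mem 1 rfl, f12.mem 1 rfl, f11.mem 1 rfl, f10.mem 1 rfl,
      f9.mem 1 rfl, f8.mem 1 rfl, f7.mem 1 rfl, f6.mem 1 rfl, f5.mem 1 rfl, f4.mem 1 rfl,
      f3.mem 1 rfl, f2.mem 1 rfl, Fin.val_castLE]
  have tP : (readAs n₁ n₂ n₃ R R s20).P = fun l : Fin R =>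
      tens n₁ n₂ fun j => s4.mem 50 [l, j] := by
    funext l p q
    simp only [readAs, f20.mem 2 rfl, f19.mem 2 rfl, f18.mem 2 rfl]
    rw [hP17, f16.mem 50 rfl, f15.mem 50 rfl, f14.mem 50 rfl, e50]
    rfl
  have tα : (readAs n₁ n₂ n₃ R R s20).α = fun i : Fin R => s5.mem 3 [i] := by
    funext i
    simp only [readAs, f20.mem 3 rfl, f19.mem 3 rfl, f18.mem 3 rfl, f17.mem 3 rfl, f16.mem 3 rfl,
      f15.mem 3 rfl, f14.mem 3 rfl, f13.mem 3 rfl, f12.mem 3 rfl, f11.mem 3 rfl, f10.mem 3 rfl,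
      f9.mem 3 rfl, f8.mem 3 rfl, f7.mem 3 rfl, f6.mem 3 rfl]
  have tβ : (readAs n₁ n₂ n₃ R R s20).β = fun i : Fin R => s5.mem 4 [i] := by
    funext i
    simp only [readAs, f20.mem 4 rfl, f19.mem 4 rfl, f18.mem 4 rfl, f17.mem 4 rfl, f16.mem 4 rfl,
      f15.mem 4 rfl, f14.mem 4 rfl, f13.mem 4 rfl, f12.mem 4 rfl, f11.mem 4 rfl, f10.mem 4 rfl,
      f9.mem 4 rfl, f8.mem 4 rfl, f7.mem 4 rfl, f6.mem 4 rfl]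
  have tAinv : (readAs n₁ n₂ n₃ R R s20).Ainv = Lᵀ * diagonal dα⁻¹ * L := by
    rw [← hA8]
    funext p q
    simp only [readAs, f20.mem 5 rfl, f19.mem 5 rfl]
    rw [hA18, f17.mem 51 rfl, f16.mem 51 rfl, f15.mem 51 rfl, f14.mem 51 rfl, f13.mem 51 rfl,
      f12.mem 51 rfl, f11.mem 51 rfl, f10.mem 51 rfl, f9.mem 51 rfl]
    rfl
  have tBinv : (readAs n₁ n₂ n₃ R R s20).Binv = Lᵀ * diagonal dβ⁻¹ * L := by
    rw [← hB9]
    funext p q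
    simp only [readAs, f20.mem 6 rfl]
    rw [hB19, f18.mem 52 rfl, f17.mem 52 rfl, f16.mem 52 rfl, f15.mem 52 rfl, f14.mem 52 rfl,
      f13.mem 52 rfl, f12.mem 52 rfl, f11.mem 52 rfl, f10.mem 52 rfl]
    rfl
  have tμ : ∀ j, (readAs n₁ n₂ n₃ R R s20).μ j = dα (π j) / dβ (π j) := by
    intro j
    rw [div_eq_mul_inv]
    refine Eq.trans ?_ (hπ j)
    simp only [readAs, f20.mem 7 rfl, f19.mem 7 rfl, f18.mem 7 rfl, f17.mem 7 rfl, f16.mem 7 rfl,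
      f15.mem 7 rfl, f14.mem 7 rfl, f13.mem 7 rfl]
  have e53' : s19.mem 53 = s13.mem 53 := by
    rw [f19.mem 53 rfl, f18.mem 53 rfl, f17.mem 53 rfl, f16.mem 53 rfl, e53]
  have tx : (readAs n₁ n₂ n₃ R R s20).x = fun j : Fin R => vec n₁ n₂ s13 53 j := by
    funext j p
    exact (hx20 j p).1.trans (by rw [e53']; rfl)
  have ty : (readAs n₁ n₂ n₃ R R s20).y = fun j : Fin R => vec n₁ n₂ s13 53 j := by
    funext j p
    exact (hx20 j p).2.trans (by rw [e53']; rfl)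
  have tz : ∀ j i, (readAs n₁ n₂ n₃ R R s20).z j i = s14.mem 10 [j, i] := by
    intro j i
    simp only [readAs, f20.mem 10 rfl, f19.mem 10 rfl, f18.mem 10 rfl, f17.mem 10 rfl,
      f16.mem 10 rfl, f15.mem 10 rfl]
  have ta : ∀ l i, (readAs n₁ n₂ n₃ R R s20).a l i = vec n₁ n₂ s13 53 l (i, ⟨0, h₂'⟩) := by
    intro l i
    simp only [readAs, f20.mem 11 rfl, f19.mem 11 rfl, f18.mem 11 rfl, f17.mem 11 rfl,
      f16.mem 11 rfl]
    rw [(hab l).1 i i.2, f14.mem 53 rfl]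
    simp [vec, flatIndex]
  have tb : ∀ l j, (readAs n₁ n₂ n₃ R R s20).b l j =
      vec n₁ n₂ s13 53 l (⟨0, h₁⟩, j) / vec n₁ n₂ s13 53 l (⟨0, h₁⟩, ⟨0, h₂'⟩) := by
    intro l j
    simp only [readAs, f20.mem 12 rfl, f19.mem 12 rfl, f18.mem 12 rfl, f17.mem 12 rfl,
      f16.mem 12 rfl]
    rw [(hab l).2 j j.2, f14.mem 53 rfl]
    simp [vec, flatIndex]
  have tc : ∀ l k, (readAs n₁ n₂ n₃ R R s20).c l k = s16.mem 13 [l, k] := by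
    intro l k
    simp only [readAs, f20.mem 13 rfl, f19.mem 13 rfl, f18.mem 13 rfl, f17.mem 13 rfl]
  refine ⟨?_, ?_, h.isRun (Z := Z) ?_ ?_ ?_ ?_ ?_ ?_ ?_ ?_ π ?_ ?_ ?_ ?_ ?_ ?_⟩
  · rw [f20.reg 3 rfl, f19.reg 3 rfl, f18.reg 3 rfl, f17.reg 3 rfl, f16.reg 3 rfl, f15.reg 3 rfl,
      f14.reg 3 rfl, f13.reg 3 rfl, f12.reg 3 rfl, f11.reg 3 rfl, f10.reg 3 rfl, f9.reg 3 rfl,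
      f8.reg 3 rfl, f7.reg 3 rfl, f6.reg 3 rfl, f5.reg 3 rfl, hr3]
  · rw [f20.reg 4 rfl, f19.reg 4 rfl, f18.reg 4 rfl, f17.reg 4 rfl, f16.reg 4 rfl, f15.reg 4 rfl,
      hr14]
  · rw [tu]
    exact h.isBasisOf_slices
  · rwa [tP]
  · rwa [tP]
  · rwa [tα]
  · rwa [tβ]
  · rwa [tα, tβ]
  · rw [Transcript.A, tAinv, tP, tα, sum_smul_diag _ _ hZ]
    exact hL.isPseudoInverse hα
  · rw [Transcript.B, tBinv, tP, tβ, sum_smul_diag _ _ hZ]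
    exact hL.isPseudoInverse hβ
  · rw [tα, tβ]
    exact tμ
  · rwa [tx]
  · rw [tx, ty]
  · intro i
    rw [tP, tx, ty]
    simp only [tz]
    rw [← e50]
    exact hz i
  · intro l i j
    rw [ta, tb, tx]
    obtain ⟨τ, hτ, hl⟩ := hx l
    have h0 := h.corner (π l)
    have ha := left_ne_zero_of_mul h0
    have hb := right_ne_zero_of_mul h0
    simp only [hl, Pi.smul_apply, smul_eq_mul, col_apply, factorMatrix, of_apply]
    field_simp
  · intro i j k
    rw [tx]
    simp only [tc]
    exact hc i j k

theorem jlvProg_sizes (T : Tensor n₁ n₂ n₃) :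
    Sizes n₁ n₂ n₃ (sizesProg₂.exec (sizesProg₁.exec (inputState T))) :=
  sizesProg_spec (st := inputState T)

theorem jlvProg_isRun {hR : R ≤ n₃} {h₁ : 0 < n₁} {h₂ : 1 < n₂} {a : Fin R → Fin n₁ → ℝ}
    {b : Fin R → Fin n₂ → ℝ} {c : Fin R → Fin n₃ → ℝ}
    (h : Good hR ⟨0, h₁⟩ ⟨0, zero_lt_one.trans h₂⟩ ⟨1, h₂⟩ a b c) (hRN : R ≤ n₁ * n₂) :
    IsRun (cpTensor a b c)
      (readTranscript n₁ n₂ n₃ (jlvProg.run (inputState (cpTensor a b c))).1) := by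
  set st := inputState (cpTensor a b c) with hst
  have f1 := frame_exec sizesProg₁ st
  have f2 := frame_exec sizesProg₂ (sizesProg₁.exec st)
  obtain ⟨h3, h4, hrun⟩ := jlvMain_isRun h hRN (jlvProg_sizes (cpTensor a b c))
    (fun i j k => by
      rw [f2.mem 0 rfl, f1.mem 0 rfl]
      simp [hst, inputState])
    (fun l j => by
      rw [f2.mem 50 rfl, f1.mem 50 rfl]
      rfl)
    (fun l j => by
      rw [f2.mem 53 rfl, f1.mem 53 rfl]
      rfl)
  change IsRun _ (readAs n₁ n₂ n₃ ((jlvMain.exec (sizesProg₂.exec (sizesProg₁.exec st))).reg 3)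
    ((jlvMain.exec (sizesProg₂.exec (sizesProg₁.exec st))).reg 4)
    (jlvMain.exec (sizesProg₂.exec (sizesProg₁.exec st))))
  rw [h3, h4]
  exact hrun

set_option maxRecDepth 10000 in
/-- All loops are bounded by registers with values at most `(n₁ + n₂ + n₃ + 1)⁴`. -/
theorem jlvProg_cost (T : Tensor n₁ n₂ n₃) : (jlvProg.run (inputState T)).2 ≤
    ((sizesProg₁.costPoly + (sizesProg₂.costPoly + jlvMain.costPoly)).comp
      ((Polynomial.X + 1) ^ 4)).eval (n₁ + n₂ + n₃) := by
  set st := inputState T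
  set B := (n₁ + n₂ + n₃ + 1) ^ 4 with hB
  have hsz := jlvProg_sizes T
  have f2 := frame_exec sizesProg₂ (sizesProg₁.exec st)
  have hm : n₁ + n₂ + n₃ + 1 ≤ B := Nat.le_self_pow (by norm_num) _
  have hN : n₁ * n₂ + 1 ≤ (n₁ + n₂ + n₃ + 1) ^ 2 := by nlinarith [Nat.zero_le (n₁ * n₁)]
  have hNN : n₁ * n₂ * (n₁ * n₂) ≤ B := by
    have : B = (n₁ + n₂ + n₃ + 1) ^ 2 * (n₁ + n₂ + n₃ + 1) ^ 2 := by rw [hB]; ring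
    rw [this]
    exact Nat.mul_le_mul (by omega) (by omega)
  have hN' : n₁ * n₂ + 1 ≤ B := hN.trans (Nat.pow_le_pow_right (by omega) (by norm_num))
  have hbounds : ∀ x ∈ jlvMain.bounds, x ∈ [0, 1, 2, 5, 6, 7] := fun x hx => by
    have : (jlvMain.bounds.all fun x => [0, 1, 2, 5, 6, 7].contains x) = true := rfl
    simpa using List.all_eq_true.1 this x hx
  have hwr : ([0, 1, 2, 5, 6, 7].all fun x => !jlvMain.wr.contains x) = true := rfl
  have h1 := run_le sizesProg₁ st B (fun x hx => by
    have hx' : x = 0 := by simpa [sizesProg₁, bounds] using hx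
    subst hx'
    change n₁ ≤ B
    omega) (by decide)
  have h2 := run_le sizesProg₂ (sizesProg₁.exec st) B (fun x hx => by
    have hx' : x = 5 := by simpa [sizesProg₂, bounds] using hx
    subst hx'
    rw [← f2.reg 5 rfl, hsz.r5]
    omega) (by decide)
  have h3 := run_le jlvMain (sizesProg₂.exec (sizesProg₁.exec st)) B (fun x hx => by
    have hx' := hbounds x hx
    simp only [List.mem_cons, List.not_mem_nil, or_false] at hx'
    rcases hx' with rfl | rfl | rfl | rfl | rfl | rfl
    · rw [hsz.r0]; omega
    · rw [hsz.r1]; omega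
    · rw [hsz.r2]; omega
    · rw [hsz.r5]; omega
    · rw [hsz.r6]; omega
    · rw [hsz.r7]; omega) (fun x hx hx' => by
    have := List.all_eq_true.1 hwr x (hbounds x hx)
    simp [hx'] at this)
  simp only [Polynomial.eval_comp, Polynomial.eval_add, Polynomial.eval_pow, Polynomial.eval_X,
    Polynomial.eval_one]
  exact add_le_add h1 (add_le_add h2 h3)

end

end JLV


theorem corollary7p1 :
    ∃ (prog : JLV.Prog) (q : Polynomial ℕ),
      -- polynomial running time, on every input
      (∀ (n₁ n₂ n₃ : ℕ) (T : JLV.Tensor n₁ n₂ n₃),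
        (prog.run (JLV.inputState T)).2 ≤ q.eval (n₁ + n₂ + n₃)) ∧
      ∀ n₁ n₂ n₃ R : ℕ, 2 ≤ n₁ → 2 ≤ n₂ →
        (R : ℝ) ≤ min ((1 / 2 : ℝ) * ((n₁ : ℝ) - 1) * ((n₂ : ℝ) - 2)) (n₃ : ℝ) →
        JLV.GenericComponents n₁ n₂ n₃ R fun a b c =>
          -- every completed run of the JLV algorithm recovers the decomposition
          (∀ (r s : ℕ) (t : JLV.Transcript n₁ n₂ n₃ r s),
            JLV.IsRun (JLV.cpTensor a b c) t → JLV.Recovers t a b c) ∧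
          -- for any bases, and generic coefficients of the two contractions, it does not fail
          (∀ (r s : ℕ) (u : Fin r → JLV.Mat n₁ n₂) (P : Fin s → JLV.Mat2 n₁ n₂),
            JLV.IsBasisOf u (JLV.colSpan (JLV.cpTensor a b c)) →
            JLV.IsBasisOf P (JLV.symSquare (Submodule.span ℝ (Set.range u)) ⊓
              JLV.minorsPerp n₁ n₂) →
            JLV.Generically fun w : Fin s ⊕ Fin s → ℝ =>
              ∃ t : JLV.Transcript n₁ n₂ n₃ r s, JLV.IsRun (JLV.cpTensor a b c) t ∧
                t.u = u ∧ t.P = P ∧ t.α = (fun i => w (Sum.inl i)) ∧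
                t.β = (fun i => w (Sum.inr i))) ∧
          -- the program carries out a completed run, and hence outputs the decomposition
          JLV.IsRun (JLV.cpTensor a b c)
            (JLV.readTranscript n₁ n₂ n₃ (prog.run (JLV.inputState (JLV.cpTensor a b c))).1) ∧
          JLV.Recovers
            (JLV.readTranscript n₁ n₂ n₃ (prog.run (JLV.inputState (JLV.cpTensor a b c))).1)
            a b c := by
  refine ⟨JLV.jlvProg, _, fun n₁ n₂ n₃ T => JLV.jlvProg_cost T, fun n₁ n₂ n₃ R h₁ h₂ hmin => ?_⟩
  obtain ⟨hR, hR'⟩ := JLV.le_of_le_min h₁ hmin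
  have hRN : R ≤ n₁ * n₂ := hR'.trans (Nat.mul_le_mul (Nat.sub_le _ _) (Nat.div_le_self _ _))
  refine (JLV.generic_good h₂ hR hR' ⟨0, by omega⟩ (j₀ := ⟨0, by omega⟩) (j₁ := ⟨1, by omega⟩)
    (by simp)).mono fun w h => ?_
  have hrun := JLV.jlvProg_isRun h hRN
  exact ⟨fun r s t ht => h.recovers ht, fun r s u P hu hP => h.generically_exists_isRun hu hP,
    hrun, h.recovers hrun⟩
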